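/- **Setting.** Let $\mathcal T$ be a nonempty, finite, conforming mesh of nondegenerate closed triangles in $\mathbb R^2$, let $\overline\Omega$ be the union of its triangles, $\Omega$ the interior and $\Gamma=\partial\Omega$ the boundary of $\overline\Omega$, $n$ the outward unit normal on $\Gamma$ (defined off the vertices), and $h$ the largest diameter of a triangle. For $P\ge 0$ let $\mathcal V_h^P$ be the space of continuous functions on $\overline\Omega$ that are polynomials of degree at most $P$ on each triangle. Let $\alpha\in\mathbb R$, $\gamma>0$, $f\in L^2(\Omega)$, $u_{RD},q_{RN}\in L^2(\Gamma)$. Write $(\cdot,\cdot)_A$ for the $L^2(A)$ scalar product, $\partial_n u=\nabla u\cdot n$ with $\nabla u$ on $\Gamma$ the limit from inside $\Omega$, and, for a test function $v$, $$\mathcal I_\Omega(u)=(\nabla u,\nabla v)_\Omega+\alpha(u,v)_\Omega,\qquad \mathcal N_\Gamma(w)=(w,v/\gamma-\partial_n v)_\Gamma .$$ The Nitsche–Robin form for $-\Delta u+\alpha u=f$ in $\Omega$, $u-u_{RD}+\varepsilon(\partial_n u-q_{RN})=0$ on $\Gamma$, is $$R_\varepsilon(u,v)=\mathcal I_\Omega(u)-(f,v)_\Omega-(\partial_n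 u,v)_\Gamma+\tfrac{\gamma}{\gamma+\varepsilon}\mathcal N_\Gamma(u-u_{RD})+\tfrac{\varepsilon\gamma}{\gamma+\varepsilon}\mathcal N_\Gamma(\partial_n u-q_{RN}),$$ and the Robin problem is to find $u\in\mathcal V_h^P$ with $R_\varepsilon(u,v)=0$ for all $v\in\mathcal V_h^P$. For a sequence $(u_m)$ put $f_0=f$, $f_m=0$ $(m\ge1)$, and $q_{N,0}=q_{RN}$, $q_{N,1}=u_{RD}-u_0$, $q_{N,m}=-u_{m-1}$ $(m\ge 2)$. The $m$-th mode problem is $$\mathcal I_\Omega(u_m)-(f_m,v)_\Omega-(q_{N,m},v)_\Gamma-\gamma(\partial_n u_m-q_{N,m},\partial_n v)_\Gamma=\mathcal E_m\quad\forall v\in\mathcal V_h^P,\tag{$*_m$}$$ $$\mathcal E_m=\sum_{\ell=0}^{m-1}(-\gamma)^{m+1-\ell}\,\mathcal N_\Gamma(\partial_n u_\ell-q_{N,\ell}),\qquad \mathcal E_0=0 .$$ Its bilinear form is $a(u,v)=(\nabla u,\nabla v)_\Omega+\alpha(u,v)_\Omega-\gamma(\partial_n u,\partial_n v)_\Gamma$.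 Call $C_I$ a trace constant if $$h\,\|\nabla u\|_{L^2(\Gamma)}^2\le C_I\,\|\nabla u\|_{L^2(\Omega)}^2\qquad\forall u\in\mathcal V_h^P .$$ **Proposition 4.2 (AP property of the Nitsche–Robin method in the Neumann limit $\varepsilon^{-1}\to0$).** 1. *Trace inequality.* For every $P$ and $\kappa>0$ there is $C_I>0$, depending only on $P$ and $\kappa$, which is a trace constant for every mesh all of whose triangles have area at least $\kappa h^2$. 2. *Cascade.* Let $N\ge0$ and $u_0,\dots,u_N\in\mathcal V_h^P$. Then $R_\varepsilon\big(\sum_{m=0}^N\varepsilon^{-m}u_m,v\big)=o(\varepsilon^{-N})$ as $\varepsilon\to\infty$ for every $v\in\mathcal V_h^P$ if and only if $(*_m)$ holds for $m=0,\dots,N$. Moreover, if $u^\varepsilon\in\mathcal V_h^P$ solves the Robin problem for all large $\varepsilon$ and $u^\varepsilon(x)=\sum_{m=0}^N\varepsilon^{-m}u_m(x)+o(\varepsilon^{-N})$ as $\varepsilon\to\infty$ at every $x\in\overline\Omega$, then $(*_m)$ holds for $m=0,\dots,N$. 3. *Consistency.* Suppose that functions $u_0,\dots,u_N$ in $C^2(\Omega)\cap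 C^1(\overline\Omega)$ solve the exact mode problems $-\Delta u_m+\alpha u_m=f_m$ in $\Omega$, $\partial_n u_m=q_{N,m}$ almost everywhere on $\Gamma$, $m=0,\dots,N$. Then they satisfy $(*_m)$, and $\mathcal E_m=0$ for all $v\in\mathcal V_h^P$, for $m=0,\dots,N$. 4. *Coercivity.* Let $C_I$ be a trace constant and $1-h^{-1}C_I\gamma\ge C>0$. Then for all $u\in\mathcal V_h^P$ $$a(u,u)\ge(1-h^{-1}C_I\gamma)\|\nabla u\|_{L^2(\Omega)}^2+\alpha\|u\|_{L^2(\Omega)}^2\ge C\|\nabla u\|_{L^2(\Omega)}^2+\alpha\|u\|_{L^2(\Omega)}^2 .$$ If in addition $\alpha>0$, then $a(u,u)\ge\min(C,\alpha)\big(\|\nabla u\|_{L^2(\Omega)}^2+\|u\|_{L^2(\Omega)}^2\big)$; for every $m$, given $u_0,\dots,u_{m-1}\in\mathcal V_h^P$, problem $(*_m)$ has exactly one solution $u_m\in\mathcal V_h^P$; for all large $\varepsilon$ the Robin problem has exactly one solution $u^\varepsilon\in\mathcal V_h^P$; and if $u_0,\dots,u_N\in\mathcal V_h^P$ solve $(*_0),\dots,(*_N)$,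 there is $K$ with $\sup_{\overline\Omega}\big|u^\varepsilon-\sum_{m=0}^N\varepsilon^{-m}u_m\big|\le K\varepsilon^{-(N+1)}$ for all large $\varepsilon$. -/

import Mathlib

open MeasureTheory Set Filter Topology Gradient Asymptotics

noncomputable section

namespace NitscheRobin

/-- The Euclidean plane. -/
abbrev Plane : Type := EuclideanSpace ℝ (Fin 2)

/-- A conforming triangular mesh of a bounded polygonal region of the plane: a nonempty finite
simplicial complex in which every vertex and every edge belongs to some triangle. -/
structure TriMesh extends Geometry.SimplicialComplex ℝ Plane where
  /-- there is at least one face -/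
  faces_nonempty : faces.Nonempty
  /-- there are finitely many faces -/
  faces_finite : faces.Finite
  /-- every face is a face of a triangle -/
  pure : ∀ s ∈ faces, ∃ t ∈ faces, s ⊆ t ∧ t.card = 3

namespace TriMesh

/-- The vertex sets of the triangles (the elements) of the mesh. -/
def elements (M : TriMesh) : Set (Finset Plane) := {t | t ∈ M.faces ∧ t.card = 3}

/-- The closed triangle with vertex set `t`. -/
def cell (t : Finset Plane) : Set Plane := convexHull ℝ (t : Set Plane)

/-- The closed meshed region, the union of all closed triangles. -/
def closedRegion (M : TriMesh) : Set Plane := M.toSimplicialComplex.space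

/-- The domain `Ω` (an open set). -/
def Ω (M : TriMesh) : Set Plane := interior M.closedRegion

/-- The boundary `Γ` of the domain. -/
def Γ (M : TriMesh) : Set Plane := frontier M.closedRegion

/-- Lebesgue measure on `Ω`. -/
def vol (M : TriMesh) : Measure Plane := (volume : Measure Plane).restrict M.Ω

/-- Arc length on `Γ`. -/
def surf (M : TriMesh) : Measure Plane := (Measure.hausdorffMeasure 1).restrict M.Γ

/-- The mesh size `h`, the largest diameter of a triangle. -/
def h (M : TriMesh) : ℝ := sSup ((fun t => Metric.diam (cell t)) '' M.elements)

/-- The mesh is quasi-uniform and shape-regular with constant `κ`: every triangle has area at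
least `κ h²`. -/
def IsRegular (M : TriMesh) (κ : ℝ) : Prop :=
  ∀ t ∈ M.elements, κ * M.h ^ 2 ≤ (volume : Measure Plane).real (cell t)

/-- `ν` is the outward unit normal at `x`: near `x` the closed region is the half plane
`⟪y - x, ν⟫ ≤ 0`. -/
def IsOutwardUnitNormal (M : TriMesh) (x ν : Plane) : Prop :=
  ‖ν‖ = 1 ∧ ∃ r > 0, ∀ y ∈ Metric.ball x r, y ∈ M.closedRegion ↔ inner ℝ (y - x) ν ≤ 0

open Classical in
/-- The outward unit normal `n` on `Γ`. It exists and is unique at all points of `Γ` except at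
finitely many vertices, where a value is immaterial. -/
def normal (M : TriMesh) (x : Plane) : Plane :=
  if hx : ∃ ν, M.IsOutwardUnitNormal x ν then hx.choose else 0

/-- The trace on `Γ` of the gradient of `u`: its limit from inside `Ω`. -/
def gradTrace (M : TriMesh) (u : Plane → ℝ) (x : Plane) : Plane :=
  limUnder (𝓝[M.Ω] x) (∇ u)

/-- The normal derivative `∂ₙu = ∇u · n` on `Γ`. -/
def dn (M : TriMesh) (u : Plane → ℝ) (x : Plane) : ℝ := inner ℝ (M.gradTrace u x) (M.normal x)

/-- The finite element space of continuous functions on the closed region that are polynomials of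
degree at most `P` on every triangle. Such a function is represented by its extension by zero to
the plane. -/
def V (M : TriMesh) (P : ℕ) : Submodule ℝ (Plane → ℝ) where
  carrier := {v | ContinuousOn v M.closedRegion ∧
    (∀ t ∈ M.elements, ∃ p : MvPolynomial (Fin 2) ℝ, p.totalDegree ≤ P ∧
      ∀ x ∈ cell t, v x = MvPolynomial.eval (fun i => x i) p) ∧
    ∀ x ∉ M.closedRegion, v x = 0}
  zero_mem' := ⟨continuousOn_const, fun _ _ => ⟨0, by simp⟩, fun _ _ => rfl⟩
  add_mem' := by
    rintro u v ⟨hu, hup, hu0⟩ ⟨hv, hvp, hv0⟩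
    refine ⟨hu.add hv, fun t ht => ?_, fun x hx => by simp [hu0 x hx, hv0 x hx]⟩
    obtain ⟨p, hp, hpe⟩ := hup t ht
    obtain ⟨q, hq, hqe⟩ := hvp t ht
    exact ⟨p + q, (MvPolynomial.totalDegree_add p q).trans (max_le hp hq),
      fun x hx => by simp [hpe x hx, hqe x hx]⟩
  smul_mem' := by
    rintro c v ⟨hv, hvp, hv0⟩
    refine ⟨continuousOn_const.smul hv, fun t ht => ?_, fun x hx => by simp [hv0 x hx]⟩
    obtain ⟨p, hp, hpe⟩ := hvp t ht
    exact ⟨c • p, (MvPolynomial.totalDegree_smul_le c p).trans hp,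
      fun x hx => by simp [hpe x hx, MvPolynomial.smul_eval]⟩

/-- The `L²` scalar product of scalar functions over `Ω`. -/
def ipΩ (M : TriMesh) (f g : Plane → ℝ) : ℝ := ∫ x, f x * g x ∂M.vol

/-- The `L²` scalar product of scalar functions over `Γ`. -/
def ipΓ (M : TriMesh) (f g : Plane → ℝ) : ℝ := ∫ x, f x * g x ∂M.surf

/-- The product `(∇u, ∇v)_Ω`. -/
def gradIp (M : TriMesh) (u v : Plane → ℝ) : ℝ := ∫ x, inner ℝ (∇ u x) (∇ v x) ∂M.vol

/-- The volume form `I_Ω(u) = (∇u, ∇v)_Ω + α (u, v)_Ω`. -/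
def formI (M : TriMesh) (α : ℝ) (u v : Plane → ℝ) : ℝ := M.gradIp u v + α * M.ipΩ u v

/-- The boundary form `N_Γ(w) = (w, v / γ - ∂ₙv)_Γ`. -/
def formN (M : TriMesh) (γ : ℝ) (w v : Plane → ℝ) : ℝ :=
  M.ipΓ w (fun x => v x / γ - M.dn v x)

/-- The left-hand side of the Nitsche-Robin method for the boundary condition
`u - uRD + ε (∂ₙu - qRN) = 0`, at trial function `u` and test function `v`. -/
def robinResidual (M : TriMesh) (α γ : ℝ) (f uRD qRN : Plane → ℝ) (ε : ℝ)
    (u v : Plane → ℝ) : ℝ :=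
  M.formI α u v - M.ipΩ f v - M.ipΓ (M.dn u) v
    + γ / (γ + ε) * M.formN γ (u - uRD) v
    + ε * γ / (γ + ε) * M.formN γ (M.dn u - qRN) v

/-- The bilinear form `(∇u, ∇v)_Ω + α (u, v)_Ω - γ (∂ₙu, ∂ₙv)_Γ` of the mode problems. -/
def neumannForm (M : TriMesh) (α γ : ℝ) (u v : Plane → ℝ) : ℝ :=
  M.formI α u v - γ * M.ipΓ (M.dn u) (M.dn v)

/-- `C_I` is a trace constant: `h ‖∇u‖²_Γ ≤ C_I ‖∇u‖²_Ω` on the finite element space. -/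
def IsTraceConstant (M : TriMesh) (P : ℕ) (CI : ℝ) : Prop :=
  ∀ u ∈ M.V P, M.h * ∫ x, ‖M.gradTrace u x‖ ^ 2 ∂M.surf ≤ CI * ∫ x, ‖∇ u x‖ ^ 2 ∂M.vol

end TriMesh

/-- The sources of the modes: `f₀ = f` and `f_m = 0` for `m ≥ 1`. -/
def modeSource (f : Plane → ℝ) : ℕ → Plane → ℝ
  | 0 => f
  | _ + 1 => 0

/-- The Neumann data of the modes in the expansion `u = ∑ ε⁻ᵐ u_m`, obtained by equating powers of
`ε⁻¹` in `∂ₙu - qRN + ε⁻¹ (u - uRD) = 0`. -/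
def modeFlux (uRD qRN : Plane → ℝ) (u : ℕ → Plane → ℝ) : ℕ → Plane → ℝ
  | 0 => qRN
  | 1 => uRD - u 0
  | m + 2 => -u (m + 1)

namespace TriMesh

/-- The error term `E_m = ∑_{ℓ < m} (-γ)^(m+1-ℓ) N_Γ(∂ₙu_ℓ - q_{N,ℓ})`. -/
def errorTerm (M : TriMesh) (γ : ℝ) (uRD qRN : Plane → ℝ) (u : ℕ → Plane → ℝ) (m : ℕ)
    (v : Plane → ℝ) : ℝ :=
  ∑ l ∈ Finset.range m,
    (-γ) ^ (m + 1 - l) * M.formN γ (M.dn (u l) - modeFlux uRD qRN u l) v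

/-- The equation tested by `v` for the `m`-th mode `z`, where `u l` for `l < m` are the previous
modes (`u l` for `l ≥ m` does not occur). -/
def ModeEq (M : TriMesh) (α γ : ℝ) (f uRD qRN : Plane → ℝ) (u : ℕ → Plane → ℝ) (m : ℕ)
    (z v : Plane → ℝ) : Prop :=
  M.formI α z v - M.ipΩ (modeSource f m) v - M.ipΓ (modeFlux uRD qRN u m) v
    - γ * M.ipΓ (M.dn z - modeFlux uRD qRN u m) (M.dn v) = M.errorTerm γ uRD qRN u m v

/-- `u` is a classical solution, of class `C²` in `Ω` and `C¹` up to the boundary, of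
`-Δu + α u = f` in `Ω`, `∂ₙu = q` on `Γ`. -/
structure IsClassicalNeumann (M : TriMesh) (α : ℝ) (f q u : Plane → ℝ) : Prop where
  smooth : ContDiffOn ℝ 2 u M.Ω
  cont : ContinuousOn u M.closedRegion
  grad : ∃ G : Plane → Plane, ContinuousOn G M.closedRegion ∧ EqOn G (∇ u) M.Ω
  pde : ∀ x ∈ M.Ω, -Laplacian.laplacian u x + α * u x = f x
  flux : ∀ᵐ x ∂M.surf, M.dn u x = q x

end TriMesh

end NitscheRobin

end

open NitscheRobin

noncomputable section

namespace NitscheRobin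

/-! Trace inequality. Let `T` be a triangle with edge `e` opposite to a vertex, and let `D` be twice
its area. On each ray from that vertex to `e`, a polynomial `p` becomes a one-variable polynomial
`r`. Compactness of the unit sphere of coefficients gives `r(1)² ≤ C ∫₀¹ s r(s)² ds`, with `C`
depending only on the degree. The weight `s` is, up to the factor `D`, the Jacobian of the collapsed
coordinates, so integration over the rays yields `∫_e p² ≤ C (|e| / D) ∫_T p²`. This is applied to
the partial derivatives of a finite element function, with `|e| ≤ h` and `D ≥ 2κh²`
(`exists_isTraceConstant`).

Cascade. Since `γ N_Γ(w) = (w, v)_Γ - γ (w, ∂ₙv)_Γ`, the Robin form equals `a(u, v) + γ/(γ+ε) b(u,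
v)` minus a load, where `b(u, v) = N_Γ(u) - γ N_Γ(∂ₙu)` (`robinResidual_eq`). Multiplication by `1 +
γ/ε`, which tends to `1`, makes the residual of a partial sum a polynomial in `ε⁻¹`
(`robinResidual_sum`). Let `B_m` be the left side of the `m`-th mode equation and `n_m = N_Γ(∂ₙu_m -
q_{N,m})`. The coefficients are `B_0` and `B_{m+1} + γ B_m - γ² n_m`, up to a remainder of order
`ε^{-(N+1)}`. They vanish exactly when `B_m = E_m`, because `E_{m+1} = -γ E_m + γ² n_m`
(`cascadeCoeff_eq_zero_iff`). A pointwise expansion of the Robin solutions suffices: on a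
finite-dimensional function space every functional is a finite combination of point evaluations
(`exists_eval_repr`).

Consistency. The fluxes of exact modes equal their Neumann data, so all `N_Γ` terms drop out and
Green's formula remains (`IsClassicalNeumann.green`). It is proved triangle by triangle. The
divergence theorem on a triangle is the one on the square pulled back by collapsed coordinates. In
the sum the normals cancel on interior edges and give the outward normal on `Γ`.

Coercivity. `|∂ₙu| ≤ |∇u|` and the trace inequality absorb the negative boundary term. For `α > 0`
the form is definite, hence nondegenerate, and so are its small perturbations, with a uniform
stability constant (`exists_stable`). This gives unique solvability, and it turns the residual bound
for the partial sum into the error bound. -/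

/-- The scalar cross product in the plane. -/
def cross (u v : Plane) : ℝ := u 0 * v 1 - u 1 * v 0

/-- Rotation by a right angle, clockwise. -/
def rot (u : Plane) : Plane := !₂[u 1, -u 0]

theorem inner_rot (u v : Plane) : inner ℝ v (rot u) = cross v u := by
  simp [rot, cross, PiLp.inner_apply, Fin.sum_univ_two]; ring

theorem cross_swap (u v : Plane) : cross u v = -cross v u := by
  simp only [cross]; ring

theorem cross_add_right (u v w : Plane) : cross u (v + w) = cross u v + cross u w := by
  simp only [cross, PiLp.add_apply]; ring

theorem cross_sub_right (u v w : Plane) : cross u (v - w) = cross u v - cross u w := by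
  simp only [cross, PiLp.sub_apply]; ring

theorem cross_smul_right (c : ℝ) (u v : Plane) : cross u (c • v) = c * cross u v := by
  simp only [cross, PiLp.smul_apply, smul_eq_mul]; ring

@[fun_prop]
theorem continuous_cross {X : Type*} [TopologicalSpace X] {f g : X → Plane} (hf : Continuous f)
    (hg : Continuous g) : Continuous fun x => cross (f x) (g x) := by
  unfold cross; fun_prop

theorem norm_rot (u : Plane) : ‖rot u‖ = ‖u‖ := by
  simp [EuclideanSpace.norm_eq, rot, Fin.sum_univ_two, add_comm]

/-! ### Outward normals of sets that are locally half planes -/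

/-- Near `x` the set `K` is the half plane with outward unit normal `ν`. -/
def IsOutNormal (K : Set Plane) (x ν : Plane) : Prop :=
  ‖ν‖ = 1 ∧ ∃ r > 0, ∀ y ∈ Metric.ball x r, y ∈ K ↔ inner ℝ (y - x) ν ≤ 0

theorem IsOutNormal.mem_interior {K : Set Plane} {x ν d : Plane} (h : IsOutNormal K x ν)
    (hd : inner ℝ d ν < 0) : ∀ᶠ s in 𝓝[>] (0 : ℝ), x + s • d ∈ interior K := by
  obtain ⟨-, r, hr, H⟩ := h
  have hop : IsOpen (Metric.ball x r ∩ {y | inner ℝ (y - x) ν < 0}) :=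
    Metric.isOpen_ball.inter (isOpen_lt (by fun_prop) continuous_const)
  have hsub : Metric.ball x r ∩ {y | inner ℝ (y - x) ν < 0} ⊆ interior K :=
    interior_maximal (fun y hy => (H y hy.1).2 (le_of_lt hy.2)) hop
  have h1 : ∀ᶠ s in 𝓝[>] (0 : ℝ), x + s • d ∈ Metric.ball x r := by
    have : Tendsto (fun s : ℝ => x + s • d) (𝓝[>] 0) (𝓝 x) := by
      have : Continuous fun s : ℝ => x + s • d := by fun_prop
      have := this.tendsto 0
      simp only [zero_smul, add_zero] at this
      exact this.mono_left nhdsWithin_le_nhds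
    exact this (Metric.ball_mem_nhds x hr)
  filter_upwards [h1, self_mem_nhdsWithin] with s hs hs0
  refine hsub ⟨hs, ?_⟩
  simp only [add_sub_cancel_left, mem_ofPred_eq, real_inner_smul_left]
  exact mul_neg_of_pos_of_neg hs0 hd

theorem inner_lt_one_of_ne {ν ν' : Plane} (h : ‖ν‖ = 1) (h' : ‖ν'‖ = 1) (hne : ν ≠ ν') :
    inner ℝ ν ν' < 1 := (inner_lt_one_iff_real_of_norm_eq_one h h').2 hne

/-- If the normals differed, the direction `ν' - ν` would point strictly into one half plane and
strictly out of the other. -/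
theorem IsOutNormal.eq {K : Set Plane} {x ν ν' : Plane} (h : IsOutNormal K x ν)
    (h' : IsOutNormal K x ν') : ν = ν' := by
  by_contra hne
  have hc := inner_lt_one_of_ne h.1 h'.1 hne
  have h1 : inner ℝ (ν' - ν) ν < 0 := by
    rw [inner_sub_left, real_inner_self_eq_norm_sq, h.1, real_inner_comm]; linarith
  have h2 := h.mem_interior h1
  obtain ⟨hν', r, hr, H⟩ := h'
  have h3 : ∀ᶠ s in 𝓝[>] (0 : ℝ), x + s • (ν' - ν) ∈ Metric.ball x r := by
    have : Continuous fun s : ℝ => x + s • (ν' - ν) := by fun_prop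
    have := this.tendsto 0
    simp only [zero_smul, add_zero] at this
    exact (this.mono_left nhdsWithin_le_nhds) (Metric.ball_mem_nhds x hr)
  obtain ⟨s, hs, hsr, hs0⟩ := (h2.and (h3.and self_mem_nhdsWithin)).exists
  have := (H _ hsr).1 (interior_subset hs)
  simp only [add_sub_cancel_left, real_inner_smul_left, inner_sub_left,
    real_inner_self_eq_norm_sq, hν'] at this
  have : 0 < s * (1 ^ 2 - inner ℝ ν ν') := mul_pos hs0 (by linarith)
  linarith

/-- Unless the normals are opposite, the direction `-(ν + ν')` points strictly into both half
planes, and a short step along it reaches both interiors. -/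
theorem IsOutNormal.eq_neg_of_disjoint {K K' : Set Plane} {x ν ν' : Plane}
    (h : IsOutNormal K x ν) (h' : IsOutNormal K' x ν')
    (hd : Disjoint (interior K) (interior K')) : ν' = -ν := by
  by_contra hne
  have hc := inner_lt_one_of_ne (ν := ν') (ν' := -ν) h'.1 (by rw [norm_neg, h.1]) hne
  rw [inner_neg_right] at hc
  have h1 : inner ℝ (-(ν + ν')) ν < 0 := by
    rw [inner_neg_left, inner_add_left, real_inner_self_eq_norm_sq, h.1]; linarith
  have h2 : inner ℝ (-(ν + ν')) ν' < 0 := by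
    rw [inner_neg_left, inner_add_left, real_inner_self_eq_norm_sq, h'.1, real_inner_comm]
    linarith
  obtain ⟨s, hs, hs'⟩ := ((h.mem_interior h1).and (h'.mem_interior h2)).exists
  exact Set.disjoint_left.1 hd hs hs'

theorem IsOutNormal.notMem_interior_of_disjoint {K K' : Set Plane} {x ν : Plane}
    (h : IsOutNormal K x ν) (hd : Disjoint (interior K) (interior K')) : x ∉ interior K' := by
  intro hx
  have h1 : inner ℝ (-ν) ν < 0 := by
    rw [inner_neg_left, real_inner_self_eq_norm_sq, h.1]; norm_num
  have h3 : ∀ᶠ s in 𝓝[>] (0 : ℝ), x + s • (-ν) ∈ interior K' := by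
    have : Continuous fun s : ℝ => x + s • (-ν) := by fun_prop
    have := this.tendsto 0
    simp only [zero_smul, add_zero] at this
    exact (this.mono_left nhdsWithin_le_nhds) (isOpen_interior.mem_nhds hx)
  obtain ⟨s, hs, hs'⟩ := ((h.mem_interior h1).and h3).exists
  exact Set.disjoint_left.1 hd hs hs'

theorem IsOutNormal.congr {K K' : Set Plane} {x ν : Plane} (h : IsOutNormal K x ν)
    (hK : ∀ᶠ y in 𝓝 x, y ∈ K ↔ y ∈ K') : IsOutNormal K' x ν := by
  obtain ⟨hν, r, hr, H⟩ := h
  obtain ⟨r', hr', H'⟩ := Metric.eventually_nhds_iff_ball.1 hK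
  refine ⟨hν, min r r', lt_min hr hr', fun y hy => ?_⟩
  rw [← H' y (Metric.ball_subset_ball (min_le_right _ _) hy),
    H y (Metric.ball_subset_ball (min_le_left _ _) hy)]

/-! ### Triangles in barycentric coordinates -/

/-- A nondegenerate triangle with positively oriented vertices. -/
structure Tri where
  /-- the vertices -/
  p : Fin 3 → Plane
  /-- positive orientation -/
  pos : 0 < cross (p 1 - p 0) (p 2 - p 0)

namespace Tri

variable (T : Tri)

/-- Twice the area. -/
def D : ℝ := cross (T.p 1 - T.p 0) (T.p 2 - T.p 0)

theorem D_pos : 0 < T.D := T.pos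

/-- The edge vector opposite to the vertex `i`. -/
def e (i : Fin 3) : Plane := T.p (i + 2) - T.p (i + 1)

/-- Barycentric coordinates. -/
def bary (i : Fin 3) (x : Plane) : ℝ := cross (T.e i) (x - T.p (i + 1)) / T.D

/-- The closed triangle. -/
def carrier : Set Plane := convexHull ℝ (range T.p)

/-- The edge opposite to the vertex `i`. -/
def edge (i : Fin 3) : Set Plane := segment ℝ (T.p (i + 1)) (T.p (i + 2))

/-- The outward unit normal on the edge opposite to the vertex `i`. -/
def ν (i : Fin 3) : Plane := ‖T.e i‖⁻¹ • rot (T.e i)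

theorem bary_sub (i : Fin 3) (x y : Plane) :
    T.bary i y - T.bary i x = cross (T.e i) (y - x) / T.D := by
  simp only [bary, cross_sub_right]; ring

theorem bary_add_smul (i : Fin 3) (x y : Plane) (s : ℝ) :
    T.bary i (x + s • y) = T.bary i x + s * (cross (T.e i) y / T.D) := by
  have := T.bary_sub i x (x + s • y)
  rw [add_sub_cancel_left, cross_smul_right] at this
  linear_combination this

theorem cross_e (i : Fin 3) : cross (T.e i) (T.e (i + 1)) = T.D := by
  fin_cases i <;> simp [e, D, cross] <;> ring

theorem bary_self (i : Fin 3) : T.bary i (T.p i) = 1 := by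
  have := T.D_pos.ne'
  rw [bary, div_eq_one_iff_eq this]
  fin_cases i <;> simp [e, D, cross] <;> ring

theorem bary_ne {i j : Fin 3} (h : i ≠ j) : T.bary i (T.p j) = 0 := by
  rw [bary, div_eq_zero_iff]; left
  fin_cases i <;> fin_cases j <;> simp [e, cross] at h ⊢ <;> ring

theorem sum_bary (x : Plane) : ∑ i, T.bary i x = 1 := by
  have := T.D_pos.ne'
  simp only [bary, ← Finset.sum_div]
  rw [div_eq_one_iff_eq this]
  simp [Fin.sum_univ_three, e, D, cross]; ring

theorem sum_bary_smul (x : Plane) : ∑ i, T.bary i x • T.p i = x := by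
  have hD := T.D_pos.ne'
  have key : ∀ k : Fin 2, ∑ i, T.bary i x * T.p i k = x k := by
    intro k
    have : ∑ i, T.bary i x * T.p i k
        = (∑ i, cross (T.e i) (x - T.p (i + 1)) * T.p i k) / T.D := by
      rw [Finset.sum_div]; refine Finset.sum_congr rfl fun i _ => by rw [bary]; ring
    rw [this, div_eq_iff hD]
    fin_cases k <;> simp [Fin.sum_univ_three, e, D, cross] <;> ring
  ext k
  simpa using key k

@[fun_prop]
theorem continuous_bary (i : Fin 3) : Continuous (T.bary i) := by
  unfold bary; fun_prop

theorem bary_convexComb (i : Fin 3) (x y : Plane) {a b : ℝ} (h : a + b = 1) :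
    T.bary i (a • x + b • y) = a * T.bary i x + b * T.bary i y := by
  have : a • x + b • y = x + b • (y - x) := by
    rw [← eq_sub_iff_add_eq] at h; rw [h]; module
  rw [this, bary_add_smul, ← bary_sub]
  rw [← eq_sub_iff_add_eq] at h; rw [h]; ring

theorem convex_bary_nonneg (i : Fin 3) : Convex ℝ {x | 0 ≤ T.bary i x} := by
  intro x hx y hy a b ha hb hab
  simp only [mem_ofPred_eq] at *
  rw [T.bary_convexComb i x y hab]; positivity

theorem convex_bary_zero (i : Fin 3) : Convex ℝ {x | T.bary i x = 0} := by
  intro x hx y hy a b ha hb hab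
  simp only [mem_ofPred_eq] at *
  rw [T.bary_convexComb i x y hab, hx, hy]; simp

theorem mem_carrier_iff (x : Plane) : x ∈ T.carrier ↔ ∀ i, 0 ≤ T.bary i x := by
  constructor
  · intro hx i
    refine convexHull_min (s := range T.p) (t := {x | 0 ≤ T.bary i x}) ?_
      (T.convex_bary_nonneg i) hx
    rintro _ ⟨j, rfl⟩
    by_cases h : i = j
    · subst h; simp [bary_self]
    · simp [T.bary_ne h]
  · intro h
    rw [← T.sum_bary_smul x]
    exact (convex_convexHull ℝ (range T.p)).sum_mem (fun i _ => h i) (T.sum_bary x)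
      fun i _ => subset_convexHull ℝ _ ⟨i, rfl⟩

theorem isCompact_carrier : IsCompact T.carrier :=
  (Set.finite_range T.p).isCompact_convexHull ℝ

theorem isClosed_carrier : IsClosed T.carrier := T.isCompact_carrier.isClosed

theorem convex_carrier : Convex ℝ T.carrier := convex_convexHull ℝ _

theorem mem_interior_iff (x : Plane) : x ∈ interior T.carrier ↔ ∀ i, 0 < T.bary i x := by
  constructor
  · intro hx i
    have h0 := (T.mem_carrier_iff x).1 (interior_subset hx) i
    refine lt_of_le_of_ne h0 fun h => ?_
    -- Moving away from the vertex `p i` lowers the `i`-th coordinate, so a point where it is zero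
    -- would leave the triangle at once.
    have h3 : ∀ᶠ s in 𝓝[>] (0 : ℝ), x + s • (x - T.p i) ∈ interior T.carrier := by
      have : Continuous fun s : ℝ => x + s • (x - T.p i) := by fun_prop
      have := this.tendsto 0
      simp only [zero_smul, add_zero] at this
      exact (this.mono_left nhdsWithin_le_nhds) (isOpen_interior.mem_nhds hx)
    obtain ⟨s, hs, hs0⟩ := (h3.and self_mem_nhdsWithin).exists
    have := (T.mem_carrier_iff _).1 (interior_subset hs) i
    rw [bary_add_smul, ← bary_sub, bary_self, ← h] at this
    have h0 : (0:ℝ) < s := hs0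
    linarith
  · intro h
    have hop : IsOpen {x | ∀ i, 0 < T.bary i x} := by
      simp only [ofPred_forall]
      exact isOpen_iInter_of_finite fun i => isOpen_lt continuous_const (T.continuous_bary i)
    exact interior_maximal (fun y hy => (T.mem_carrier_iff y).2 fun i => (hy i).le) hop h

theorem e_ne_zero (i : Fin 3) : T.e i ≠ 0 := by
  intro h
  have := T.cross_e i
  rw [h] at this
  have h2 := T.D_pos
  simp [cross] at this
  linarith

theorem norm_e_pos (i : Fin 3) : 0 < ‖T.e i‖ := norm_pos_iff.2 (T.e_ne_zero i)

theorem norm_ν (i : Fin 3) : ‖T.ν i‖ = 1 := by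
  rw [ν, norm_smul, norm_rot, norm_inv, norm_norm, inv_mul_cancel₀ (T.norm_e_pos i).ne']

theorem inner_ν (i : Fin 3) (v : Plane) : inner ℝ v (T.ν i) = ‖T.e i‖⁻¹ * cross v (T.e i) := by
  rw [ν, real_inner_smul_right, inner_rot]

/-- The other two coordinates stay positive near `x`, so the single affine inequality `0 ≤ bary i`
describes the triangle there. -/
theorem isOutNormal {i : Fin 3} {x : Plane} (hi : T.bary i x = 0)
    (hj : ∀ j, j ≠ i → 0 < T.bary j x) : IsOutNormal T.carrier x (T.ν i) := by
  refine ⟨T.norm_ν i, ?_⟩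
  have : ∀ᶠ y in 𝓝 x, ∀ j, j ≠ i → 0 < T.bary j y := by
    rw [eventually_all]; intro j
    by_cases h : j = i
    · simp [h]
    · filter_upwards [((T.continuous_bary j).tendsto x).eventually_const_lt (hj j h)] with y hy _
        using hy
  obtain ⟨r, hr, H⟩ := Metric.eventually_nhds_iff_ball.1 this
  refine ⟨r, hr, fun y hy => ?_⟩
  have h1 : T.bary i y = cross (T.e i) (y - x) / T.D := by rw [← T.bary_sub, hi, sub_zero]
  have h2 : y ∈ T.carrier ↔ 0 ≤ T.bary i y := by
    rw [mem_carrier_iff]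
    refine ⟨fun h => h i, fun h j => ?_⟩
    by_cases hji : j = i
    · rw [hji]; exact h
    · exact (H y hy j hji).le
  have h3 : 0 ≤ cross (T.e i) (y - x) / T.D ↔ 0 ≤ cross (T.e i) (y - x) := by
    rw [le_div_iff₀ T.D_pos, zero_mul]
  rw [h2, h1, h3, inner_ν, cross_swap]
  have := inv_pos.2 (T.norm_e_pos i)
  constructor
  · intro h; nlinarith
  · intro h; by_contra hlt; nlinarith

theorem mem_edge_iff {i : Fin 3} {x : Plane} : x ∈ T.edge i ↔ x ∈ T.carrier ∧ T.bary i x = 0 := by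
  have n1 : i ≠ i + 1 := by fin_cases i <;> decide
  have n2 : i ≠ i + 2 := by fin_cases i <;> decide
  constructor
  · intro h
    refine ⟨(convex_convexHull ℝ (range T.p)).segment_subset (subset_convexHull ℝ _ ⟨_, rfl⟩)
      (subset_convexHull ℝ _ ⟨_, rfl⟩) h, ?_⟩
    exact (T.convex_bary_zero i).segment_subset (T.bary_ne n1) (T.bary_ne n2) h
  · rintro ⟨h, h0⟩
    have h1 := T.sum_bary x
    have h2 := T.sum_bary_smul x
    have hs : ∀ {M : Type} [AddCommMonoid M] (f : Fin 3 → M),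
        ∑ j, f j = f i + f (i + 1) + f (i + 2) := by
      intro M _ f
      rw [Fin.sum_univ_three]
      fin_cases i <;> simp <;> abel
    rw [hs] at h1 h2
    rw [h0] at h1 h2
    rw [mem_carrier_iff] at h
    refine ⟨_, _, h (i + 1), h (i + 2), by linarith, ?_⟩
    simpa using h2

theorem eq_vertex_of_bary {i j : Fin 3} (hij : i ≠ j) {x : Plane} (hi : T.bary i x = 0)
    (hj : T.bary j x = 0) : ∃ k, x = T.p k := by
  have h1 := T.sum_bary x
  have h2 := T.sum_bary_smul x
  rw [Fin.sum_univ_three] at h1 h2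
  fin_cases i <;> fin_cases j <;> simp at hij hi hj <;> simp only [hi, hj] at h1 h2 <;>
    first
      | exact ⟨0, by rw [← h2, show T.bary 0 x = 1 by linarith]; simp⟩
      | exact ⟨1, by rw [← h2, show T.bary 1 x = 1 by linarith]; simp⟩
      | exact ⟨2, by rw [← h2, show T.bary 2 x = 1 by linarith]; simp⟩

theorem bary_pos_of_mem_edge {i : Fin 3} {x : Plane} (hx : x ∈ T.edge i) (hv : ∀ k, x ≠ T.p k)
    {j : Fin 3} (hj : j ≠ i) : 0 < T.bary j x := by
  rw [mem_edge_iff, mem_carrier_iff] at hx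
  refine lt_of_le_of_ne (hx.1 j) fun h => ?_
  obtain ⟨k, hk⟩ := T.eq_vertex_of_bary hj h.symm hx.2
  exact hv k hk

theorem isOutNormal_of_mem_edge {i : Fin 3} {x : Plane} (hx : x ∈ T.edge i)
    (hv : ∀ k, x ≠ T.p k) : IsOutNormal T.carrier x (T.ν i) :=
  T.isOutNormal (T.mem_edge_iff.1 hx).2 fun _ hj => T.bary_pos_of_mem_edge hx hv hj

theorem exists_edge_of_notMem_interior {x : Plane} (hx : x ∈ T.carrier)
    (hi : x ∉ interior T.carrier) : ∃ i, x ∈ T.edge i := by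
  rw [mem_interior_iff] at hi
  push Not at hi
  obtain ⟨i, hi⟩ := hi
  exact ⟨i, T.mem_edge_iff.2 ⟨hx, le_antisymm hi ((T.mem_carrier_iff x).1 hx i)⟩⟩

theorem edge_notMem_interior {i : Fin 3} {x : Plane} (hx : x ∈ T.edge i) :
    x ∉ interior T.carrier := by
  rw [mem_interior_iff]
  intro h
  exact (h i).ne' (T.mem_edge_iff.1 hx).2

/-- The outward unit normal field on the boundary, off the vertices, extended by zero. -/
def nrm (x : Plane) : Plane := ∑ i, (T.edge i).indicator (fun _ => T.ν i) x

theorem nrm_eq {i : Fin 3} {x : Plane} (hx : x ∈ T.edge i) (hv : ∀ k, x ≠ T.p k) :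
    T.nrm x = T.ν i := by
  rw [nrm, Finset.sum_eq_single i]
  · rw [indicator_of_mem hx]
  · intro j _ hj
    refine indicator_of_notMem (fun h => ?_) _
    exact (T.bary_pos_of_mem_edge hx hv hj).ne' (T.mem_edge_iff.1 h).2
  · simp

theorem nrm_eq_zero {x : Plane} (hx : ∀ i, x ∉ T.edge i) : T.nrm x = 0 :=
  Finset.sum_eq_zero fun i _ => indicator_of_notMem (hx i) _

/-- Points with vanishing cross product are collinear. -/
theorem collinear_of_cross_eq_zero {a b c : Plane} (hab : a ≠ b)
    (h0 : cross (b - a) (c - a) = 0) : Collinear ℝ {a, b, c} := by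
  rw [collinear_iff_of_mem (p₀ := a) (by simp)]
  have hba : b - a ≠ 0 := sub_ne_zero.2 (Ne.symm hab)
  refine ⟨b - a, ?_⟩
  have hn : 0 < (b 0 - a 0) ^ 2 + (b 1 - a 1) ^ 2 := by
    by_contra hle
    apply hba
    have h1 : b 0 - a 0 = 0 := by nlinarith [sq_nonneg (b 0 - a 0), sq_nonneg (b 1 - a 1)]
    have h2 : b 1 - a 1 = 0 := by nlinarith [sq_nonneg (b 0 - a 0), sq_nonneg (b 1 - a 1)]
    ext k; fin_cases k <;> simp [h1, h2]
  intro q hq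
  simp only [mem_insert_iff, mem_singleton_iff] at hq
  rcases hq with rfl | rfl | rfl
  · exact ⟨0, by simp⟩
  · exact ⟨1, by simp⟩
  -- The coefficient of the orthogonal projection of `q - a` onto `b - a`.
  · refine ⟨((q 0 - a 0) * (b 0 - a 0) + (q 1 - a 1) * (b 1 - a 1)) /
      ((b 0 - a 0) ^ 2 + (b 1 - a 1) ^ 2), ?_⟩
    simp only [cross, PiLp.sub_apply] at h0
    ext k
    simp only [vadd_eq_add, PiLp.add_apply, PiLp.smul_apply, PiLp.sub_apply, smul_eq_mul]
    rw [div_mul_eq_mul_div, eq_comm, ← eq_sub_iff_add_eq, div_eq_iff hn.ne']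
    fin_cases k
    · simp; linear_combination (b 1 - a 1) * h0
    · simp; linear_combination (-(b 0 - a 0)) * h0

/-- Three affinely independent points are the vertices of a positively oriented triangle. -/
theorem exists_of_affineIndependent {t : Finset Plane} (ht : t.card = 3)
    (hi : AffineIndependent ℝ ((↑) : t → Plane)) : ∃ T : Tri, range T.p = (t : Set Plane) := by
  obtain ⟨a, b, c, hab, hac, hbc, rfl⟩ := Finset.card_eq_three.1 ht
  have hr : ∀ x y z : Plane, range ![x, y, z] = {x, y, z} := by
    intro x y z
    simp only [Matrix.range_cons, Matrix.range_empty, union_empty, singleton_union]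
  have hne : cross (b - a) (c - a) ≠ 0 := by
    intro h0
    have hcol := collinear_of_cross_eq_zero hab h0
    have hinj : Function.Injective ![a, b, c] := by
      intro i j
      fin_cases i <;> fin_cases j <;>
        simp [hab, hac, hbc, Ne.symm hab, Ne.symm hac, Ne.symm hbc]
    have hm : ∀ i, ![a, b, c] i ∈ ({a, b, c} : Finset Plane) := by
      intro i; fin_cases i <;> simp
    let f : Fin 3 ↪ ({a, b, c} : Finset Plane) :=
      ⟨fun i => ⟨![a, b, c] i, hm i⟩, fun i j h => hinj (Subtype.ext_iff.1 h)⟩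
    have h3 : AffineIndependent ℝ ![a, b, c] := hi.comp_embedding f
    rw [affineIndependent_iff_not_collinear_set] at h3
    exact h3 hcol
  have hc : (({a, b, c} : Finset Plane) : Set Plane) = {a, b, c} := by push_cast; rfl
  rw [hc]
  rcases lt_or_gt_of_ne hne with h | h
  -- A negatively oriented triple becomes positive when two vertices are exchanged.
  · refine ⟨⟨![a, c, b], ?_⟩, ?_⟩
    · rw [cross_swap]
      exact neg_pos.2 h
    · rw [hr, Set.pair_comm c b]
  · exact ⟨⟨![a, b, c], h⟩, hr a b c⟩

end Tri

/-! ### Collapsed coordinates on a triangle -/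

/-- The plane as a product of lines. -/
def planeEquiv : Plane ≃ᵐ ℝ × ℝ :=
  (MeasurableEquiv.toLp 2 (Fin 2 → ℝ)).symm.trans MeasurableEquiv.finTwoArrow

theorem measurePreserving_planeEquiv : MeasurePreserving planeEquiv volume volume :=
  (EuclideanSpace.volume_preserving_symm_measurableEquiv_toLp (Fin 2)).trans
    (volume_preserving_finTwoArrow ℝ)

/-- The open unit square. -/
def openSquare : Set (ℝ × ℝ) := Ioo 0 1 ×ˢ Ioo 0 1

theorem measurableSet_openSquare : MeasurableSet openSquare :=
  measurableSet_Ioo.prod measurableSet_Ioo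

namespace Tri

variable (T : Tri)

theorem ext_bary {x y : Plane} (h : ∀ i, T.bary i x = T.bary i y) : x = y := by
  rw [← T.sum_bary_smul x, ← T.sum_bary_smul y]
  exact Finset.sum_congr rfl fun i _ => by rw [h i]

/-- The collapsed coordinates of the triangle: the unit square is mapped onto the triangle, one
side of it to the vertex `i`. -/
def duffy (i : Fin 3) (z : ℝ × ℝ) : Plane :=
  T.p i + z.1 • ((1 - z.2) • (T.p (i + 1) - T.p i) + z.2 • (T.p (i + 2) - T.p i))

theorem bary_duffy (i j : Fin 3) (z : ℝ × ℝ) : T.bary j (T.duffy i z) =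
    (1 - z.1) * T.bary j (T.p i) + z.1 * (1 - z.2) * T.bary j (T.p (i + 1)) +
      z.1 * z.2 * T.bary j (T.p (i + 2)) := by
  have h1 := T.bary_sub j (T.p i) (T.p (i + 1))
  have h2 := T.bary_sub j (T.p i) (T.p (i + 2))
  rw [duffy, bary_add_smul, cross_add_right, cross_smul_right, cross_smul_right, add_div,
    mul_div_assoc, mul_div_assoc, ← h1, ← h2]
  ring

theorem bary_duffy_zero (i : Fin 3) (z : ℝ × ℝ) : T.bary i (T.duffy i z) = 1 - z.1 := by
  rw [bary_duffy, bary_self, bary_ne, bary_ne]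
  · ring
  · fin_cases i <;> decide
  · fin_cases i <;> decide

theorem bary_duffy_one (i : Fin 3) (z : ℝ × ℝ) :
    T.bary (i + 1) (T.duffy i z) = z.1 * (1 - z.2) := by
  rw [bary_duffy, bary_self, bary_ne, bary_ne]
  · ring
  · fin_cases i <;> decide
  · fin_cases i <;> decide

theorem bary_duffy_two (i : Fin 3) (z : ℝ × ℝ) : T.bary (i + 2) (T.duffy i z) = z.1 * z.2 := by
  rw [bary_duffy, bary_self, bary_ne, bary_ne]
  · ring
  · fin_cases i <;> decide
  · fin_cases i <;> decide

theorem forall_fin_three_add (i : Fin 3) {q : Fin 3 → Prop} :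
    (∀ j, q j) ↔ q i ∧ q (i + 1) ∧ q (i + 2) := by
  refine ⟨fun h => ⟨h _, h _, h _⟩, fun h j => ?_⟩
  obtain ⟨h0, h1, h2⟩ := h
  fin_cases i <;> fin_cases j <;> first | exact h0 | exact h1 | exact h2

theorem injOn_duffy (i : Fin 3) : InjOn (T.duffy i) openSquare := by
  intro z hz w hw h
  have h0 := T.bary_duffy_zero i z
  have h2 := T.bary_duffy_two i z
  rw [h, bary_duffy_zero] at h0
  rw [h, bary_duffy_two] at h2
  have h1 : z.1 = w.1 := by linarith
  rw [← h1] at h2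
  exact Prod.ext h1 (mul_left_cancel₀ hz.1.1.ne' h2).symm

theorem duffy_image (i : Fin 3) : T.duffy i '' openSquare = interior T.carrier := by
  ext x
  rw [mem_interior_iff, forall_fin_three_add i]
  constructor
  · rintro ⟨z, ⟨⟨h1, h2⟩, h3, h4⟩, rfl⟩
    rw [bary_duffy_zero, bary_duffy_one, bary_duffy_two]
    exact ⟨by linarith, mul_pos h1 (by linarith), mul_pos h1 h3⟩
  · rintro ⟨h0, h1, h2⟩
    have hs : T.bary i x + T.bary (i + 1) x + T.bary (i + 2) x = 1 := by
      rw [← T.sum_bary x, Fin.sum_univ_three]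
      fin_cases i <;> simp <;> ring
    have hp : 0 < 1 - T.bary i x := by linarith
    -- The inverse map: the first coordinate comes from `bary_duffy_zero`, the second from
    -- `bary_duffy_two` after division by the first.
    refine ⟨(1 - T.bary i x, T.bary (i + 2) x / (1 - T.bary i x)),
      ⟨⟨hp, by linarith⟩, by positivity, ?_⟩, ?_⟩
    · change T.bary (i + 2) x / (1 - T.bary i x) < 1
      rw [div_lt_one hp]; linarith
    · refine T.ext_bary ((forall_fin_three_add i).2 ⟨?_, ?_, ?_⟩)
      · rw [bary_duffy_zero]; ring
      · rw [bary_duffy_one]; field_simp; linarith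
      · rw [bary_duffy_two]; field_simp

theorem duffy_mem_carrier (i : Fin 3) {z : ℝ × ℝ} (hz : z ∈ Icc (0 : ℝ × ℝ) 1) :
    T.duffy i z ∈ T.carrier := by
  obtain ⟨⟨h1, h2⟩, h3, h4⟩ := hz
  simp only [Prod.fst_zero, Prod.snd_zero, Prod.fst_one, Prod.snd_one] at h1 h2 h3 h4
  rw [mem_carrier_iff, forall_fin_three_add i, bary_duffy_zero, bary_duffy_one, bary_duffy_two]
  exact ⟨by linarith, mul_nonneg h1 (by linarith), mul_nonneg h1 h2⟩

@[fun_prop]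
theorem continuous_duffy (i : Fin 3) : Continuous (T.duffy i) := by
  unfold duffy; fun_prop

/-- The derivative of the collapsed coordinates, in the product of lines. -/
def duffyDeriv (i : Fin 3) (z : ℝ × ℝ) : ℝ × ℝ →L[ℝ] ℝ × ℝ :=
  (Matrix.toLin (.finTwoProd ℝ) (.finTwoProd ℝ)
    !![(1 - z.2) * (T.p (i + 1) - T.p i) 0 + z.2 * (T.p (i + 2) - T.p i) 0, z.1 * T.e i 0;
      (1 - z.2) * (T.p (i + 1) - T.p i) 1 + z.2 * (T.p (i + 2) - T.p i) 1, z.1 * T.e i 1]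
    ).toContinuousLinearMap

theorem cross_at (i : Fin 3) : cross (T.p (i + 1) - T.p i) (T.p (i + 2) - T.p i) = T.D := by
  fin_cases i <;> simp [D, cross] <;> ring

/-- The factor `z.1`, which degenerates at the collapsed side, is the weight `s` in the one-variable
estimate `exists_sq_eval_one_le`. -/
theorem det_duffyDeriv (i : Fin 3) (z : ℝ × ℝ) : (T.duffyDeriv i z).det = T.D * z.1 := by
  unfold duffyDeriv
  simp only [LinearMap.det_toContinuousLinearMap, LinearMap.det_toLin, Matrix.det_fin_two_of]
  rw [← T.cross_at i]
  simp only [e, cross, PiLp.sub_apply]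
  ring

theorem hasFDerivAt_duffy_coord (i : Fin 3) (k : Fin 2) (z : ℝ × ℝ) :
    HasFDerivAt (fun z : ℝ × ℝ => T.duffy i z k)
      (((1 - z.2) * (T.p (i + 1) - T.p i) k + z.2 * (T.p (i + 2) - T.p i) k) •
        ContinuousLinearMap.fst ℝ ℝ ℝ + (z.1 * T.e i k) • ContinuousLinearMap.snd ℝ ℝ ℝ) z := by
  have h1 : HasFDerivAt (fun z : ℝ × ℝ => z.1) (ContinuousLinearMap.fst ℝ ℝ ℝ) z := hasFDerivAt_fst
  have h2 : HasFDerivAt (fun z : ℝ × ℝ => z.2) (ContinuousLinearMap.snd ℝ ℝ ℝ) z := hasFDerivAt_snd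
  have := (h1.mul (((h2.const_sub 1).mul_const ((T.p (i + 1) - T.p i) k)).add
    (h2.mul_const ((T.p (i + 2) - T.p i) k)))).const_add (T.p i k)
  refine (this.congr_fderiv ?_).congr_of_eventuallyEq (Eventually.of_forall fun z => ?_)
  · ext <;> simp [e]; ring
  · simp [duffy]; ring

theorem hasFDerivAt_duffy (i : Fin 3) (z : ℝ × ℝ) :
    HasFDerivAt (fun z => planeEquiv (T.duffy i z)) (T.duffyDeriv i z) z := by
  refine ((T.hasFDerivAt_duffy_coord i 0 z).prodMk (T.hasFDerivAt_duffy_coord i 1 z)).congr_fderiv ?_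
  rw [duffyDeriv, Matrix.toLin_finTwoProd_toContinuousLinearMap]

theorem planeEquiv_image (i : Fin 3) :
    planeEquiv.symm ⁻¹' interior T.carrier = (fun z => planeEquiv (T.duffy i z)) '' openSquare := by
  rw [← T.duffy_image i, ← planeEquiv.image_eq_preimage_symm, image_image]

theorem injOn_planeEquiv_duffy (i : Fin 3) :
    InjOn (fun z => planeEquiv (T.duffy i z)) openSquare :=
  planeEquiv.injective.comp_injOn (T.injOn_duffy i)

theorem abs_det_duffyDeriv (i : Fin 3) {z : ℝ × ℝ} (hz : z ∈ openSquare) :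
    |(T.duffyDeriv i z).det| = T.D * z.1 := by
  rw [det_duffyDeriv, abs_of_pos (mul_pos T.D_pos hz.1.1)]

/-- The change of variables uses the open square and the interior of the triangle, since a whole
side of the closed square is sent to one vertex. -/
theorem integral_duffy (i : Fin 3) (g : Plane → ℝ) :
    ∫ x in interior T.carrier, g x = ∫ z in openSquare, T.D * z.1 * g (T.duffy i z) := by
  have h := (measurePreserving_planeEquiv.symm _).setIntegral_preimage_emb
    planeEquiv.symm.measurableEmbedding g (interior T.carrier)
  rw [← h, T.planeEquiv_image i, integral_image_eq_integral_abs_det_fderiv_smul volume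
    measurableSet_openSquare (fun z _ => (T.hasFDerivAt_duffy i z).hasFDerivWithinAt)
    (T.injOn_planeEquiv_duffy i)]
  refine setIntegral_congr_fun measurableSet_openSquare fun z hz => ?_
  simp [T.abs_det_duffyDeriv i hz]

theorem integrableOn_duffy (i : Fin 3) (g : Plane → ℝ) :
    IntegrableOn g (interior T.carrier) ↔
      IntegrableOn (fun z => T.D * z.1 * g (T.duffy i z)) openSquare := by
  have h := (measurePreserving_planeEquiv.symm _).integrableOn_comp_preimage
    planeEquiv.symm.measurableEmbedding (f := g) (s := interior T.carrier)
  rw [← h, T.planeEquiv_image i, integrableOn_image_iff_integrableOn_abs_det_fderiv_smul volume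
    measurableSet_openSquare (fun z _ => (T.hasFDerivAt_duffy i z).hasFDerivWithinAt)
    (T.injOn_planeEquiv_duffy i)]
  refine integrableOn_congr_fun (fun z hz => ?_) measurableSet_openSquare
  simp [T.abs_det_duffyDeriv i hz]

end Tri

/-! ### Arc length and the divergence theorem on a triangle -/

/-- The trace of an endomorphism of the plane. -/
def divg (A : Plane →L[ℝ] Plane) : ℝ :=
  A (EuclideanSpace.single 0 1) 0 + A (EuclideanSpace.single 1 1) 1

theorem apply_eq_single (A : Plane →L[ℝ] Plane) (x : Plane) :
    A x = x 0 • A (EuclideanSpace.single 0 1) + x 1 • A (EuclideanSpace.single 1 1) := by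
  rw [← map_smul, ← map_smul, ← map_add]
  congr 1
  ext k; fin_cases k <;> simp

/-- The infinitesimal form of multiplicativity of the determinant. It identifies the divergence of
the pulled-back field in `integral_divg`. -/
theorem cross_apply_add (A : Plane →L[ℝ] Plane) (x y : Plane) :
    cross (A x) y + cross x (A y) = divg A * cross x y := by
  rw [apply_eq_single A x, apply_eq_single A y]
  simp only [cross, divg, PiLp.add_apply, PiLp.smul_apply, smul_eq_mul]
  ring

theorem rot_add_smul (u v : Plane) (c : ℝ) : rot u + c • rot v = rot (u + c • v) := by
  ext k; fin_cases k <;> simp [rot]; ring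

theorem Icc_prod_ae_openSquare : (Icc (0 : ℝ × ℝ) 1 : Set (ℝ × ℝ)) =ᵐ[volume] openSquare := by
  have h : (Icc (0 : ℝ × ℝ) 1) = Icc (0 : ℝ) 1 ×ˢ Icc (0 : ℝ) 1 := by
    rw [Icc_prod_Icc]; rfl
  rw [h]
  exact (Measure.set_prod_ae_eq Ioo_ae_eq_Icc Ioo_ae_eq_Icc).symm

namespace Tri

variable (T : Tri)

/-- The Piola transform of `F` under the collapsed coordinates has divergence `D * z.1 * divg F'` on
the square, where the divergence theorem for rectangles applies. That theorem needs continuity on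
the closed square but derivatives only inside, hence the form of the hypotheses. -/
theorem integral_divg {F : Plane → Plane} {F' : Plane → Plane →L[ℝ] Plane}
    (hc : ContinuousOn F T.carrier) (hd : ∀ x ∈ interior T.carrier, HasFDerivAt F (F' x) x)
    (hi : IntegrableOn (fun x => divg (F' x)) (interior T.carrier)) :
    ∫ x in interior T.carrier, divg (F' x) =
      ∑ i, ∫ s in (0 : ℝ)..1, cross (F (T.p (i + 1) + s • T.e i)) (T.e i) := by
  have hdu : ∀ z, T.duffy 0 z = T.p 0 + z.1 • (T.e 2 + z.2 • T.e 0) := by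
    intro z
    simp only [duffy, e, Fin.isValue, zero_add, show (2 : Fin 3) + 2 = 1 from rfl,
      show (2 : Fin 3) + 1 = 0 from rfl]
    module
  have hw : T.e 2 + T.e 0 = -T.e 1 := by
    simp only [e, Fin.isValue, zero_add, show (2 : Fin 3) + 2 = 1 from rfl,
      show (2 : Fin 3) + 1 = 0 from rfl, show (1 : Fin 3) + 1 = 2 from rfl,
      show (1 : Fin 3) + 2 = 0 from rfl]
    abel
  set Φ' : ℝ × ℝ → ℝ × ℝ →L[ℝ] Plane := fun z =>
    z.1 • (ContinuousLinearMap.snd ℝ ℝ ℝ).smulRight (T.e 0) +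
      (ContinuousLinearMap.fst ℝ ℝ ℝ).smulRight (T.e 2 + z.2 • T.e 0) with hΦ'
  have hΦ : ∀ z, HasFDerivAt (T.duffy 0) (Φ' z) z := by
    intro z
    have h1 : HasFDerivAt (fun z : ℝ × ℝ => z.1) (ContinuousLinearMap.fst ℝ ℝ ℝ) z :=
      hasFDerivAt_fst
    have h2 : HasFDerivAt (fun z : ℝ × ℝ => z.2) (ContinuousLinearMap.snd ℝ ℝ ℝ) z :=
      hasFDerivAt_snd
    have := (h1.smul ((h2.smul_const (T.e 0)).const_add (T.e 2))).const_add (T.p 0)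
    exact this.congr_of_eventuallyEq (Eventually.of_forall fun z => hdu z)
  set E := rot (T.e 0) with hE
  set U := rot (T.e 2) with hU
  -- With `Φ = duffy 0`, the components of the transformed field are `f = cross F (∂₂Φ)` and `g =
  -- -cross F (∂₁Φ)`.
  set f : ℝ × ℝ → ℝ := fun z => inner ℝ (F (T.duffy 0 z)) (z.1 • E) with hf
  set g : ℝ × ℝ → ℝ := fun z => -inner ℝ (F (T.duffy 0 z)) (U + z.2 • E) with hg
  set f' : ℝ × ℝ → ℝ × ℝ →L[ℝ] ℝ := fun z =>
    (fderivInnerCLM ℝ (F (T.duffy 0 z), z.1 • E)).comp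
      (((F' (T.duffy 0 z)).comp (Φ' z)).prod ((ContinuousLinearMap.fst ℝ ℝ ℝ).smulRight E)) with hf'
  set g' : ℝ × ℝ → ℝ × ℝ →L[ℝ] ℝ := fun z =>
    -(fderivInnerCLM ℝ (F (T.duffy 0 z), U + z.2 • E)).comp
      (((F' (T.duffy 0 z)).comp (Φ' z)).prod ((ContinuousLinearMap.snd ℝ ℝ ℝ).smulRight E)) with hg'
  have hcF : ContinuousOn (fun z => F (T.duffy 0 z)) (Icc (0 : ℝ × ℝ) 1) :=
    hc.comp (T.continuous_duffy 0).continuousOn fun z hz => T.duffy_mem_carrier 0 hz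
  have hFd : ∀ z ∈ openSquare, HasFDerivAt (fun z => F (T.duffy 0 z))
      ((F' (T.duffy 0 z)).comp (Φ' z)) z := fun z hz =>
    (hd _ (T.duffy_image 0 ▸ mem_image_of_mem _ hz)).comp z (hΦ z)
  have hfd : ∀ z ∈ openSquare, HasFDerivAt f (f' z) z := fun z hz =>
    (hFd z hz).inner ℝ (hasFDerivAt_fst.smul_const E)
  have hgd : ∀ z ∈ openSquare, HasFDerivAt g (g' z) z := fun z hz =>
    ((hFd z hz).inner ℝ ((hasFDerivAt_snd.smul_const E).const_add U)).neg
  -- The terms with the mixed derivative `∂₁∂₂Φ` cancel, and `cross_apply_add` evaluates the rest.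
  have hdiv : ∀ z, f' z (1, 0) + g' z (0, 1) = T.D * z.1 * divg (F' (T.duffy 0 z)) := by
    intro z
    have h1 : Φ' z (1, 0) = T.e 2 + z.2 • T.e 0 := by simp [hΦ']
    have h2 : Φ' z (0, 1) = z.1 • T.e 0 := by simp [hΦ']
    have h3 : cross (T.e 2 + z.2 • T.e 0) (z.1 • T.e 0) = T.D * z.1 := by
      rw [cross_smul_right, ← T.cross_e 2]
      simp only [cross, PiLp.add_apply, PiLp.smul_apply, smul_eq_mul,
        show (2 : Fin 3) + 1 = 0 from rfl]
      ring
    have h4 : z.1 • E = rot (z.1 • T.e 0) := by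
      ext k; fin_cases k <;> simp [hE, rot]
    have := cross_apply_add (F' (T.duffy 0 z)) (T.e 2 + z.2 • T.e 0) (z.1 • T.e 0)
    rw [h3] at this
    simp only [hf', hg', ContinuousLinearMap.comp_apply, neg_apply,
      ContinuousLinearMap.prod_apply, fderivInnerCLM_apply, h1, h2,
      ContinuousLinearMap.smulRight_apply, ContinuousLinearMap.coe_fst',
      ContinuousLinearMap.coe_snd', one_smul]
    rw [hU, hE, rot_add_smul, ← hE, h4, inner_rot, inner_rot, inner_rot,
      cross_swap (F' (T.duffy 0 z) (z.1 • T.e 0))]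
    linear_combination this
  have hint : IntegrableOn (fun z => f' z (1, 0) + g' z (0, 1)) (Icc (0 : ℝ × ℝ) 1) := by
    rw [integrableOn_congr_set_ae Icc_prod_ae_openSquare]
    simp only [hdiv]
    exact (T.integrableOn_duffy 0 _).1 hi
  have key := integral_divergence_prod_Icc_of_hasFDerivAt_of_le f g f' g' 0 1
    (by constructor <;> simp)
    (hcF.inner (by fun_prop)) (hcF.inner (by fun_prop)).neg hfd hgd hint
  rw [setIntegral_congr_set Icc_prod_ae_openSquare] at key
  simp only [hdiv] at key
  rw [T.integral_duffy 0, key, Fin.sum_univ_three]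
  -- The collapsed side `z.1 = 0` contributes nothing. The other three sides are the edges of the
  -- triangle, edge `1` being traversed backwards.
  simp only [Prod.fst_zero, Prod.snd_zero, Prod.fst_one, Prod.snd_one, hf, hg, zero_smul,
    inner_zero_right, intervalIntegral.integral_zero, sub_zero, one_smul, add_zero, hdu]
  have e1 : T.p 0 = T.p 2 + T.e 1 := by simp [e]
  have e2 : T.p 0 + T.e 2 = T.p 1 := by simp [e]
  have i1 : ∫ x in (0 : ℝ)..1, -inner ℝ (F (T.p 0 + x • (T.e 2 + T.e 0))) (U + E) =
      ∫ s in (0 : ℝ)..1, cross (F (T.p 2 + s • T.e 1)) (T.e 1) := by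
    have h := intervalIntegral.integral_comp_sub_left (a := 0) (b := 1)
      (fun s : ℝ => cross (F (T.p 2 + s • T.e 1)) (T.e 1)) 1
    simp only [sub_zero, sub_self] at h
    rw [← h]
    refine intervalIntegral.integral_congr fun s _ => ?_
    have h5 : U + E = rot (-T.e 1) := by
      rw [← hw, hU, hE]
      simpa using rot_add_smul (T.e 2) (T.e 0) 1
    have h6 : T.p 0 + s • (T.e 2 + T.e 0) = T.p 2 + (1 - s) • T.e 1 := by
      rw [hw, e1]; module
    rw [h5, h6, inner_rot]
    simp [cross]; ring
  have i2 : ∫ x in (0 : ℝ)..1, -inner ℝ (F (T.p 0 + x • T.e 2)) U =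
      -∫ s in (0 : ℝ)..1, cross (F (T.p 0 + s • T.e 2)) (T.e 2) := by
    rw [intervalIntegral.integral_neg]
    simp only [hU, inner_rot]
  have i3 : ∫ y in (0 : ℝ)..1, inner ℝ (F (T.p 0 + (T.e 2 + y • T.e 0))) E =
      ∫ s in (0 : ℝ)..1, cross (F (T.p 1 + s • T.e 0)) (T.e 0) := by
    simp only [hE, inner_rot, ← add_assoc, e2]
  rw [i1, i2, i3]
  simp only [Fin.isValue, zero_add, show (2 : Fin 3) + 1 = 0 from rfl,
      show (1 : Fin 3) + 1 = 2 from rfl]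
  ring

end Tri

/-- The integral along a segment with respect to arc length. -/
theorem integral_segment (a v : Plane) (hv : v ≠ 0) (g : Plane → ℝ) :
    ∫ x in segment ℝ a (a + v), g x ∂(Measure.hausdorffMeasure 1) =
      ‖v‖ * ∫ s in (0 : ℝ)..1, g (a + s • v) := by
  have hn : 0 < ‖v‖ := norm_pos_iff.2 hv
  -- Parametrisation at unit speed is an isometry, so it carries Lebesgue measure on the line to
  -- one-dimensional Hausdorff measure on its image.
  set ι : ℝ → Plane := fun s => a + s • (‖v‖⁻¹ • v) with hι
  have hiso : Isometry ι := by
    refine Isometry.of_dist_eq fun s t => ?_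
    rw [hι, dist_add_left, dist_eq_norm, ← sub_smul, norm_smul, norm_smul, norm_inv, norm_norm,
      inv_mul_cancel₀ hn.ne', mul_one]
    rfl
  have hm : MeasurableEmbedding ι := hiso.isClosedEmbedding.measurableEmbedding
  have himg : ι '' Icc 0 ‖v‖ = segment ℝ a (a + v) := by
    rw [segment_eq_image']
    ext x
    constructor
    · rintro ⟨s, ⟨h0, h1⟩, rfl⟩
      refine ⟨s / ‖v‖, ⟨by positivity, (div_le_one hn).2 h1⟩, ?_⟩
      simp only [hι, add_sub_cancel_left, smul_smul, div_eq_mul_inv]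
    · rintro ⟨s, ⟨h0, h1⟩, rfl⟩
      refine ⟨s * ‖v‖, ⟨by positivity, by nlinarith⟩, ?_⟩
      simp only [hι, add_sub_cancel_left, smul_smul, mul_assoc, mul_inv_cancel₀ hn.ne', mul_one]
  have hsub : segment ℝ a (a + v) ⊆ range ι := himg ▸ image_subset_range _ _
  have hms : MeasurableSet (segment ℝ a (a + v)) :=
    himg ▸ hm.measurableSet_image.2 measurableSet_Icc
  have hmap := hiso.map_hausdorffMeasure (d := 1) (Or.inl zero_le_one)
  have h1 : (Measure.hausdorffMeasure 1 : Measure Plane).restrict (segment ℝ a (a + v)) =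
      (Measure.map ι (Measure.hausdorffMeasure 1)).restrict (segment ℝ a (a + v)) := by
    rw [hmap, Measure.restrict_restrict hms, inter_eq_left.2 hsub]
  have hpre : ι ⁻¹' segment ℝ a (a + v) = Icc 0 ‖v‖ := by
    rw [← himg, hm.injective.preimage_image]
  rw [h1, hm.setIntegral_map, hpre, hausdorffMeasure_real, integral_Icc_eq_integral_Ioc,
    ← intervalIntegral.integral_of_le hn.le]
  have h2 := intervalIntegral.integral_comp_mul_left (a := 0) (b := 1) (fun s => g (ι s)) hn.ne'
  simp only [mul_zero, mul_one] at h2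
  have h3 : ∀ s : ℝ, ι (‖v‖ * s) = a + s • v := by
    intro s
    simp only [hι, smul_smul]
    rw [mul_right_comm, mul_inv_cancel₀ hn.ne', one_mul]
  simp only [h3] at h2
  rw [h2, smul_eq_mul, mul_inv_cancel_left₀ hn.ne']

namespace Tri

variable (T : Tri)

theorem edge_eq (i : Fin 3) : T.edge i = segment ℝ (T.p (i + 1)) (T.p (i + 1) + T.e i) := by
  simp [edge, e]

theorem measure_edge_lt_top (i : Fin 3) :
    (Measure.hausdorffMeasure 1 : Measure Plane) (T.edge i) < ⊤ := by
  rw [edge, hausdorffMeasure_segment]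
  exact edist_lt_top _ _

theorem edge_subset_carrier (i : Fin 3) : T.edge i ⊆ T.carrier := fun _ hx => (T.mem_edge_iff.1 hx).1

theorem isCompact_edge (i : Fin 3) : IsCompact (T.edge i) := by
  have : T.edge i = T.carrier ∩ {x | T.bary i x = 0} := by
    ext x; exact T.mem_edge_iff
  rw [this]
  exact T.isCompact_carrier.inter_right (isClosed_eq (T.continuous_bary i) continuous_const)

theorem measurableSet_edge (i : Fin 3) : MeasurableSet (T.edge i) :=
  (T.isCompact_edge i).isClosed.measurableSet

theorem integrableOn_edge {g : Plane → ℝ} (i : Fin 3) (hg : ContinuousOn g (T.edge i)) :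
    IntegrableOn g (T.edge i) (Measure.hausdorffMeasure 1) := by
  obtain ⟨C, hC⟩ := (T.isCompact_edge i).exists_bound_of_continuousOn hg
  exact IntegrableOn.of_bound (T.measure_edge_lt_top i)
    (hg.aestronglyMeasurable (T.measurableSet_edge i)) C
    ((ae_restrict_mem (T.measurableSet_edge i)).mono hC)

theorem integral_edge (i : Fin 3) (g : Plane → ℝ) :
    ∫ x in T.edge i, g x ∂(Measure.hausdorffMeasure 1) =
      ‖T.e i‖ * ∫ s in (0 : ℝ)..1, g (T.p (i + 1) + s • T.e i) := by
  rw [edge_eq, integral_segment _ _ (T.e_ne_zero i)]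

/-- Exact at every point, vertices included, because `nrm` is a sum of indicators. The flux thus
splits into edge integrals with no exceptional set. -/
theorem inner_nrm (F : Plane → Plane) (x : Plane) :
    inner ℝ (F x) (T.nrm x) = ∑ i, (T.edge i).indicator (fun x => inner ℝ (F x) (T.ν i)) x := by
  rw [nrm, inner_sum]
  refine Finset.sum_congr rfl fun i _ => ?_
  by_cases h : x ∈ T.edge i <;> simp [h]

theorem integrable_flux {F : Plane → Plane} (hc : ContinuousOn F T.carrier) :
    Integrable (fun x => inner ℝ (F x) (T.nrm x)) (Measure.hausdorffMeasure 1) := by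
  simp only [inner_nrm]
  refine integrable_finsetSum _ fun i _ => ?_
  rw [integrable_indicator_iff (T.measurableSet_edge i)]
  exact T.integrableOn_edge i ((hc.mono (T.edge_subset_carrier i)).inner continuousOn_const)

/-- The divergence theorem on a triangle. -/
theorem integral_divg_eq_flux {F : Plane → Plane} {F' : Plane → Plane →L[ℝ] Plane}
    (hc : ContinuousOn F T.carrier) (hd : ∀ x ∈ interior T.carrier, HasFDerivAt F (F' x) x)
    (hi : IntegrableOn (fun x => divg (F' x)) (interior T.carrier)) :
    ∫ x in interior T.carrier, divg (F' x) =
      ∫ x, inner ℝ (F x) (T.nrm x) ∂(Measure.hausdorffMeasure 1) := by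
  simp only [inner_nrm]
  rw [T.integral_divg hc hd hi, integral_finsetSum]
  · refine Finset.sum_congr rfl fun i _ => ?_
    rw [integral_indicator (T.measurableSet_edge i), integral_edge,
      ← intervalIntegral.integral_const_mul]
    refine intervalIntegral.integral_congr fun s _ => ?_
    simp only [inner_ν]
    rw [mul_inv_cancel_left₀ (T.norm_e_pos i).ne']
  · intro i _
    rw [integrable_indicator_iff (T.measurableSet_edge i)]
    exact T.integrableOn_edge i ((hc.mono (T.edge_subset_carrier i)).inner continuousOn_const)

end Tri

/-! ### Polynomials and the trace inequality on one edge -/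

/-- On polynomials of bounded degree on `[0, 1]` the value at `1` is bounded by a weighted
`L²` norm. -/
theorem exists_sq_eval_one_le (P : ℕ) : ∃ C : ℝ, 0 < C ∧ ∀ r : Polynomial ℝ, r.natDegree ≤ P →
    (r.eval 1) ^ 2 ≤ C * ∫ s in (0 : ℝ)..1, s * (r.eval s) ^ 2 := by
  set q : (Fin (P + 1) → ℝ) → ℝ → ℝ := fun c s => ∑ k, c k * s ^ (k : ℕ) with hq
  have hqc : Continuous fun z : (Fin (P + 1) → ℝ) × ℝ => q z.1 z.2 := by
    simp only [hq]; fun_prop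
  set Q : (Fin (P + 1) → ℝ) → ℝ := fun c => ∫ s in (0 : ℝ)..1, s * (q c s) ^ 2 with hQ
  have hQc : Continuous Q := by
    refine intervalIntegral.continuous_parametric_intervalIntegral_of_continuous' ?_ 0 1
    exact continuous_snd.mul (hqc.pow 2)
  have hqs : ∀ (a : ℝ) c s, q (a • c) s = a * q c s := by
    intro a c s
    simp only [hq, Pi.smul_apply, smul_eq_mul, Finset.mul_sum, mul_assoc]
  have hqC : ∀ c, Continuous (q c) := fun c => hqc.comp (by fun_prop : Continuous fun s => (c, s))
  -- The weight is positive on the open interval, so `Q c = 0` would give a polynomial with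
  -- infinitely many roots.
  have hpos : ∀ c, c ≠ 0 → 0 < Q c := by
    intro c hc
    have : ∃ s ∈ Ioo (0 : ℝ) 1, q c s ≠ 0 := by
      by_contra! hall
      apply hc
      set p : Polynomial ℝ := ∑ k, Polynomial.C (c k) * Polynomial.X ^ (k : ℕ) with hp
      have hpe : ∀ s, p.eval s = q c s := by
        intro s; simp [hp, hq, Polynomial.eval_finsetSum]
      have hp0 : p = 0 := by
        refine Polynomial.eq_zero_of_infinite_isRoot p ?_
        refine (Set.Ioo_infinite (zero_lt_one (α := ℝ))).mono fun s hs => ?_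
        change p.eval s = 0
        rw [hpe, hall s hs]
      ext k
      have := congrArg (fun r => Polynomial.coeff r (k : ℕ)) hp0
      simpa [hp, Polynomial.finsetSum_coeff, Polynomial.coeff_C_mul, Polynomial.coeff_X_pow,
        Fin.val_inj] using this
    obtain ⟨s, hs, hs0⟩ := this
    refine intervalIntegral.integral_pos zero_lt_one
      (continuous_id.mul ((hqC c).pow 2)).continuousOn (fun x hx => ?_)
      ⟨s, ⟨hs.1.le, hs.2.le⟩, ?_⟩
    · exact mul_nonneg hx.1.le (sq_nonneg _)
    · exact mul_pos hs.1 (by positivity)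
  -- The quadratic form `Q` is bounded below by its positive minimum on the unit sphere, and
  -- homogeneity extends the bound to all coefficient vectors.
  obtain ⟨c₀, hc₀, hmin⟩ := (isCompact_sphere (0 : Fin (P + 1) → ℝ) 1).exists_isMinOn
    (NormedSpace.sphere_nonempty.2 zero_le_one) hQc.continuousOn
  have hm : 0 < Q c₀ := hpos c₀ (by rintro rfl; simp at hc₀)
  have hlow : ∀ c, Q c₀ * ‖c‖ ^ 2 ≤ Q c := by
    intro c
    by_cases hc : c = 0
    · subst hc
      simp [hQ, hq]
    · have hn : 0 < ‖c‖ := norm_pos_iff.2 hc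
      have h1 : Q c₀ ≤ Q (‖c‖⁻¹ • c) := hmin (by
        simp [norm_smul, inv_mul_cancel₀ hn.ne'])
      have h2 : Q (‖c‖⁻¹ • c) = (‖c‖⁻¹) ^ 2 * Q c := by
        simp only [hQ, hqs]
        rw [← intervalIntegral.integral_const_mul]
        refine intervalIntegral.integral_congr fun s _ => ?_
        ring
      rw [h2] at h1
      calc Q c₀ * ‖c‖ ^ 2 ≤ (‖c‖⁻¹) ^ 2 * Q c * ‖c‖ ^ 2 := by gcongr
        _ = Q c := by field_simp
  -- The value at `1` is the sum of the `P + 1` coefficients, hence at most `P + 1` times their sup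
  -- norm.
  refine ⟨((P : ℝ) + 1) ^ 2 / Q c₀, by positivity, fun r hr => ?_⟩
  set c : Fin (P + 1) → ℝ := fun k => r.coeff k with hc
  have hre : ∀ s, r.eval s = q c s := by
    intro s
    rw [Polynomial.eval_eq_sum_range' (Nat.lt_succ_of_le hr), ← Fin.sum_univ_eq_sum_range
      (fun k => r.coeff k * s ^ k)]
  have h1 : |q c 1| ≤ ((P : ℝ) + 1) * ‖c‖ := by
    calc |q c 1| ≤ ∑ k : Fin (P + 1), |c k| := by
          simp only [hq, one_pow, mul_one]; exact Finset.abs_sum_le_sum_abs _ _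
      _ ≤ ∑ k : Fin (P + 1), ‖c‖ := Finset.sum_le_sum fun k _ => norm_le_pi_norm c k
      _ = _ := by simp
  simp only [hre]
  change _ ≤ _ * Q c
  calc q c 1 ^ 2 = |q c 1| ^ 2 := (sq_abs _).symm
    _ ≤ (((P : ℝ) + 1) * ‖c‖) ^ 2 := by gcongr
    _ = ((P : ℝ) + 1) ^ 2 / Q c₀ * (Q c₀ * ‖c‖ ^ 2) := by field_simp
    _ ≤ _ := by gcongr; exact hlow c

/-- Evaluation of a polynomial in two variables at a point of the plane. -/
def peval (p : MvPolynomial (Fin 2) ℝ) (x : Plane) : ℝ := MvPolynomial.eval (fun i => x i) p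

@[fun_prop]
theorem continuous_peval (p : MvPolynomial (Fin 2) ℝ) : Continuous (peval p) := by
  unfold peval
  exact (MvPolynomial.continuous_eval p).comp (by fun_prop)

/-- Substitution of affine functions does not raise the degree, so one constant serves all rays
through a vertex. -/
theorem exists_polynomial_line (p : MvPolynomial (Fin 2) ℝ) (a d : Plane) :
    ∃ r : Polynomial ℝ, r.natDegree ≤ p.totalDegree ∧ ∀ s : ℝ, r.eval s = peval p (a + s • d) := by
  refine ⟨MvPolynomial.aeval (fun k => Polynomial.C (a k) + Polynomial.C (d k) * Polynomial.X) p,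
    ?_, fun s => ?_⟩
  · have := MvPolynomial.aeval_natDegree_le (n := 1) p le_rfl
      (fun k => Polynomial.C (a k) + Polynomial.C (d k) * Polynomial.X) (fun k => ?_)
    · simpa using this
    · compute_degree
  · rw [← Polynomial.coe_evalRingHom, MvPolynomial.aeval_def, MvPolynomial.hom_eval₂]
    simp only [peval, MvPolynomial.eval, MvPolynomial.coe_eval₂Hom]
    congr 1
    · ext; simp
    · ext k; simp; ring

/-- The gradient of a polynomial. -/
def pgrad (p : MvPolynomial (Fin 2) ℝ) (x : Plane) : Plane :=
  WithLp.toLp 2 fun k => peval (MvPolynomial.pderiv k p) x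

@[fun_prop]
theorem continuous_pgrad (p : MvPolynomial (Fin 2) ℝ) : Continuous (pgrad p) := by
  unfold pgrad; fun_prop

theorem hasFDerivAt_peval (p : MvPolynomial (Fin 2) ℝ) (x : Plane) :
    HasFDerivAt (peval p) (∑ k, peval (MvPolynomial.pderiv k p) x •
      (EuclideanSpace.proj k : Plane →L[ℝ] ℝ)) x := by
  induction p using MvPolynomial.induction_on with
  | C a => 
    have : peval (MvPolynomial.C a) = fun _ => a := by ext y; simp [peval]
    rw [this]
    simpa [peval] using hasFDerivAt_const a x
  | add p q hp hq =>
    have : peval (p + q) = peval p + peval q := by ext y; simp [peval]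
    rw [this]
    refine (hp.add hq).congr_fderiv ?_
    simp [peval, add_smul, Finset.sum_add_distrib]
  | mul_X p i hp =>
    have : peval (p * MvPolynomial.X i) = fun y => peval p y * (EuclideanSpace.proj i : Plane →L[ℝ] ℝ) y := by
      ext y; simp [peval]
    rw [this]
    refine (hp.mul (EuclideanSpace.proj i : Plane →L[ℝ] ℝ).hasFDerivAt).congr_fderiv ?_
    ext v
    fin_cases i <;> simp [peval, Fin.sum_univ_two, MvPolynomial.pderiv_X] <;> ring

theorem hasGradientAt_peval (p : MvPolynomial (Fin 2) ℝ) (x : Plane) :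
    HasGradientAt (peval p) (pgrad p x) x := by
  rw [hasGradientAt_iff_hasFDerivAt]
  refine (hasFDerivAt_peval p x).congr_fderiv ?_
  ext v
  simp [pgrad, PiLp.inner_apply, mul_comm]

theorem norm_sq_pgrad (p : MvPolynomial (Fin 2) ℝ) (x : Plane) :
    ‖pgrad p x‖ ^ 2 = ∑ k, peval (MvPolynomial.pderiv k p) x ^ 2 := by
  rw [EuclideanSpace.norm_sq_eq]; simp [pgrad]

theorem totalDegree_pderiv_le (p : MvPolynomial (Fin 2) ℝ) (k : Fin 2) :
    (MvPolynomial.pderiv k p).totalDegree ≤ p.totalDegree := by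
  rw [MvPolynomial.as_sum p, map_sum]
  refine (MvPolynomial.totalDegree_finsetSum_le fun m hm => ?_)
  rw [MvPolynomial.pderiv_monomial]
  refine (MvPolynomial.totalDegree_monomial_le _ _).trans ?_
  rw [← MvPolynomial.as_sum p]
  refine le_trans ?_ (MvPolynomial.le_totalDegree hm)
  rw [Finsupp.sum_fintype _ _ (by simp), Finsupp.sum_fintype _ _ (by simp)]
  exact Finset.sum_le_sum fun i _ => by simp

namespace Tri

variable (T : Tri)

theorem integrableOn_interior {g : Plane → ℝ} (hg : ContinuousOn g T.carrier) :
    IntegrableOn g (interior T.carrier) :=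
  (hg.integrableOn_compact T.isCompact_carrier).mono_set interior_subset

/-- The trace inequality on one edge of a triangle. -/
theorem integral_edge_sq_le {P : ℕ} {C : ℝ}
    (hC : ∀ r : Polynomial ℝ, r.natDegree ≤ P →
      (r.eval 1) ^ 2 ≤ C * ∫ s in (0 : ℝ)..1, s * (r.eval s) ^ 2)
    {p : MvPolynomial (Fin 2) ℝ} (hp : p.totalDegree ≤ P) (i : Fin 3) :
    ∫ x in T.edge i, peval p x ^ 2 ∂(Measure.hausdorffMeasure 1) ≤
      C * ‖T.e i‖ / T.D * ∫ x in interior T.carrier, peval p x ^ 2 := by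
  have hD := T.D_pos
  have hcont : Continuous fun z : ℝ × ℝ => z.1 * peval p (T.duffy i z) ^ 2 := by fun_prop
  -- Fubini with the inner integral along the rays from the vertex `i`, the outer one along the
  -- opposite edge.
  have hI : ∫ x in interior T.carrier, peval p x ^ 2 =
      T.D * ∫ t in (0 : ℝ)..1, ∫ s in (0 : ℝ)..1, s * peval p (T.duffy i (s, t)) ^ 2 := by
    rw [T.integral_duffy i]
    simp only [mul_assoc]
    rw [integral_const_mul]
    congr 1
    rw [openSquare, Measure.volume_eq_prod, ← Measure.prod_restrict, integral_prod_symm]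
    · simp only [intervalIntegral.integral_of_le zero_le_one, integral_Ioc_eq_integral_Ioo]
    · rw [Measure.prod_restrict]
      exact (hcont.continuousOn.integrableOn_compact (isCompact_Icc (a := (0 : ℝ × ℝ)) (b := 1))
        ).mono_set (by
          intro z hz
          exact ⟨⟨hz.1.1.le, hz.2.1.le⟩, ⟨hz.1.2.le, hz.2.2.le⟩⟩)
  have hedge : ∀ t : ℝ, T.p (i + 1) + t • T.e i = T.duffy i (1, t) := by
    intro t
    simp only [duffy, e]
    module
  have hpt : ∀ t : ℝ, peval p (T.duffy i (1, t)) ^ 2 ≤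
      C * ∫ s in (0 : ℝ)..1, s * peval p (T.duffy i (s, t)) ^ 2 := by
    intro t
    obtain ⟨r, hr, hre⟩ := exists_polynomial_line p (T.p i)
      ((1 - t) • (T.p (i + 1) - T.p i) + t • (T.p (i + 2) - T.p i))
    have := hC r (hr.trans hp)
    simp only [hre] at this
    exact this
  rw [integral_edge, hI]
  simp only [hedge]
  have hmono : ∫ t in (0 : ℝ)..1, peval p (T.duffy i (1, t)) ^ 2 ≤
      ∫ t in (0 : ℝ)..1, C * ∫ s in (0 : ℝ)..1, s * peval p (T.duffy i (s, t)) ^ 2 := by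
    refine intervalIntegral.integral_mono zero_le_one ?_ ?_ hpt
    · exact Continuous.intervalIntegrable (by fun_prop) _ _
    · refine Continuous.intervalIntegrable (continuous_const.mul ?_) _ _
      refine intervalIntegral.continuous_parametric_intervalIntegral_of_continuous' ?_ 0 1
      exact hcont.comp continuous_swap
  rw [intervalIntegral.integral_const_mul] at hmono
  calc _ ≤ ‖T.e i‖ * (C * ∫ t in (0 : ℝ)..1, ∫ s in (0 : ℝ)..1,
        s * peval p (T.duffy i (s, t)) ^ 2) := by gcongr
    _ = _ := by field_simp

theorem volume_interior : (volume : Measure Plane).real (interior T.carrier) = T.D / 2 := by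
  have h := T.integral_duffy 0 fun _ => 1
  rw [setIntegral_const, smul_eq_mul, mul_one] at h
  rw [h]
  simp only [mul_one]
  rw [integral_const_mul, openSquare, Measure.volume_eq_prod]
  have h2 := setIntegral_prod_mul (μ := (volume : Measure ℝ)) (ν := (volume : Measure ℝ))
    (fun s : ℝ => s) (fun _ : ℝ => (1 : ℝ)) (Ioo 0 1) (Ioo 0 1)
  simp only [mul_one] at h2
  rw [h2, ← integral_Ioc_eq_integral_Ioo, ← intervalIntegral.integral_of_le zero_le_one]
  simp
  ring

theorem volume_carrier : (volume : Measure Plane).real T.carrier = T.D / 2 := by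
  rw [← T.volume_interior]
  refine measureReal_congr ?_
  exact (interior_ae_eq_of_null_frontier (T.convex_carrier.addHaar_frontier volume)).symm

end Tri

/-! ### The mesh, its boundary and its normals -/

open Classical in
/-- A triangle with the vertex set `t`, if there is one. -/
def triOf (t : Finset Plane) : Tri :=
  if h : ∃ T : Tri, range T.p = (t : Set Plane) then h.choose
  -- An arbitrary nondegenerate triangle. The default never arises for elements of a mesh, by
  -- `range_triOf`.
  else ⟨![0, EuclideanSpace.single 0 1, EuclideanSpace.single 1 1], by simp [cross]⟩

namespace TriMesh

variable (M : TriMesh)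

theorem finite_elements : M.elements.Finite := M.faces_finite.subset fun _ h => h.1

/-- The finite set of elements. -/
def els : Finset (Finset Plane) := M.finite_elements.toFinset

variable {M}

theorem mem_els {t : Finset Plane} : t ∈ M.els ↔ t ∈ M.elements := by simp [els]

theorem range_triOf {t : Finset Plane} (ht : t ∈ M.els) : range (triOf t).p = (t : Set Plane) := by
  rw [mem_els] at ht
  have h : ∃ T : Tri, range T.p = (t : Set Plane) :=
    Tri.exists_of_affineIndependent ht.2 (M.indep ht.1)
  rw [triOf, dif_pos h]
  exact h.choose_spec

theorem cell_eq {t : Finset Plane} (ht : t ∈ M.els) : cell t = (triOf t).carrier := by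
  rw [cell, Tri.carrier, range_triOf ht]

variable (M)

theorem els_nonempty : M.els.Nonempty := by
  obtain ⟨s, hs⟩ := M.faces_nonempty
  obtain ⟨t, ht, -, hc⟩ := M.pure s hs
  exact ⟨t, mem_els.2 ⟨ht, hc⟩⟩

theorem closedRegion_eq : M.closedRegion = ⋃ t ∈ M.els, (triOf t).carrier := by
  ext x
  simp only [closedRegion, Geometry.SimplicialComplex.mem_space_iff, mem_iUnion, exists_prop]
  constructor
  · rintro ⟨s, hs, hx⟩
    obtain ⟨t, ht, hst, hc⟩ := M.pure s hs
    have ht' : t ∈ M.els := mem_els.2 ⟨ht, hc⟩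
    refine ⟨t, ht', ?_⟩
    rw [← cell_eq ht']
    exact convexHull_mono (Finset.coe_subset.2 hst) hx
  · rintro ⟨t, ht, hx⟩
    rw [← cell_eq ht] at hx
    exact ⟨t, (mem_els.1 ht).1, hx⟩

theorem mem_closedRegion {x : Plane} :
    x ∈ M.closedRegion ↔ ∃ t ∈ M.els, x ∈ (triOf t).carrier := by
  simp [closedRegion_eq]

variable {M} in
theorem carrier_subset {t : Finset Plane} (ht : t ∈ M.els) :
    (triOf t).carrier ⊆ M.closedRegion := fun _ hx => M.mem_closedRegion.2 ⟨t, ht, hx⟩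

theorem isCompact_closedRegion : IsCompact M.closedRegion := by
  rw [closedRegion_eq]
  exact M.els.isCompact_biUnion fun t _ => (triOf t).isCompact_carrier

theorem isClosed_closedRegion : IsClosed M.closedRegion := M.isCompact_closedRegion.isClosed

variable {M} in
theorem interior_carrier_subset {t : Finset Plane} (ht : t ∈ M.els) :
    interior (triOf t).carrier ⊆ M.Ω := interior_mono (carrier_subset ht)

theorem Ω_subset : M.Ω ⊆ M.closedRegion := interior_subset

theorem Γ_subset : M.Γ ⊆ M.closedRegion := M.isClosed_closedRegion.frontier_subset

theorem isOpen_Ω : IsOpen M.Ω := isOpen_interior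

variable {M} in
-- By conformity a common point lies in the hull of the common vertices. There the barycentric
-- coordinate of a vertex of `t` missing from `s` vanishes, which excludes the interior of `t`.
theorem disjoint_interior {s t : Finset Plane} (hs : s ∈ M.els) (ht : t ∈ M.els) (hst : s ≠ t) :
    Disjoint (interior (triOf s).carrier) (interior (triOf t).carrier) := by
  rw [Set.disjoint_left]
  intro x hxs hxt
  have hx : x ∈ convexHull ℝ ((s : Set Plane) ∩ t) := by
    refine M.inter_subset_convexHull (mem_els.1 hs).1 (mem_els.1 ht).1 ⟨?_, ?_⟩
    · exact (cell_eq hs).superset (interior_subset hxs)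
    · exact (cell_eq ht).superset (interior_subset hxt)
  have hns : ¬ t ⊆ s := fun h => hst (Finset.eq_of_subset_of_card_le h
    ((mem_els.1 hs).2.trans (mem_els.1 ht).2.symm).le).symm
  obtain ⟨v, hvt, hvs⟩ := Finset.not_subset.1 hns
  have hv : v ∈ range (triOf t).p := by rw [range_triOf ht]; exact hvt
  obtain ⟨i, rfl⟩ := hv
  have h0 : (triOf t).bary i x = 0 := by
    refine convexHull_min (t := {x | (triOf t).bary i x = 0}) ?_ ((triOf t).convex_bary_zero i) hx
    rintro y ⟨hys, hyt⟩
    rw [← range_triOf ht] at hyt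
    obtain ⟨j, rfl⟩ := hyt
    refine (triOf t).bary_ne ?_
    rintro rfl
    exact hvs hys
  exact (((triOf t).mem_interior_iff x).1 hxt i).ne' h0

/-- The vertices of the mesh. -/
def verts : Set Plane := ⋃ t ∈ M.els, (t : Set Plane)

theorem finite_verts : M.verts.Finite :=
  M.els.finite_toSet.biUnion fun t _ => t.finite_toSet

variable {M} in
theorem ne_vertex {x : Plane} (hx : x ∉ M.verts) {t : Finset Plane} (ht : t ∈ M.els) (k : Fin 3) :
    x ≠ (triOf t).p k := by
  rintro rfl
  refine hx (mem_biUnion ht ?_)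
  rw [← range_triOf ht]
  exact mem_range_self k

/-- Near `x` only the triangles containing `x` matter. -/
theorem eventually_mem_closedRegion (x : Plane) : ∀ᶠ y in 𝓝 x,
    ∀ t ∈ M.els, y ∈ (triOf t).carrier → x ∈ (triOf t).carrier := by
  rw [Filter.eventually_all_finset]
  intro t _
  by_cases h : x ∈ (triOf t).carrier
  · simp [h]
  · filter_upwards [(triOf t).isClosed_carrier.isOpen_compl.mem_nhds h] with y hy hy'
    exact absurd hy' hy

variable {M} in
theorem isOutNormal_nrm {x : Plane} (hx : x ∉ M.verts) {t : Finset Plane} (ht : t ∈ M.els)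
    (hxt : x ∈ (triOf t).carrier) (hi : x ∉ interior (triOf t).carrier) :
    IsOutNormal (triOf t).carrier x ((triOf t).nrm x) := by
  obtain ⟨i, hxi⟩ := (triOf t).exists_edge_of_notMem_interior hxt hi
  rw [(triOf t).nrm_eq hxi (ne_vertex hx ht)]
  exact (triOf t).isOutNormal_of_mem_edge hxi (ne_vertex hx ht)

theorem _root_.NitscheRobin.Tri.nrm_eq_zero_of_notMem (T : Tri) {x : Plane} (hx : x ∉ T.carrier) :
    T.nrm x = 0 := T.nrm_eq_zero fun i hi => hx (T.edge_subset_carrier i hi)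

theorem _root_.NitscheRobin.Tri.nrm_eq_zero_of_mem_interior (T : Tri) {x : Plane}
    (hx : x ∈ interior T.carrier) : T.nrm x = 0 :=
  T.nrm_eq_zero fun _ hi => T.edge_notMem_interior hi hx

/-- A boundary point which is not a vertex belongs to exactly one triangle. -/
theorem exists_boundary_element {x : Plane} (hΓ : x ∈ M.Γ) (hx : x ∉ M.verts) :
    ∃ t ∈ M.els, x ∈ (triOf t).carrier ∧ x ∉ interior (triOf t).carrier ∧
      (∀ s ∈ M.els, s ≠ t → x ∉ (triOf s).carrier) ∧
      ∀ᶠ y in 𝓝 x, y ∈ (triOf t).carrier ↔ y ∈ M.closedRegion := by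
  obtain ⟨t, ht, hxt⟩ := M.mem_closedRegion.1 (M.Γ_subset hΓ)
  have hni : ∀ s ∈ M.els, x ∉ interior (triOf s).carrier := fun s hs h =>
    hΓ.2 (interior_carrier_subset hs h)
  have hone : ∀ s ∈ M.els, s ≠ t → x ∉ (triOf s).carrier := by
    intro s hs hst hxs
    have h1 := isOutNormal_nrm hx ht hxt (hni t ht)
    have h2 := isOutNormal_nrm hx hs hxs (hni s hs)
    have h3 := h1.eq_neg_of_disjoint h2 (disjoint_interior ht hs hst.symm)
    obtain ⟨-, r1, hr1, H1⟩ := h1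
    obtain ⟨-, r2, hr2, H2⟩ := h2
    -- Two triangles at `x` would be opposite half planes there. Together they fill a ball, and `x`
    -- would be an interior point.
    apply hΓ.2
    rw [mem_interior_iff_mem_nhds]
    filter_upwards [Metric.ball_mem_nhds x hr1, Metric.ball_mem_nhds x hr2] with y hy1 hy2
    rcases le_total (inner ℝ (y - x) ((triOf t).nrm x)) 0 with h | h
    · exact carrier_subset ht ((H1 y hy1).2 h)
    · refine carrier_subset hs ((H2 y hy2).2 ?_)
      rw [h3, inner_neg_right]
      linarith
  refine ⟨t, ht, hxt, hni t ht, hone, ?_⟩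
  filter_upwards [M.eventually_mem_closedRegion x] with y hy
  refine ⟨fun h => carrier_subset ht h, fun h => ?_⟩
  obtain ⟨s, hs, hys⟩ := M.mem_closedRegion.1 h
  by_cases hst : s = t
  · exact hst ▸ hys
  · exact absurd (hy s hs hys) (hone s hs hst)

variable {M} in
theorem normal_eq {x ν : Plane} (h : IsOutNormal M.closedRegion x ν) : M.normal x = ν := by
  have hex : ∃ ν, M.IsOutwardUnitNormal x ν := ⟨ν, h⟩
  rw [normal, dif_pos hex]
  have h' : IsOutNormal M.closedRegion x hex.choose := hex.choose_spec
  exact h'.eq h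

theorem norm_normal_le (x : Plane) : ‖M.normal x‖ ≤ 1 := by
  rw [normal]
  split_ifs with h
  · exact h.choose_spec.1.le
  · simp

theorem normal_eq_nrm {x : Plane} (hx : x ∉ M.verts) {t : Finset Plane} (ht : t ∈ M.els)
    (hxt : x ∈ (triOf t).carrier) (hi : x ∉ interior (triOf t).carrier)
    (hloc : ∀ᶠ y in 𝓝 x, y ∈ (triOf t).carrier ↔ y ∈ M.closedRegion) :
    M.normal x = (triOf t).nrm x :=
  normal_eq ((isOutNormal_nrm hx ht hxt hi).congr hloc)

/-- The normals of the triangles add up to the normal of the region on the boundary. -/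
theorem sum_nrm_of_mem {x : Plane} (hΓ : x ∈ M.Γ) (hx : x ∉ M.verts) :
    ∑ t ∈ M.els, (triOf t).nrm x = M.normal x := by
  obtain ⟨t, ht, hxt, hi, hone, hloc⟩ := M.exists_boundary_element hΓ hx
  rw [M.normal_eq_nrm hx ht hxt hi hloc, Finset.sum_eq_single_of_mem t ht]
  intro s hs hst
  exact (triOf s).nrm_eq_zero_of_notMem (hone s hs hst)

/-- The normals of the triangles cancel inside the region. -/
theorem sum_nrm_of_notMem {x : Plane} (hΓ : x ∉ M.Γ) (hx : x ∉ M.verts) :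
    ∑ t ∈ M.els, (triOf t).nrm x = 0 := by
  by_cases hall : ∀ t ∈ M.els, (triOf t).nrm x = 0
  · exact Finset.sum_eq_zero hall
  push Not at hall
  obtain ⟨t, ht, hne⟩ := hall
  have hxt : x ∈ (triOf t).carrier := by
    by_contra h; exact hne ((triOf t).nrm_eq_zero_of_notMem h)
  have hti : x ∉ interior (triOf t).carrier := fun h =>
    hne ((triOf t).nrm_eq_zero_of_mem_interior h)
  have h1 := isOutNormal_nrm hx ht hxt hti
  have hint : x ∈ interior M.closedRegion := by
    by_contra h
    exact hΓ ⟨subset_closure (carrier_subset ht hxt), h⟩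
  -- If `t` were the only triangle at `x`, it would agree with the region near `x`, and `x` would be
  -- interior to `t`.
  have hother : ∃ s ∈ M.els, s ≠ t ∧ x ∈ (triOf s).carrier := by
    by_contra! hone
    apply hti
    rw [mem_interior_iff_mem_nhds] at hint ⊢
    filter_upwards [hint, M.eventually_mem_closedRegion x] with y hy hy'
    obtain ⟨s, hs, hys⟩ := M.mem_closedRegion.1 hy
    by_cases hst : s = t
    · exact hst ▸ hys
    · exact absurd (hy' s hs hys) (hone s hs hst)
  obtain ⟨s, hs, hst, hxs⟩ := hother
  have hopp : ∀ r ∈ M.els, r ≠ t → x ∈ (triOf r).carrier →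
      IsOutNormal (triOf r).carrier x ((triOf r).nrm x) ∧ (triOf r).nrm x = -(triOf t).nrm x := by
    intro r hr hrt hxr
    have hd := disjoint_interior ht hr hrt.symm
    have h2 := isOutNormal_nrm hx hr hxr (h1.notMem_interior_of_disjoint hd)
    exact ⟨h2, h1.eq_neg_of_disjoint h2 hd⟩
  obtain ⟨h2, hs'⟩ := hopp s hs hst hxs
  classical
  rw [← Finset.add_sum_erase _ _ ht, Finset.sum_eq_single_of_mem s (Finset.mem_erase.2 ⟨hst, hs⟩),
    hs', add_neg_cancel]
  intro r hr hrs
  rw [Finset.mem_erase] at hr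
  refine (triOf r).nrm_eq_zero_of_notMem fun hxr => ?_
  obtain ⟨h3, hr'⟩ := hopp r hr.2 hr.1 hxr
  -- A third triangle at `x` would have a normal opposite to both of two opposite normals, forcing
  -- the normal of `t` to be zero.
  have h4 := h2.eq_neg_of_disjoint h3 (disjoint_interior hs hr.2 hrs.symm)
  rw [hr', hs', neg_neg, neg_eq_iff_add_eq_zero, ← two_smul ℝ, smul_eq_zero] at h4
  rcases h4 with h4 | h4
  · norm_num at h4
  · exact hne h4

/-- The edges of the mesh. -/
def skel : Set Plane := ⋃ t ∈ M.els, ⋃ i, (triOf t).edge i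

theorem Γ_subset_skel : M.Γ ⊆ M.skel := by
  intro x hx
  obtain ⟨t, ht, hxt⟩ := M.mem_closedRegion.1 (M.Γ_subset hx)
  have := (triOf t).exists_edge_of_notMem_interior hxt fun h => hx.2 (interior_carrier_subset ht h)
  simp only [skel, mem_iUnion]
  obtain ⟨i, hi⟩ := this
  exact ⟨t, ht, i, hi⟩

theorem measure_skel_lt_top : (Measure.hausdorffMeasure 1 : Measure Plane) M.skel < ⊤ := by
  refine (measure_biUnion_lt_top M.els.finite_toSet fun t _ => ?_)
  refine (measure_iUnion_fintype_le _ _).trans_lt ?_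
  exact ENNReal.sum_lt_top.2 fun i _ => (triOf t).measure_edge_lt_top i

instance : IsFiniteMeasure M.surf :=
  ⟨by
    rw [surf, Measure.restrict_apply_univ]
    exact (measure_mono M.Γ_subset_skel).trans_lt M.measure_skel_lt_top⟩

theorem measure_Ω_lt_top : (volume : Measure Plane) M.Ω < ⊤ :=
  (measure_mono M.Ω_subset).trans_lt M.isCompact_closedRegion.measure_lt_top

instance : IsFiniteMeasure M.vol :=
  ⟨by rw [vol, Measure.restrict_apply_univ]; exact M.measure_Ω_lt_top⟩

theorem measurableSet_Γ : MeasurableSet M.Γ := isClosed_frontier.measurableSet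

theorem measurableSet_Ω : MeasurableSet M.Ω := M.isOpen_Ω.measurableSet

theorem ae_notMem_verts : ∀ᵐ x ∂(Measure.hausdorffMeasure 1 : Measure Plane), x ∉ M.verts := by
  have := Measure.nullSingletonClass_hausdorff Plane (d := 1) one_pos
  rw [ae_iff]
  simpa using M.finite_verts.measure_zero _

variable {M} in
theorem ae_surf {q : Plane → Prop} (h : ∀ x ∈ M.Γ, x ∉ M.verts → q x) : ∀ᵐ x ∂M.surf, q x := by
  rw [surf, ae_restrict_iff' M.measurableSet_Γ]
  filter_upwards [M.ae_notMem_verts] with x hx hΓ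
  exact h x hΓ hx

/-- What is missing lies on the frontiers of finitely many convex sets, which are null. Integrals
over `Ω` are therefore sums over open triangles, where finite element functions are polynomials. -/
theorem Ω_ae_eq : M.Ω =ᵐ[volume] (⋃ t ∈ M.els, interior (triOf t).carrier : Set Plane) := by
  refine (ae_eq_set).2 ⟨?_, ?_⟩
  · have hsub : M.Ω \ (⋃ t ∈ M.els, interior (triOf t).carrier) ⊆
        ⋃ t ∈ M.els, frontier (triOf t).carrier := by
      rintro x ⟨hx, hn⟩
      obtain ⟨t, ht, hxt⟩ := M.mem_closedRegion.1 (M.Ω_subset hx)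
      refine mem_biUnion ht ⟨subset_closure hxt, fun h => hn (mem_biUnion ht h)⟩
    refine measure_mono_null hsub ?_
    exact (measure_biUnion_null_iff M.els.countable_toSet).2 fun t _ =>
      (triOf t).convex_carrier.addHaar_frontier volume
  · rw [sdiff_eq_empty.2, measure_empty]
    exact iUnion₂_subset fun t ht => interior_carrier_subset ht

variable {M} in
theorem ae_vol {q : Plane → Prop} (h : ∀ t ∈ M.els, ∀ x ∈ interior (triOf t).carrier, q x) :
    ∀ᵐ x ∂M.vol, q x := by
  rw [vol, Measure.restrict_congr_set M.Ω_ae_eq, ae_restrict_biUnion_finset_iff]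
  exact fun t ht => (ae_restrict_mem isOpen_interior.measurableSet).mono (h t ht)

variable {M} in
theorem integrable_vol_iff {E : Type*} [NormedAddCommGroup E] {g : Plane → E} :
    Integrable g M.vol ↔ ∀ t ∈ M.els, IntegrableOn g (interior (triOf t).carrier) := by
  rw [vol, ← IntegrableOn, integrableOn_congr_set_ae M.Ω_ae_eq, integrableOn_finset_iUnion]

variable {M} in
theorem integral_vol {g : Plane → ℝ} (hg : Integrable g M.vol) :
    ∫ x, g x ∂M.vol = ∑ t ∈ M.els, ∫ x in interior (triOf t).carrier, g x := by
  rw [integrable_vol_iff] at hg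
  rw [vol, Measure.restrict_congr_set M.Ω_ae_eq]
  refine integral_biUnion_finset M.els (fun t _ => isOpen_interior.measurableSet) ?_ hg
  exact fun s hs t ht hst => disjoint_interior hs ht hst

/-- Makes `𝓝[Ω] x` nontrivial, so that `gradTrace` is determined by an actual limit. It also lets
continuous functions vanishing on `Ω` vanish on the closed region. -/
theorem closedRegion_subset_closure : M.closedRegion ⊆ closure M.Ω := by
  intro x hx
  obtain ⟨t, ht, hxt⟩ := M.mem_closedRegion.1 hx
  have hne : (interior (triOf t).carrier).Nonempty := by
    rw [← (triOf t).duffy_image 0]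
    exact ⟨_, (1 / 2, 1 / 2), by norm_num [openSquare], rfl⟩
  refine closure_mono (interior_carrier_subset ht) ?_
  rw [(triOf t).convex_carrier.closure_interior_eq_closure_of_nonempty_interior hne]
  exact subset_closure hxt

theorem neBot_nhdsWithin {x : Plane} (hx : x ∈ M.closedRegion) : (𝓝[M.Ω] x).NeBot :=
  mem_closure_iff_nhdsWithin_neBot.1 (M.closedRegion_subset_closure hx)

variable {M} in
theorem norm_e_le_h {t : Finset Plane} (ht : t ∈ M.els) (i : Fin 3) : ‖(triOf t).e i‖ ≤ M.h := by
  have h1 : ‖(triOf t).e i‖ ≤ Metric.diam (cell t) := by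
    rw [Tri.e, ← dist_eq_norm, cell_eq ht]
    exact Metric.dist_le_diam_of_mem (triOf t).isCompact_carrier.isBounded
      (subset_convexHull ℝ _ (mem_range_self _)) (subset_convexHull ℝ _ (mem_range_self _))
  refine h1.trans (le_csSup ?_ (mem_image_of_mem _ (mem_els.1 ht)))
  exact (M.finite_elements.image _).bddAbove

theorem h_pos : 0 < M.h := by
  obtain ⟨t, ht⟩ := M.els_nonempty
  exact ((triOf t).norm_e_pos 0).trans_le (norm_e_le_h ht 0)

end TriMesh

/-! ### Piecewise polynomials: gradients, boundary traces and the trace inequality -/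

theorem pgrad_smul_add (c : ℝ) (p q : MvPolynomial (Fin 2) ℝ) (x : Plane) :
    pgrad (c • p + q) x = c • pgrad p x + pgrad q x := by
  ext k; simp [pgrad, peval, MvPolynomial.smul_eval]

theorem measurable_gradient (u : Plane → ℝ) : Measurable (∇ u) :=
  (InnerProductSpace.toDual ℝ Plane).symm.continuous.measurable.comp (measurable_fderiv ℝ u)

theorem Tri.measurable_nrm (T : Tri) : Measurable T.nrm := by
  unfold Tri.nrm
  exact Finset.measurable_fun_sum _ fun i _ => measurable_const.indicator (T.measurableSet_edge i)

namespace TriMesh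

variable {M : TriMesh} {P : ℕ}

/-- The function `u` is on each triangle `t` the polynomial `p t`, of degree at most `P`. -/
def IsPiecewise (M : TriMesh) (P : ℕ) (u : Plane → ℝ)
    (p : Finset Plane → MvPolynomial (Fin 2) ℝ) : Prop :=
  ∀ t ∈ M.els, (p t).totalDegree ≤ P ∧ ∀ x ∈ (triOf t).carrier, u x = peval (p t) x

theorem exists_isPiecewise {u : Plane → ℝ} (hu : u ∈ M.V P) : ∃ p, M.IsPiecewise P u p := by
  have h : ∀ t, ∃ p : MvPolynomial (Fin 2) ℝ, t ∈ M.els →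
      p.totalDegree ≤ P ∧ ∀ x ∈ (triOf t).carrier, u x = peval p x := by
    intro t
    by_cases ht : t ∈ M.els
    · obtain ⟨p, hp, hpe⟩ := hu.2.1 t (mem_els.1 ht)
      exact ⟨p, fun _ => ⟨hp, fun x hx => hpe x (by rwa [cell_eq ht])⟩⟩
    · exact ⟨0, fun h => absurd h ht⟩
  choose p hp using h
  exact ⟨p, hp⟩

variable {u w : Plane → ℝ} {p q : Finset Plane → MvPolynomial (Fin 2) ℝ}

theorem IsPiecewise.smul_add (hu : M.IsPiecewise P u p) (hw : M.IsPiecewise P w q) (c : ℝ) :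
    M.IsPiecewise P (c • u + w) (c • p + q) := by
  intro t ht
  obtain ⟨h1, h2⟩ := hu t ht
  obtain ⟨h3, h4⟩ := hw t ht
  refine ⟨(MvPolynomial.totalDegree_add _ _).trans
    (max_le ((MvPolynomial.totalDegree_smul_le _ _).trans h1) h3), fun x hx => ?_⟩
  simp only [Pi.add_apply, Pi.smul_apply, h2 x hx, h4 x hx, peval, map_add, smul_eq_mul,
    MvPolynomial.smul_eval]

theorem IsPiecewise.hasGradientAt (hu : M.IsPiecewise P u p) {t : Finset Plane} (ht : t ∈ M.els)
    {x : Plane} (hx : x ∈ interior (triOf t).carrier) : HasGradientAt u (pgrad (p t) x) x := by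
  refine (hasGradientAt_peval (p t) x).congr_of_eventuallyEq ?_
  filter_upwards [isOpen_interior.mem_nhds hx] with y hy
  exact (hu t ht).2 y (interior_subset hy)

theorem IsPiecewise.gradient_eq (hu : M.IsPiecewise P u p) {t : Finset Plane} (ht : t ∈ M.els)
    {x : Plane} (hx : x ∈ interior (triOf t).carrier) : ∇ u x = pgrad (p t) x :=
  (hu.hasGradientAt ht hx).gradient

theorem gradTrace_eq_of_tendsto {x g : Plane} (hx : x ∈ M.closedRegion)
    (h : Tendsto (∇ u) (𝓝[M.Ω] x) (𝓝 g)) : M.gradTrace u x = g := by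
  have := M.neBot_nhdsWithin hx
  exact h.limUnder_eq

theorem IsPiecewise.gradTrace_eq (hu : M.IsPiecewise P u p) {x : Plane} {t : Finset Plane}
    (ht : t ∈ M.els) (hxt : x ∈ (triOf t).carrier)
    (hloc : ∀ᶠ y in 𝓝 x, y ∈ (triOf t).carrier ↔ y ∈ M.closedRegion) :
    M.gradTrace u x = pgrad (p t) x := by
  refine gradTrace_eq_of_tendsto (carrier_subset ht hxt) ?_
  have h1 : Tendsto (pgrad (p t)) (𝓝[M.Ω] x) (𝓝 (pgrad (p t) x)) :=
    ((continuous_pgrad (p t)).tendsto x).mono_left nhdsWithin_le_nhds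
  refine h1.congr' ?_
  -- The triangle agrees with the region in a whole neighbourhood of `y`, so an interior point of
  -- the region is interior to the triangle.
  filter_upwards [nhdsWithin_le_nhds hloc.eventually_nhds, self_mem_nhdsWithin] with y hy hyΩ
  refine (hu.gradient_eq ht ?_).symm
  have hyΩ' : y ∈ interior M.closedRegion := hyΩ
  rw [mem_interior_iff_mem_nhds] at hyΩ' ⊢
  filter_upwards [hy, hyΩ'] with z hz hz' using hz.2 hz'

/-- Off the vertices only one summand is nonzero. The explicit right-hand side supplies the
measurability of the trace, which is defined by a limit. -/
theorem IsPiecewise.gradTrace_ae (hu : M.IsPiecewise P u p) : M.gradTrace u =ᵐ[M.surf]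
    fun x => ∑ t ∈ M.els, (triOf t).carrier.indicator (pgrad (p t)) x := by
  refine ae_surf fun x hΓ hx => ?_
  obtain ⟨t, ht, hxt, -, hone, hloc⟩ := M.exists_boundary_element hΓ hx
  change M.gradTrace u x = ∑ t ∈ M.els, (triOf t).carrier.indicator (pgrad (p t)) x
  rw [hu.gradTrace_eq ht hxt hloc, Finset.sum_eq_single_of_mem t ht, indicator_of_mem hxt]
  intro s hs hst
  exact indicator_of_notMem (hone s hs hst) _

theorem normal_ae : M.normal =ᵐ[M.surf] fun x => ∑ t ∈ M.els, (triOf t).nrm x :=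
  ae_surf fun _ hΓ hx => (M.sum_nrm_of_mem hΓ hx).symm

theorem aestronglyMeasurable_normal : AEStronglyMeasurable M.normal M.surf :=
  (Finset.measurable_fun_sum _ fun t _ => (triOf t).measurable_nrm).aestronglyMeasurable.congr
    normal_ae.symm

theorem exists_bound_pgrad (M : TriMesh) (p : Finset Plane → MvPolynomial (Fin 2) ℝ) :
    ∃ C : ℝ, 0 ≤ C ∧ ∀ t ∈ M.els, ∀ x ∈ (triOf t).carrier, ‖pgrad (p t) x‖ ≤ C := by
  have h : ∀ t, ∃ C : ℝ, ∀ x ∈ (triOf t).carrier, ‖pgrad (p t) x‖ ≤ C := fun t =>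
    (triOf t).isCompact_carrier.exists_bound_of_continuousOn (continuous_pgrad (p t)).continuousOn
  choose C hC using h
  refine ⟨∑ t ∈ M.els, |C t|, Finset.sum_nonneg fun _ _ => abs_nonneg _, fun t ht x hx => ?_⟩
  exact (hC t x hx).trans ((le_abs_self _).trans
    (Finset.single_le_sum (f := fun t => |C t|) (fun _ _ => abs_nonneg _) ht))

theorem memLp_gradient (hu : u ∈ M.V P) : MemLp (∇ u) 2 M.vol := by
  obtain ⟨p, hp⟩ := exists_isPiecewise hu
  obtain ⟨C, -, hC⟩ := M.exists_bound_pgrad p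
  refine MemLp.of_bound (measurable_gradient u).aestronglyMeasurable C (ae_vol ?_)
  intro t ht x hx
  rw [hp.gradient_eq ht hx]
  exact hC t ht x (interior_subset hx)

theorem memLp_gradTrace (hu : u ∈ M.V P) : MemLp (M.gradTrace u) 2 M.surf := by
  obtain ⟨p, hp⟩ := exists_isPiecewise hu
  obtain ⟨C, -, hC⟩ := M.exists_bound_pgrad p
  refine MemLp.of_bound (AEStronglyMeasurable.congr ?_ hp.gradTrace_ae.symm) C (ae_surf ?_)
  · refine Measurable.aestronglyMeasurable ?_
    exact Finset.measurable_fun_sum _ fun t _ =>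
      (continuous_pgrad (p t)).measurable.indicator (triOf t).isClosed_carrier.measurableSet
  · intro x hΓ hx
    obtain ⟨t, ht, hxt, -, hone, hloc⟩ := M.exists_boundary_element hΓ hx
    rw [hp.gradTrace_eq ht hxt hloc]
    exact hC t ht x hxt

theorem abs_dn_le (M : TriMesh) (u : Plane → ℝ) (x : Plane) : ‖M.dn u x‖ ≤ ‖M.gradTrace u x‖ := by
  rw [dn]
  refine (norm_inner_le_norm _ _).trans ?_
  exact mul_le_of_le_one_right (norm_nonneg _) (M.norm_normal_le x)

theorem memLp_dn (hu : u ∈ M.V P) : MemLp (M.dn u) 2 M.surf :=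
  (memLp_gradTrace hu).mono
    ((memLp_gradTrace hu).aestronglyMeasurable.inner aestronglyMeasurable_normal)
    (Eventually.of_forall (M.abs_dn_le u))

theorem memLp_vol_of_continuousOn (hu : ContinuousOn u M.closedRegion) : MemLp u 2 M.vol := by
  obtain ⟨C, hC⟩ := M.isCompact_closedRegion.exists_bound_of_continuousOn hu
  refine MemLp.of_bound ((hu.mono M.Ω_subset).aestronglyMeasurable M.measurableSet_Ω) C ?_
  exact (ae_restrict_mem M.measurableSet_Ω).mono fun x hx => hC x (M.Ω_subset hx)

theorem memLp_surf_of_continuousOn (hu : ContinuousOn u M.closedRegion) : MemLp u 2 M.surf := by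
  obtain ⟨C, hC⟩ := M.isCompact_closedRegion.exists_bound_of_continuousOn hu
  refine MemLp.of_bound ((hu.mono M.Γ_subset).aestronglyMeasurable M.measurableSet_Γ) C ?_
  exact (ae_restrict_mem M.measurableSet_Γ).mono fun x hx => hC x (M.Γ_subset hx)

/-- Only almost everywhere: across interior edges the functions need not be differentiable, and `∇`
takes its default value there. -/
theorem gradient_smul_add_ae (hu : u ∈ M.V P) (hw : w ∈ M.V P) (c : ℝ) :
    ∀ᵐ x ∂M.vol, ∇ (c • u + w) x = c • ∇ u x + ∇ w x := by
  obtain ⟨p, hp⟩ := exists_isPiecewise hu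
  obtain ⟨q, hq⟩ := exists_isPiecewise hw
  refine ae_vol fun t ht x hx => ?_
  rw [(hp.smul_add hq c).gradient_eq ht hx, hp.gradient_eq ht hx, hq.gradient_eq ht hx]
  exact pgrad_smul_add _ _ _ _

theorem dn_smul_add_ae (hu : u ∈ M.V P) (hw : w ∈ M.V P) (c : ℝ) :
    ∀ᵐ x ∂M.surf, M.dn (c • u + w) x = c * M.dn u x + M.dn w x := by
  obtain ⟨p, hp⟩ := exists_isPiecewise hu
  obtain ⟨q, hq⟩ := exists_isPiecewise hw
  refine ae_surf fun x hΓ hx => ?_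
  obtain ⟨t, ht, hxt, -, hone, hloc⟩ := M.exists_boundary_element hΓ hx
  rw [dn, (hp.smul_add hq c).gradTrace_eq ht hxt hloc, dn, hp.gradTrace_eq ht hxt hloc,
    dn, hq.gradTrace_eq ht hxt hloc, Pi.add_apply, Pi.smul_apply, pgrad_smul_add, inner_add_left,
    real_inner_smul_left]

/-- A boundary point off the vertices lies on an edge of the triangle that determines its trace.
Interior edges on the right only add nonnegative terms. -/
theorem IsPiecewise.integral_norm_sq_gradTrace_le (hp : M.IsPiecewise P u p) :
    ∫ x, ‖M.gradTrace u x‖ ^ 2 ∂M.surf ≤ ∑ t ∈ M.els, ∑ i,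
      ∫ x in (triOf t).edge i, ‖pgrad (p t) x‖ ^ 2 ∂(Measure.hausdorffMeasure 1) := by
  set G : Finset Plane → Fin 3 → Plane → ℝ := fun t i =>
    ((triOf t).edge i).indicator fun x => ‖pgrad (p t) x‖ ^ 2 with hG
  have hGi : ∀ t i, Integrable (G t i) (Measure.hausdorffMeasure 1) := fun t i => by
    rw [hG, integrable_indicator_iff ((triOf t).measurableSet_edge i)]
    exact (triOf t).integrableOn_edge i (by fun_prop)
  have hG0 : ∀ t i x, 0 ≤ G t i x := fun t i x => indicator_nonneg (fun _ _ => by positivity) x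
  have hSi : Integrable (fun x => ∑ t ∈ M.els, ∑ i, G t i x) (Measure.hausdorffMeasure 1) :=
    integrable_finsetSum _ fun t _ => integrable_finsetSum _ fun i _ => hGi t i
  calc ∫ x, ‖M.gradTrace u x‖ ^ 2 ∂M.surf ≤ ∫ x, ∑ t ∈ M.els, ∑ i, G t i x ∂M.surf := by
        refine integral_mono_of_nonneg (Eventually.of_forall fun x => by positivity)
          hSi.integrableOn (ae_surf fun x hΓ hx => ?_)
        obtain ⟨t, ht, hxt, hni, hone, hloc⟩ := M.exists_boundary_element hΓ hx
        obtain ⟨i, hi⟩ := (triOf t).exists_edge_of_notMem_interior hxt hni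
        change ‖M.gradTrace u x‖ ^ 2 ≤ _
        rw [hp.gradTrace_eq ht hxt hloc]
        calc ‖pgrad (p t) x‖ ^ 2 = G t i x := by simp only [hG, indicator_of_mem hi]
          _ ≤ ∑ i, G t i x :=
            Finset.single_le_sum (f := fun i => G t i x) (fun j _ => hG0 t j x) (Finset.mem_univ i)
          _ ≤ _ := Finset.single_le_sum (f := fun t => ∑ i, G t i x)
            (fun s _ => Finset.sum_nonneg fun j _ => hG0 s j x) ht
    _ ≤ ∫ x, ∑ t ∈ M.els, ∑ i, G t i x ∂(Measure.hausdorffMeasure 1) := by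
        refine setIntegral_le_integral hSi (Eventually.of_forall fun x => ?_)
        exact Finset.sum_nonneg fun s _ => Finset.sum_nonneg fun j _ => hG0 s j x
    _ = _ := by
        rw [integral_finsetSum _ fun t _ => integrable_finsetSum _ fun i _ => hGi t i]
        refine Finset.sum_congr rfl fun t _ => ?_
        rw [integral_finsetSum _ fun i _ => hGi t i]
        refine Finset.sum_congr rfl fun i _ => ?_
        rw [hG, integral_indicator ((triOf t).measurableSet_edge i)]

theorem _root_.NitscheRobin.Tri.integral_edge_norm_sq_le (T : Tri) {C : ℝ}
    (hC : ∀ r : Polynomial ℝ, r.natDegree ≤ P →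
      (r.eval 1) ^ 2 ≤ C * ∫ s in (0 : ℝ)..1, s * (r.eval s) ^ 2)
    {p : MvPolynomial (Fin 2) ℝ} (hp : p.totalDegree ≤ P) (i : Fin 3) :
    ∫ x in T.edge i, ‖pgrad p x‖ ^ 2 ∂(Measure.hausdorffMeasure 1) ≤
      C * ‖T.e i‖ / T.D * ∫ x in interior T.carrier, ‖pgrad p x‖ ^ 2 := by
  simp only [norm_sq_pgrad]
  rw [integral_finsetSum, integral_finsetSum, Finset.mul_sum]
  · exact Finset.sum_le_sum fun k _ =>
      T.integral_edge_sq_le hC ((totalDegree_pderiv_le p k).trans hp) i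
  · exact fun k _ => T.integrableOn_interior (by fun_prop)
  · exact fun k _ => T.integrableOn_edge i (by fun_prop)

theorem exists_isTraceConstant (P : ℕ) {κ : ℝ} (hκ : 0 < κ) :
    ∃ CI : ℝ, 0 < CI ∧ ∀ M : TriMesh, M.IsRegular κ → M.IsTraceConstant P CI := by
  obtain ⟨C, hC0, hC⟩ := exists_sq_eval_one_le P
  -- Each of the three edges of a triangle contributes `h * C * ‖e‖ / D`, which is at most `C / (2 *
  -- κ)` because `‖e‖ ≤ h` and `D ≥ 2 * κ * h ^ 2`.
  refine ⟨3 * (C / (2 * κ)), by positivity, fun M hM u hu => ?_⟩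
  obtain ⟨p, hp⟩ := exists_isPiecewise hu
  have hgi : Integrable (fun x => ‖∇ u x‖ ^ 2) M.vol := by
    simpa using (memLp_gradient hu).integrable_norm_pow (by norm_num)
  have hvol : ∫ x, ‖∇ u x‖ ^ 2 ∂M.vol =
      ∑ t ∈ M.els, ∫ x in interior (triOf t).carrier, ‖pgrad (p t) x‖ ^ 2 := by
    rw [integral_vol hgi]
    refine Finset.sum_congr rfl fun t ht => setIntegral_congr_fun isOpen_interior.measurableSet ?_
    intro x hx
    simp only [hp.gradient_eq ht hx]
  have hh := M.h_pos
  rw [hvol]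
  refine (mul_le_mul_of_nonneg_left hp.integral_norm_sq_gradTrace_le hh.le).trans ?_
  rw [Finset.mul_sum, Finset.mul_sum]
  refine Finset.sum_le_sum fun t ht => ?_
  have hI : 0 ≤ ∫ x in interior (triOf t).carrier, ‖pgrad (p t) x‖ ^ 2 :=
    integral_nonneg fun x => by positivity
  have hD := (triOf t).D_pos
  have hreg : κ * M.h ^ 2 ≤ (triOf t).D / 2 := by
    have := hM t (mem_els.1 ht)
    rwa [cell_eq ht, Tri.volume_carrier] at this
  have hedge : ∀ i, M.h * ∫ x in (triOf t).edge i, ‖pgrad (p t) x‖ ^ 2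
      ∂(Measure.hausdorffMeasure 1) ≤
      C / (2 * κ) * ∫ x in interior (triOf t).carrier, ‖pgrad (p t) x‖ ^ 2 := by
    intro i
    refine (mul_le_mul_of_nonneg_left
      ((triOf t).integral_edge_norm_sq_le hC (hp t ht).1 i) hh.le).trans ?_
    rw [← mul_assoc]
    refine mul_le_mul_of_nonneg_right ?_ hI
    have he := norm_e_le_h ht i
    rw [← mul_div_assoc, div_le_div_iff₀ hD (by positivity)]
    calc M.h * (C * ‖(triOf t).e i‖) * (2 * κ) ≤ M.h * (C * M.h) * (2 * κ) := by gcongr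
      _ = C * (2 * (κ * M.h ^ 2)) := by ring
      _ ≤ C * (triOf t).D := by gcongr; linarith
  rw [Finset.mul_sum]
  calc _ ≤ ∑ i : Fin 3, C / (2 * κ) * ∫ x in interior (triOf t).carrier, ‖pgrad (p t) x‖ ^ 2 :=
        Finset.sum_le_sum fun i _ => hedge i
    _ = _ := by simp; ring

end TriMesh

/-! ### Green's formula for classical solutions -/

theorem gradient_apply (u : Plane → ℝ) (x : Plane) (i : Fin 2) :
    ∇ u x i = fderiv ℝ u x (EuclideanSpace.single i 1) := by
  have h : inner ℝ (∇ u x) (EuclideanSpace.single i (1 : ℝ)) =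
      fderiv ℝ u x (EuclideanSpace.single i 1) := by
    rw [gradient, InnerProductSpace.toDual_symm_apply]
  rw [← h, EuclideanSpace.inner_single_right]
  simp

theorem hasFDerivAt_gradient {u : Plane → ℝ} {x : Plane} (hu : ContDiffAt ℝ 2 u x) :
    HasFDerivAt (∇ u) (fderiv ℝ (∇ u) x) x ∧
      divg (fderiv ℝ (∇ u) x) = Laplacian.laplacian u x := by
  have h1 : DifferentiableAt ℝ (fderiv ℝ u) x :=
    (hu.fderiv_right (m := 1) (by norm_num)).differentiableAt (by norm_num)
  have h2 : ∀ i : Fin 2, HasFDerivAt (fun y => ∇ u y i)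
      ((ContinuousLinearMap.apply ℝ ℝ (EuclideanSpace.single i (1 : ℝ))).comp
        (fderiv ℝ (fderiv ℝ u) x)) x := by
    intro i
    simp only [gradient_apply]
    exact (ContinuousLinearMap.apply ℝ ℝ (EuclideanSpace.single i (1 : ℝ))).hasFDerivAt.comp x
      h1.hasFDerivAt
  have h3 : HasFDerivAt (∇ u) (fderiv ℝ (∇ u) x) x :=
    (differentiableAt_euclidean.2 fun i => (h2 i).differentiableAt).hasFDerivAt
  have h4 : ∀ (i : Fin 2) (d : Plane), fderiv ℝ (∇ u) x d i =
      fderiv ℝ (fderiv ℝ u) x d (EuclideanSpace.single i 1) := by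
    intro i d
    have := ((EuclideanSpace.proj i : Plane →L[ℝ] ℝ).hasFDerivAt.comp x h3).unique (h2 i)
    simpa using congrArg (fun L => L d) this
  refine ⟨h3, ?_⟩
  rw [InnerProductSpace.laplacian_eq_iteratedFDeriv_orthonormalBasis u
    (EuclideanSpace.basisFun (Fin 2) ℝ), divg, h4, h4]
  simp [iteratedFDeriv_two_apply]

theorem divg_add_smulRight (A : Plane →L[ℝ] Plane) (c : ℝ) (φ : Plane →L[ℝ] ℝ) (g : Plane) :
    divg (c • A + φ.smulRight g) = c * divg A +
      (φ (EuclideanSpace.single 0 1) * g 0 + φ (EuclideanSpace.single 1 1) * g 1) := by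
  simp [divg]; ring

theorem integrable_inner_of_memLp {μ : Measure Plane} {F G : Plane → Plane} (hF : MemLp F 2 μ)
    (hG : MemLp G 2 μ) : Integrable (fun x => inner ℝ (F x) (G x)) μ :=
  (hF.norm.integrable_mul hG.norm).mono' (hF.aestronglyMeasurable.inner hG.aestronglyMeasurable)
    (Eventually.of_forall fun _ => norm_inner_le_norm _ _)

namespace TriMesh

variable {M : TriMesh} {P : ℕ} {α : ℝ} {f q u v : Plane → ℝ}

theorem IsClassicalNeumann.memLp_gradient (hu : M.IsClassicalNeumann α f q u) :
    MemLp (∇ u) 2 M.vol := by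
  obtain ⟨G, hG, hGu⟩ := hu.grad
  obtain ⟨C, hC⟩ := M.isCompact_closedRegion.exists_bound_of_continuousOn hG
  refine MemLp.of_bound (measurable_gradient u).aestronglyMeasurable C ?_
  refine (ae_restrict_mem M.measurableSet_Ω).mono fun x hx => ?_
  rw [← hGu hx]
  exact hC x (M.Ω_subset hx)

/-- The divergence theorem on one triangle for the product of a polynomial and the gradient of a
classical solution. -/
theorem IsClassicalNeumann.integral_element (hu : M.IsClassicalNeumann α f q u)
    {t : Finset Plane} (ht : t ∈ M.els) {G : Plane → Plane} (hG : ContinuousOn G M.closedRegion)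
    (hGu : EqOn G (∇ u) M.Ω) (p : MvPolynomial (Fin 2) ℝ)
    (hi : IntegrableOn (fun x => inner ℝ (∇ u x) (pgrad p x) + (α * u x - f x) * peval p x)
      (interior (triOf t).carrier)) :
    ∫ x in interior (triOf t).carrier,
      (inner ℝ (∇ u x) (pgrad p x) + (α * u x - f x) * peval p x) =
      ∫ x, inner ℝ (peval p x • G x) ((triOf t).nrm x) ∂(Measure.hausdorffMeasure 1) := by
  set F' : Plane → Plane →L[ℝ] Plane := fun x => peval p x • fderiv ℝ (∇ u) x +
    (∑ k, peval (MvPolynomial.pderiv k p) x •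
      (EuclideanSpace.proj k : Plane →L[ℝ] ℝ)).smulRight (∇ u x) with hF'
  have hder : ∀ x ∈ M.Ω, HasFDerivAt (∇ u) (fderiv ℝ (∇ u) x) x ∧
      divg (fderiv ℝ (∇ u) x) = Laplacian.laplacian u x := fun x hx =>
    hasFDerivAt_gradient (hu.smooth.contDiffAt (M.isOpen_Ω.mem_nhds hx))
  -- The product rule for `p ∇u`, with the Laplacian replaced by `α u - f` through the equation.
  have hdiv : EqOn (fun x => inner ℝ (∇ u x) (pgrad p x) + (α * u x - f x) * peval p x)
      (fun x => divg (F' x)) (interior (triOf t).carrier) := by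
    intro x hx
    have hxΩ := interior_carrier_subset ht hx
    have hpde := hu.pde x hxΩ
    simp only [hF']
    rw [divg_add_smulRight, (hder x hxΩ).2]
    simp only [pgrad, PiLp.inner_apply, Fin.sum_univ_two]
    simp
    linear_combination (peval p x) * hpde
  rw [setIntegral_congr_fun isOpen_interior.measurableSet hdiv]
  refine (triOf t).integral_divg_eq_flux ?_ ?_ ?_
  · exact (continuous_peval p).continuousOn.smul (hG.mono (carrier_subset ht))
  · intro x hx
    have hxΩ := interior_carrier_subset ht hx
    refine ((hasFDerivAt_peval p x).smul (hder x hxΩ).1).congr_of_eventuallyEq ?_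
    filter_upwards [M.isOpen_Ω.mem_nhds hxΩ] with y hy
    rw [hGu hy]
    rfl
  -- Second derivatives may blow up at the boundary; the divergence is integrable because the
  -- equation identifies it with an integrable function.
  · exact hi.congr_fun hdiv isOpen_interior.measurableSet

theorem dn_eq_of_extension {G : Plane → Plane}
    (hG : ContinuousOn G M.closedRegion) (hGu : EqOn G (∇ u) M.Ω) {x : Plane} (hx : x ∈ M.Γ) :
    M.dn u x = inner ℝ (G x) (M.normal x) := by
  rw [dn, gradTrace_eq_of_tendsto (M.Γ_subset hx)]
  refine ((hG x (M.Γ_subset hx)).mono M.Ω_subset).tendsto.congr' ?_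
  filter_upwards [self_mem_nhdsWithin] with y hy using hGu hy

/-- Green's formula for a classical solution and a finite element test function. -/
theorem IsClassicalNeumann.green (hu : M.IsClassicalNeumann α f q u) (hf : MemLp f 2 M.vol)
    (hv : v ∈ M.V P) : M.formI α u v - M.ipΩ f v - M.ipΓ q v = 0 := by
  obtain ⟨G, hG, hGu⟩ := hu.grad
  obtain ⟨p, hp⟩ := exists_isPiecewise hv
  have hi1 : Integrable (fun x => inner ℝ (∇ u x) (∇ v x)) M.vol :=
    integrable_inner_of_memLp hu.memLp_gradient (TriMesh.memLp_gradient hv)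
  have hi2 : Integrable (fun x => u x * v x) M.vol :=
    (memLp_vol_of_continuousOn hu.cont).integrable_mul (memLp_vol_of_continuousOn hv.1)
  have hi3 : Integrable (fun x => f x * v x) M.vol :=
    hf.integrable_mul (memLp_vol_of_continuousOn hv.1)
  have hi : Integrable (fun x => inner ℝ (∇ u x) (∇ v x) + (α * (u x * v x) - f x * v x)) M.vol :=
    hi1.add ((hi2.const_mul α).sub hi3)
  have hsum : M.formI α u v - M.ipΩ f v =
      ∫ x, (inner ℝ (∇ u x) (∇ v x) + (α * (u x * v x) - f x * v x)) ∂M.vol := by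
    have hi4 : Integrable (fun x => α * (u x * v x) - f x * v x) M.vol :=
      (hi2.const_mul α).sub hi3
    rw [integral_add hi1 hi4, integral_sub (hi2.const_mul α) hi3,
      integral_const_mul, formI, gradIp, ipΩ, ipΩ]
    ring
  have helt : ∀ t ∈ M.els, EqOn
      (fun x => inner ℝ (∇ u x) (∇ v x) + (α * (u x * v x) - f x * v x))
      (fun x => inner ℝ (∇ u x) (pgrad (p t) x) + (α * u x - f x) * peval (p t) x)
      (interior (triOf t).carrier) := by
    intro t ht x hx
    simp only
    rw [hp.gradient_eq ht hx, (hp t ht).2 x (interior_subset hx)]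
    ring
  have hflux : ∀ t ∈ M.els, ∫ x in interior (triOf t).carrier,
      (inner ℝ (∇ u x) (∇ v x) + (α * (u x * v x) - f x * v x)) =
      ∫ x, inner ℝ (v x • G x) ((triOf t).nrm x) ∂(Measure.hausdorffMeasure 1) := by
    intro t ht
    rw [setIntegral_congr_fun isOpen_interior.measurableSet (helt t ht),
      hu.integral_element ht hG hGu (p t)
        ((integrable_vol_iff.1 hi t ht).congr_fun (helt t ht) isOpen_interior.measurableSet)]
    -- The triangle's normal field vanishes off the triangle, so its polynomial may be replaced by
    -- `v`. The same field `v • G` then occurs in every flux and the normals can be added.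
    refine integral_congr_ae (Eventually.of_forall fun x => ?_)
    by_cases hx : x ∈ (triOf t).carrier
    · simp only [(hp t ht).2 x hx]
    · simp only [(triOf t).nrm_eq_zero_of_notMem hx, inner_zero_right]
  have hvG : ContinuousOn (fun x => v x • G x) M.closedRegion := hv.1.smul hG
  rw [hsum, integral_vol hi, Finset.sum_congr rfl hflux, ← integral_finsetSum, sub_eq_zero]
  · simp only [← inner_sum]
    rw [ipΓ, surf, ← integral_indicator M.measurableSet_Γ]
    have hq : ∀ᵐ x ∂(Measure.hausdorffMeasure 1 : Measure Plane), x ∈ M.Γ → M.dn u x = q x :=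
      (ae_restrict_iff' M.measurableSet_Γ).1 hu.flux
    refine integral_congr_ae ?_
    filter_upwards [M.ae_notMem_verts, hq] with x hx hqx
    by_cases hΓ : x ∈ M.Γ
    · rw [indicator_of_mem hΓ, M.sum_nrm_of_mem hΓ hx, ← hqx hΓ, dn_eq_of_extension hG hGu hΓ,
        real_inner_smul_left, mul_comm]
    · rw [indicator_of_notMem hΓ, M.sum_nrm_of_notMem hΓ hx, inner_zero_right]
  · exact fun t ht => (triOf t).integrable_flux (hvG.mono (carrier_subset ht))

end TriMesh

/-! ### Finite-dimensional linear algebra -/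

section LinearAlgebra

variable {V : Type*} [AddCommGroup V] [Module ℝ V]

/-- A linear functional from its compatibility with `c • u + w`. -/
def functionalOf (L : V → ℝ) (h : ∀ (c : ℝ) u w, L (c • u + w) = c * L u + L w) : V →ₗ[ℝ] ℝ where
  toFun := L
  map_add' u w := by simpa using h 1 u w
  map_smul' c u := by
    have h0 : L 0 = 0 := by have := h 1 0 0; simp at this; linarith
    simpa [h0] using h c u 0

/-- A bilinear form from its compatibility with `c • u + w` in both variables. -/
def bilinOf (B : V → V → ℝ) (hl : ∀ (c : ℝ) u w v, B (c • u + w) v = c * B u v + B w v)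
    (hr : ∀ (c : ℝ) u w v, B v (c • u + w) = c * B v u + B v w) : V →ₗ[ℝ] V →ₗ[ℝ] ℝ :=
  LinearMap.mk₂ ℝ B
    (fun u w v => (functionalOf (fun u => B u v) fun c u w => hl c u w v).map_add u w)
    (fun c u v => (functionalOf (fun u => B u v) fun c u w => hl c u w v).map_smul c u)
    (fun u v w => (functionalOf (fun v => B u v) fun c v w => hr c v w u).map_add v w)
    (fun c u v => (functionalOf (fun v => B u v) fun c v w => hr c v w u).map_smul c v)

/-- A nondegenerate bilinear form on a finite-dimensional space represents every functional. -/
theorem existsUnique_of_injective [FiniteDimensional ℝ V] (a : V →ₗ[ℝ] V →ₗ[ℝ] ℝ) (ha : Function.Injective a)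
    (L : V →ₗ[ℝ] ℝ) : ∃! z, ∀ v, a z v = L v := by
  have hs : Function.Surjective a :=
    (LinearMap.injective_iff_surjective_of_finrank_eq_finrank
      (Subspace.dual_finrank_eq (K := ℝ) (V := V)).symm).1 ha
  obtain ⟨z, hz⟩ := hs L
  refine ⟨z, fun v => by rw [hz], fun y hy => ha ?_⟩
  rw [hz]
  exact LinearMap.ext hy

theorem injective_of_pos (a : V →ₗ[ℝ] V →ₗ[ℝ] ℝ) (ha : ∀ u, u ≠ 0 → 0 < a u u) :
    Function.Injective a := by
  refine (injective_iff_map_eq_zero a).2 fun u hu => ?_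
  by_contra h
  have := ha u h
  rw [hu] at this
  simp at this

/-- Small perturbations of a nondegenerate bilinear form are uniformly stable. -/
theorem exists_stable {ι : Type*} [Fintype ι] (e : Module.Basis ι ℝ V)
    (a b : V →ₗ[ℝ] V →ₗ[ℝ] ℝ) (ha : Function.Injective a) :
    ∃ τ₀ > 0, ∃ K : ℝ, 0 ≤ K ∧ ∀ τ : ℝ, |τ| ≤ τ₀ → ∀ (u : V) (δ : ℝ), 0 ≤ δ →
      (∀ k, |a u (e k) + τ * b u (e k)| ≤ δ) → ∀ j, |e.repr u j| ≤ K * δ := by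
  have hmk : ∀ b : V →ₗ[ℝ] V →ₗ[ℝ] ℝ, ∃ B : (ι → ℝ) →ₗ[ℝ] (ι → ℝ),
      ∀ c k, B c k = b (e.equivFun.symm c) (e k) := fun b =>
    ⟨LinearMap.pi fun k => (b.flip (e k)).comp e.equivFun.symm.toLinearMap, fun c k => rfl⟩
  obtain ⟨A, hA⟩ := hmk a
  obtain ⟨B, hB⟩ := hmk b
  have hAi : LinearMap.ker A = ⊥ := by
    rw [LinearMap.ker_eq_bot']
    intro c hc
    have : a (e.equivFun.symm c) = 0 := e.ext fun k => by
      rw [← hA, hc]; rfl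
    rw [← map_zero a] at this
    exact (LinearEquiv.map_eq_zero_iff _).1 (ha this)
  -- In coordinates the form `a` becomes an injective matrix, hence one bounded below.
  obtain ⟨K₀, hK₀, hK⟩ := A.exists_antilipschitzWith hAi
  have hA' : ∀ c, ‖c‖ ≤ K₀ * ‖A c‖ := fun c => by
    simpa using hK.le_mul_dist c 0
  set Bc := LinearMap.toContinuousLinearMap B
  have hB' : ∀ c, ‖B c‖ ≤ ‖Bc‖ * ‖c‖ := fun c => Bc.le_opNorm c
  have hKp : (0 : ℝ) < K₀ := NNReal.coe_pos.2 hK₀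
  -- For such `τ` the perturbation costs at most `‖c‖ / 2`, which is absorbed on the left and
  -- doubles the constant. The `+ 1` covers `Bc = 0`.
  refine ⟨1 / (2 * K₀ * (‖Bc‖ + 1)), by positivity, 2 * K₀, by positivity, ?_⟩
  intro τ hτ u δ hδ hu j
  set c : ι → ℝ := e.equivFun u with hc
  have hcu : e.equivFun.symm c = u := by simp [hc]
  have h1 : ‖A c + τ • B c‖ ≤ δ := by
    rw [pi_norm_le_iff_of_nonneg hδ]
    intro k
    simpa [hA, hB, hcu] using hu k
  have h2 : ‖A c‖ ≤ δ + |τ| * (‖Bc‖ * ‖c‖) := by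
    calc ‖A c‖ = ‖(A c + τ • B c) - τ • B c‖ := by simp
      _ ≤ ‖A c + τ • B c‖ + ‖τ • B c‖ := norm_sub_le _ _
      _ ≤ _ := by
        rw [norm_smul, Real.norm_eq_abs]
        gcongr
        exact hB' c
  have h3 : K₀ * (|τ| * (‖Bc‖ * ‖c‖)) ≤ ‖c‖ / 2 := by
    calc K₀ * (|τ| * (‖Bc‖ * ‖c‖)) ≤
        K₀ * (1 / (2 * K₀ * (‖Bc‖ + 1)) * ((‖Bc‖ + 1) * ‖c‖)) := by gcongr; linarith
      _ = ‖c‖ / 2 := by field_simp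
  have h4 : ‖c‖ ≤ 2 * K₀ * δ := by
    have := (hA' c).trans (mul_le_mul_of_nonneg_left h2 hKp.le)
    rw [mul_add] at this
    linarith
  exact (norm_le_pi_norm c j).trans h4

end LinearAlgebra

/-- On a finite-dimensional space of functions every linear functional is a finite combination of
point evaluations. -/
theorem exists_eval_repr {X : Type*} (W : Submodule ℝ (X → ℝ)) [FiniteDimensional ℝ W]
    (L : W →ₗ[ℝ] ℝ) : ∃ c : X →₀ ℝ, ∀ w : W, L w = c.sum fun x a => a * (w : X → ℝ) x := by
  set ev : X → Module.Dual ℝ W := fun x => (LinearMap.proj x).comp W.subtype with hev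
  have htop : Submodule.span ℝ (range ev) = ⊤ := by
    -- A function on which all evaluations vanish is zero. In finite dimension the span of the
    -- evaluations is then the whole dual.
    have hbot : (Submodule.span ℝ (range ev)).dualCoannihilator = ⊥ := by
      rw [eq_bot_iff]
      intro w hw
      rw [Submodule.mem_dualCoannihilator] at hw
      refine Subtype.ext (funext fun x => ?_)
      exact hw (ev x) (Submodule.subset_span (mem_range_self x))
    rw [← Subspace.dualCoannihilator_dualAnnihilator_eq (W := Submodule.span ℝ (range ev)), hbot,
      Submodule.dualAnnihilator_bot]
  have hL : L ∈ Submodule.span ℝ (range ev) := htop ▸ Submodule.mem_top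
  rw [Finsupp.mem_span_range_iff_exists_finsupp] at hL
  obtain ⟨c, rfl⟩ := hL
  refine ⟨c, fun w => ?_⟩
  simp [Finsupp.sum, hev, LinearMap.sum_apply]

/-! ### Powers of `ε⁻¹` and the recursion of the error terms -/

theorem isLittleO_const_mul_inv_pow {c : ℝ} {N : ℕ}
    (h : (fun ε : ℝ => (ε⁻¹) ^ N * c) =o[atTop] fun ε : ℝ => (ε⁻¹) ^ N) : c = 0 := by
  by_contra hc
  have h1 : (fun ε : ℝ => (ε⁻¹) ^ N) =o[atTop] fun ε : ℝ => (ε⁻¹) ^ N := by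
    have := h.const_mul_left c⁻¹
    refine this.congr_left fun ε => ?_
    field_simp
  refine isLittleO_irrefl ?_ h1
  refine Eventually.frequently ?_
  filter_upwards [eventually_gt_atTop 0] with ε hε
  positivity

theorem isLittleO_inv_pow_succ (N : ℕ) :
    (fun ε : ℝ => (ε⁻¹) ^ (N + 1)) =o[atTop] fun ε : ℝ => (ε⁻¹) ^ N := by
  have h : (fun ε : ℝ => ε⁻¹) =o[atTop] fun _ : ℝ => (1 : ℝ) :=
    (isLittleO_one_iff ℝ).2 tendsto_inv_atTop_zero
  have := (isBigO_refl (fun ε : ℝ => (ε⁻¹) ^ N) atTop).mul_isLittleO h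
  simpa [pow_succ] using this

/-- A polynomial in `ε⁻¹` of degree `N` which is `o(ε⁻ᴺ)` vanishes. -/
theorem isLittleO_sum_inv_pow_iff (c : ℕ → ℝ) (N : ℕ) :
    (fun ε : ℝ => ∑ m ∈ Finset.range (N + 1), (ε⁻¹) ^ m * c m) =o[atTop]
      (fun ε : ℝ => (ε⁻¹) ^ N) ↔ ∀ m ≤ N, c m = 0 := by
  constructor
  · induction N with
    | zero =>
      intro h m hm
      obtain rfl : m = 0 := by omega
      refine isLittleO_const_mul_inv_pow (N := 0) (h.congr_left fun ε => ?_)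
      simp
    | succ N ih =>
      intro h
      -- The top term is negligible at order `N`, so the induction hypothesis first removes all
      -- lower coefficients.
      have h1 : (fun ε : ℝ => (ε⁻¹) ^ (N + 1) * c (N + 1)) =o[atTop] fun ε : ℝ => (ε⁻¹) ^ N := by
        have := (isLittleO_inv_pow_succ N).const_mul_left (c (N + 1))
        exact this.congr_left fun ε => mul_comm _ _
      have h2 := (h.trans (isLittleO_inv_pow_succ N)).sub h1
      have h3 := ih (h2.congr_left fun ε => by rw [Finset.sum_range_succ _ (N + 1)]; ring)
      intro m hm
      rcases Nat.le_succ_iff.1 hm with hm | rfl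
      · exact h3 m hm
      · refine isLittleO_const_mul_inv_pow (h.congr_left fun ε => ?_)
        rw [Finset.sum_range_succ, Finset.sum_eq_zero, zero_add]
        intro k hk
        rw [h3 k (by have := Finset.mem_range.1 hk; omega), mul_zero]
  · intro h
    refine (isLittleO_zero _ _).congr_left fun ε => ?_
    symm
    exact Finset.sum_eq_zero fun m hm => by
      rw [h m (by have := Finset.mem_range.1 hm; omega), mul_zero]

/-- The coefficients of `ε⁻ᵐ` in the Robin residual, multiplied by `1 + γ ε⁻¹`. -/
def cascadeCoeff (γ : ℝ) (B n : ℕ → ℝ) : ℕ → ℝ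
  | 0 => B 0
  | m + 1 => B (m + 1) + γ * B m - γ ^ 2 * n m

/-- The sum on the right obeys `E (m + 1) = -γ * E m + γ ^ 2 * n m`, the very recursion that
vanishing coefficients impose on `B`. This is where the error terms come from. -/
theorem cascadeCoeff_eq_zero_iff (γ : ℝ) (B n : ℕ → ℝ) (N : ℕ) :
    (∀ m ≤ N, cascadeCoeff γ B n m = 0) ↔
      ∀ m ≤ N, B m = ∑ l ∈ Finset.range m, (-γ) ^ (m + 1 - l) * n l := by
  have hE : ∀ m, ∑ l ∈ Finset.range (m + 1), (-γ) ^ (m + 1 + 1 - l) * n l =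
      -γ * ∑ l ∈ Finset.range m, (-γ) ^ (m + 1 - l) * n l + γ ^ 2 * n m := by
    intro m
    rw [Finset.sum_range_succ, Finset.mul_sum, show m + 1 + 1 - m = 2 by omega, neg_sq]
    congr 1
    refine Finset.sum_congr rfl fun l hl => ?_
    rw [show m + 1 + 1 - l = (m + 1 - l) + 1 by have := Finset.mem_range.1 hl; omega, pow_succ]
    ring
  induction N with
  | zero => simp [cascadeCoeff]
  | succ N ih =>
    have hsplit : ∀ q : ℕ → Prop, (∀ m ≤ N + 1, q m) ↔ (∀ m ≤ N, q m) ∧ q (N + 1) := fun q =>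
      ⟨fun h => ⟨fun m hm => h m (by omega), h _ le_rfl⟩, fun h m hm => by
        rcases Nat.le_succ_iff.1 hm with hm | rfl
        exacts [h.1 m hm, h.2]⟩
    refine (hsplit _).trans ((and_congr_left' ih).trans
      (Iff.trans (and_congr_right fun h => ?_) (hsplit _).symm))
    rw [hE, ← h N le_rfl, cascadeCoeff]
    constructor <;> intro h' <;> linarith

/-! ### Finite dimension, bilinearity and the splitting of the Robin form -/

namespace TriMesh

variable {M : TriMesh} {P : ℕ} {α γ : ℝ} {f g k u v w : Plane → ℝ}

/-- One chosen triangle per point turns a family of polynomials into a function. The image of this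
linear map is finite-dimensional and contains the space; that it also contains discontinuous
functions does no harm. -/
instance finiteDimensional_V (M : TriMesh) (P : ℕ) : FiniteDimensional ℝ (M.V P) := by
  classical
  have hT : ∀ x, ∃ t, x ∈ M.closedRegion → t ∈ M.els ∧ x ∈ (triOf t).carrier := by
    intro x
    by_cases hx : x ∈ M.closedRegion
    · obtain ⟨t, ht⟩ := M.mem_closedRegion.1 hx
      exact ⟨t, fun _ => ht⟩
    · exact ⟨∅, fun h => absurd h hx⟩
  choose T hT using hT
  let Ψ : (M.els → MvPolynomial.restrictTotalDegree (Fin 2) ℝ P) →ₗ[ℝ] (Plane → ℝ) :=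
    { toFun := fun p x => if h : x ∈ M.closedRegion then peval (p ⟨T x, (hT x h).1⟩) x else 0
      map_add' := fun p q => by
        funext x
        by_cases h : x ∈ M.closedRegion <;> simp [h, peval]
      map_smul' := fun c p => by
        funext x
        by_cases h : x ∈ M.closedRegion <;> simp [h, peval, MvPolynomial.smul_eval] }
  have hle : M.V P ≤ LinearMap.range Ψ := by
    intro u hu
    obtain ⟨p, hp⟩ := exists_isPiecewise hu
    refine ⟨fun t => ⟨p t, (MvPolynomial.mem_restrictTotalDegree _ _ _).2 (hp t t.2).1⟩, ?_⟩
    funext x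
    by_cases h : x ∈ M.closedRegion
    · simp only [Ψ, LinearMap.coe_mk, AddHom.coe_mk, h, dite_true]
      exact ((hp _ (hT x h).1).2 x (hT x h).2).symm
    · simp only [Ψ, LinearMap.coe_mk, AddHom.coe_mk, h, dite_false]
      exact (hu.2.2 x h).symm
  exact Submodule.finiteDimensional_of_le hle

theorem V_memLp_vol (hu : u ∈ M.V P) : MemLp u 2 M.vol := memLp_vol_of_continuousOn hu.1

theorem V_memLp_surf (hu : u ∈ M.V P) : MemLp u 2 M.surf := memLp_surf_of_continuousOn hu.1

theorem V_smul_add (hu : u ∈ M.V P) (hw : w ∈ M.V P) (c : ℝ) : c • u + w ∈ M.V P :=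
  (M.V P).add_mem ((M.V P).smul_mem c hu) hw

theorem ipΓ_comm (M : TriMesh) (f g : Plane → ℝ) : M.ipΓ f g = M.ipΓ g f := by
  simp only [ipΓ, mul_comm]

theorem ipΩ_comm (M : TriMesh) (f g : Plane → ℝ) : M.ipΩ f g = M.ipΩ g f := by
  simp only [ipΩ, mul_comm]

theorem ipΓ_smul_add_left (hf : MemLp f 2 M.surf) (hg : MemLp g 2 M.surf) (hk : MemLp k 2 M.surf)
    (c : ℝ) : M.ipΓ (c • f + g) k = c * M.ipΓ f k + M.ipΓ g k := by
  have h1 : Integrable (fun x => f x * k x) M.surf := hf.integrable_mul hk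
  have h2 : Integrable (fun x => g x * k x) M.surf := hg.integrable_mul hk
  rw [ipΓ, ipΓ, ipΓ, ← integral_const_mul, ← integral_add (h1.const_mul c) h2]
  refine integral_congr_ae (Eventually.of_forall fun x => ?_)
  simp only [Pi.add_apply, Pi.smul_apply, smul_eq_mul]
  ring

theorem ipΩ_smul_add_left (hf : MemLp f 2 M.vol) (hg : MemLp g 2 M.vol) (hk : MemLp k 2 M.vol)
    (c : ℝ) : M.ipΩ (c • f + g) k = c * M.ipΩ f k + M.ipΩ g k := by
  have h1 : Integrable (fun x => f x * k x) M.vol := hf.integrable_mul hk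
  have h2 : Integrable (fun x => g x * k x) M.vol := hg.integrable_mul hk
  rw [ipΩ, ipΩ, ipΩ, ← integral_const_mul, ← integral_add (h1.const_mul c) h2]
  refine integral_congr_ae (Eventually.of_forall fun x => ?_)
  simp only [Pi.add_apply, Pi.smul_apply, smul_eq_mul]
  ring

theorem ipΓ_dn_smul_add_left (hu : u ∈ M.V P) (hw : w ∈ M.V P) (hk : MemLp k 2 M.surf) (c : ℝ) :
    M.ipΓ (M.dn (c • u + w)) k = c * M.ipΓ (M.dn u) k + M.ipΓ (M.dn w) k := by
  rw [← ipΓ_smul_add_left (memLp_dn hu) (memLp_dn hw) hk]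
  refine integral_congr_ae ?_
  filter_upwards [dn_smul_add_ae hu hw c] with x hx
  simp only [hx, Pi.add_apply, Pi.smul_apply, smul_eq_mul]

theorem gradIp_comm (M : TriMesh) (u v : Plane → ℝ) : M.gradIp u v = M.gradIp v u := by
  simp only [gradIp, real_inner_comm]

theorem gradIp_smul_add_left (hu : u ∈ M.V P) (hw : w ∈ M.V P) (hv : v ∈ M.V P) (c : ℝ) :
    M.gradIp (c • u + w) v = c * M.gradIp u v + M.gradIp w v := by
  have h1 := integrable_inner_of_memLp (memLp_gradient hu) (memLp_gradient hv)
  have h2 := integrable_inner_of_memLp (memLp_gradient hw) (memLp_gradient hv)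
  rw [gradIp, gradIp, gradIp, ← integral_const_mul, ← integral_add (h1.const_mul c) h2]
  refine integral_congr_ae ?_
  filter_upwards [gradient_smul_add_ae hu hw c] with x hx
  rw [hx, inner_add_left, real_inner_smul_left]

theorem neumannForm_comm (M : TriMesh) (α γ : ℝ) (u v : Plane → ℝ) :
    M.neumannForm α γ u v = M.neumannForm α γ v u := by
  rw [neumannForm, neumannForm, formI, formI, gradIp_comm, ipΩ_comm, ipΓ_comm]

theorem neumannForm_smul_add_left (hu : u ∈ M.V P) (hw : w ∈ M.V P) (hv : v ∈ M.V P) (c : ℝ) :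
    M.neumannForm α γ (c • u + w) v =
      c * M.neumannForm α γ u v + M.neumannForm α γ w v := by
  simp only [neumannForm, formI]
  rw [gradIp_smul_add_left hu hw hv,
    ipΩ_smul_add_left (V_memLp_vol hu) (V_memLp_vol hw) (V_memLp_vol hv),
    ipΓ_dn_smul_add_left hu hw (memLp_dn hv)]
  ring

theorem neumannForm_smul_add_right (hu : u ∈ M.V P) (hw : w ∈ M.V P) (hv : v ∈ M.V P) (c : ℝ) :
    M.neumannForm α γ v (c • u + w) =
      c * M.neumannForm α γ v u + M.neumannForm α γ v w := by
  simp only [neumannForm_comm M α γ v]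
  exact neumannForm_smul_add_left hu hw hv c

theorem formN_eq (hg : MemLp g 2 M.surf) (hv : v ∈ M.V P) :
    M.formN γ g v = M.ipΓ g v / γ - M.ipΓ g (M.dn v) := by
  have h1 : Integrable (fun x => g x * v x) M.surf := hg.integrable_mul (V_memLp_surf hv)
  have h2 : Integrable (fun x => g x * M.dn v x) M.surf := hg.integrable_mul (memLp_dn hv)
  rw [formN, ipΓ, ipΓ, ipΓ, ← integral_div, ← integral_sub (h1.div_const γ) h2]
  refine integral_congr_ae (Eventually.of_forall fun x => ?_)
  simp only
  ring

theorem formN_smul_add_left (hf : MemLp f 2 M.surf) (hg : MemLp g 2 M.surf) (hv : v ∈ M.V P)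
    (c : ℝ) : M.formN γ (c • f + g) v = c * M.formN γ f v + M.formN γ g v := by
  rw [formN_eq ((hf.const_smul c).add hg) hv, formN_eq hf hv, formN_eq hg hv,
    ipΓ_smul_add_left hf hg (V_memLp_surf hv), ipΓ_smul_add_left hf hg (memLp_dn hv)]
  ring

theorem formN_sub_left (hf : MemLp f 2 M.surf) (hg : MemLp g 2 M.surf) (hv : v ∈ M.V P) :
    M.formN γ (f - g) v = M.formN γ f v - M.formN γ g v := by
  have := formN_smul_add_left (γ := γ) hg hf hv (-1)
  rw [neg_one_smul, neg_add_eq_sub] at this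
  rw [this]; ring

theorem formN_neg_left (M : TriMesh) (γ : ℝ) (f v : Plane → ℝ) :
    M.formN γ (-f) v = -M.formN γ f v := by
  simp only [formN, ipΓ, Pi.neg_apply, neg_mul, integral_neg]

theorem formN_smul_add_right (hg : MemLp g 2 M.surf) (hu : u ∈ M.V P) (hw : w ∈ M.V P) (c : ℝ) :
    M.formN γ g (c • u + w) = c * M.formN γ g u + M.formN γ g w := by
  rw [formN_eq hg (V_smul_add hu hw c), formN_eq hg hu, formN_eq hg hw, ipΓ_comm M g, ipΓ_comm M g,
    ipΓ_smul_add_left (V_memLp_surf hu) (V_memLp_surf hw) hg, ipΓ_dn_smul_add_left hu hw hg,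
    ipΓ_comm M g u, ipΓ_comm M g w, ipΓ_comm M g (M.dn u), ipΓ_comm M g (M.dn w)]
  ring

theorem formN_dn_smul_add_left (hu : u ∈ M.V P) (hw : w ∈ M.V P) (hv : v ∈ M.V P) (c : ℝ) :
    M.formN γ (M.dn (c • u + w)) v = c * M.formN γ (M.dn u) v + M.formN γ (M.dn w) v := by
  rw [← formN_smul_add_left (memLp_dn hu) (memLp_dn hw) hv]
  refine integral_congr_ae ?_
  filter_upwards [dn_smul_add_ae hu hw c] with x hx
  simp only [hx, Pi.add_apply, Pi.smul_apply, smul_eq_mul]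

/-- The bilinear form multiplying `γ / (γ + ε)` in the Robin form. -/
def robinPerturb (M : TriMesh) (γ : ℝ) (u v : Plane → ℝ) : ℝ :=
  M.formN γ u v - γ * M.formN γ (M.dn u) v

theorem robinPerturb_smul_add_left (hu : u ∈ M.V P) (hw : w ∈ M.V P) (hv : v ∈ M.V P) (c : ℝ) :
    M.robinPerturb γ (c • u + w) v = c * M.robinPerturb γ u v + M.robinPerturb γ w v := by
  simp only [robinPerturb]
  rw [formN_smul_add_left (V_memLp_surf hu) (V_memLp_surf hw) hv, formN_dn_smul_add_left hu hw hv]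
  ring

theorem robinPerturb_smul_add_right (hu : u ∈ M.V P) (hw : w ∈ M.V P) (hv : v ∈ M.V P) (c : ℝ) :
    M.robinPerturb γ v (c • u + w) = c * M.robinPerturb γ v u + M.robinPerturb γ v w := by
  simp only [robinPerturb]
  rw [formN_smul_add_right (V_memLp_surf hv) hu hw, formN_smul_add_right (memLp_dn hv) hu hw]
  ring

/-- The load of the Robin problem. -/
def robinLoad (M : TriMesh) (γ : ℝ) (f uRD qRN : Plane → ℝ) (ε : ℝ) (v : Plane → ℝ) : ℝ :=
  M.ipΩ f v + γ / (γ + ε) * M.formN γ uRD v + ε * γ / (γ + ε) * M.formN γ qRN v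

variable {uRD qRN : Plane → ℝ} {ε : ℝ}

/-- By `formN_eq`, `-(∂ₙu, v)_Γ` equals `-γ N_Γ(∂ₙu) - γ (∂ₙu, ∂ₙv)_Γ`. The last term completes
`neumannForm`, and `εγ/(γ+ε) - γ = -γ²/(γ+ε)` leaves a small multiple of `N_Γ(∂ₙu)`. -/
theorem robinResidual_eq (hγ : 0 < γ) (hε : 0 < ε) (hD : MemLp uRD 2 M.surf)
    (hN : MemLp qRN 2 M.surf) (hu : u ∈ M.V P) (hv : v ∈ M.V P) :
    M.robinResidual α γ f uRD qRN ε u v = M.neumannForm α γ u v +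
      γ / (γ + ε) * M.robinPerturb γ u v - M.robinLoad γ f uRD qRN ε v := by
  have h1 := formN_eq (γ := γ) (memLp_dn hu) hv
  rw [robinResidual, formN_sub_left (V_memLp_surf hu) hD hv, formN_sub_left (memLp_dn hu) hN hv,
    neumannForm, robinPerturb, robinLoad]
  have h2 : M.ipΓ (M.dn u) v =
      γ * (M.formN γ (M.dn u) v + M.ipΓ (M.dn u) (M.dn v)) := by
    rw [h1]; field_simp; ring
  rw [h2]
  have : γ + ε ≠ 0 := by positivity
  field_simp
  ring

theorem robinResidual_smul_add (hγ : 0 < γ) (hε : 0 < ε) (hD : MemLp uRD 2 M.surf)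
    (hN : MemLp qRN 2 M.surf) (hu : u ∈ M.V P) (hw : w ∈ M.V P) (hv : v ∈ M.V P) (c : ℝ) :
    M.robinResidual α γ f uRD qRN ε (c • u + w) v = M.robinResidual α γ f uRD qRN ε w v +
      c * (M.neumannForm α γ u v + γ / (γ + ε) * M.robinPerturb γ u v) := by
  rw [robinResidual_eq hγ hε hD hN (V_smul_add hu hw c) hv, robinResidual_eq hγ hε hD hN hw hv,
    neumannForm_smul_add_left hu hw hv, robinPerturb_smul_add_left hu hw hv]
  ring

theorem memLp_modeFlux {U : ℕ → Plane → ℝ} (hD : MemLp uRD 2 M.surf) (hN : MemLp qRN 2 M.surf)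
    {m : ℕ} (hU : ∀ l < m, U l ∈ M.V P) : MemLp (modeFlux uRD qRN U m) 2 M.surf := by
  match m with
  | 0 => exact hN
  | 1 => exact hD.sub (V_memLp_surf (hU 0 one_pos))
  | m + 2 => exact (V_memLp_surf (hU (m + 1) (by omega))).neg

/-- The load of the mode problem, without the error term. -/
def modeLoad (M : TriMesh) (γ : ℝ) (f uRD qRN : Plane → ℝ) (U : ℕ → Plane → ℝ) (m : ℕ)
    (v : Plane → ℝ) : ℝ :=
  M.ipΩ (modeSource f m) v + γ * M.formN γ (modeFlux uRD qRN U m) v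

theorem modeEq_iff {U : ℕ → Plane → ℝ} (hγ : 0 < γ) (hD : MemLp uRD 2 M.surf)
    (hN : MemLp qRN 2 M.surf) {m : ℕ} (hU : ∀ l < m, U l ∈ M.V P) {z : Plane → ℝ}
    (hz : z ∈ M.V P) (hv : v ∈ M.V P) : M.ModeEq α γ f uRD qRN U m z v ↔
      M.neumannForm α γ z v - M.modeLoad γ f uRD qRN U m v = M.errorTerm γ uRD qRN U m v := by
  have hq := memLp_modeFlux hD hN hU
  have h1 : M.ipΓ (M.dn z - modeFlux uRD qRN U m) (M.dn v) =
      M.ipΓ (M.dn z) (M.dn v) - M.ipΓ (modeFlux uRD qRN U m) (M.dn v) := by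
    have := ipΓ_smul_add_left hq (memLp_dn hz) (memLp_dn hv) (-1)
    rw [neg_one_smul, neg_add_eq_sub] at this
    rw [this]; ring
  rw [ModeEq, h1, neumannForm, modeLoad, formN_eq hq hv]
  have h2 : γ * (M.ipΓ (modeFlux uRD qRN U m) v / γ - M.ipΓ (modeFlux uRD qRN U m) (M.dn v)) =
      M.ipΓ (modeFlux uRD qRN U m) v - γ * M.ipΓ (modeFlux uRD qRN U m) (M.dn v) := by
    field_simp
  rw [h2]
  constructor <;> intro h <;> linarith

/-- The Robin residual of a partial sum of the expansion, in powers of `ε⁻¹`. -/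
theorem robinResidual_sum {U : ℕ → Plane → ℝ} {N : ℕ} (hγ : 0 < γ) (hε : 0 < ε)
    (hD : MemLp uRD 2 M.surf) (hN : MemLp qRN 2 M.surf) (hU : ∀ m ≤ N, U m ∈ M.V P)
    (hv : v ∈ M.V P) {B n : ℕ → ℝ}
    (hB : B = fun m => M.neumannForm α γ (U m) v - M.modeLoad γ f uRD qRN U m v)
    (hn : n = fun m => M.formN γ (M.dn (U m) - modeFlux uRD qRN U m) v) :
    (1 + γ * ε⁻¹) * M.robinResidual α γ f uRD qRN ε
        (∑ m ∈ Finset.range (N + 1), (ε⁻¹) ^ m • U m) v =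
      ∑ m ∈ Finset.range (N + 1), (ε⁻¹) ^ m * cascadeCoeff γ B n m +
        (ε⁻¹) ^ (N + 1) * (γ * B N - γ ^ 2 * n N - γ * M.formN γ (modeFlux uRD qRN U (N + 1)) v) := by
  -- Since `1 + γ * ε⁻¹ = (γ + ε) / ε`, this factor clears both denominators of the Robin form.
  have hτ : (1 + γ * ε⁻¹) * (γ / (γ + ε)) = γ * ε⁻¹ := by field_simp; ring
  have hτ' : (1 + γ * ε⁻¹) * (ε * γ / (γ + ε)) = γ := by field_simp; ring
  -- The remainder is `cascadeCoeff` at `N + 1` without the term `neumannForm (U (N + 1))`, which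
  -- the next mode supplies. That mode leaves a new remainder because `modeFlux` at `N + 2` is `-U
  -- (N + 1)`.
  induction N with
  | zero =>
    have h0 := hU 0 le_rfl
    rw [zero_add, Finset.sum_range_one, Finset.sum_range_one, pow_zero, one_smul,
      robinResidual_eq hγ hε hD hN h0 hv, robinLoad, robinPerturb]
    simp only [cascadeCoeff, hB, hn, modeLoad, modeSource, modeFlux]
    rw [formN_sub_left (memLp_dn h0) hN hv, formN_sub_left hD (V_memLp_surf h0) hv]
    linear_combination (M.formN γ (U 0) v - γ * M.formN γ (M.dn (U 0)) v - M.formN γ uRD v) * hτ -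
      M.formN γ qRN v * hτ'
  | succ N ih =>
    have ih' := ih fun m hm => hU m (by omega)
    have hk := hU (N + 1) le_rfl
    have hs : ∑ m ∈ Finset.range (N + 1), (ε⁻¹) ^ m • U m ∈ M.V P :=
      (M.V P).sum_mem fun m hm => (M.V P).smul_mem _
        (hU m (by have := Finset.mem_range.1 hm; omega))
    have hq : MemLp (modeFlux uRD qRN U (N + 1)) 2 M.surf :=
      memLp_modeFlux hD hN fun l hl => hU l (by omega)
    rw [Finset.sum_range_succ _ (N + 1), Finset.sum_range_succ _ (N + 1), add_comm _ (_ • U (N + 1)),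
      robinResidual_smul_add hγ hε hD hN hk hs hv, mul_add, ih']
    have hc : cascadeCoeff γ B n (N + 1) = B (N + 1) + γ * B N - γ ^ 2 * n N := rfl
    have hBN : B (N + 1) = M.neumannForm α γ (U (N + 1)) v -
        γ * M.formN γ (modeFlux uRD qRN U (N + 1)) v := by
      simp [hB, modeLoad, modeSource, ipΩ]
    have hnN : n (N + 1) = M.formN γ (M.dn (U (N + 1))) v -
        M.formN γ (modeFlux uRD qRN U (N + 1)) v := by
      rw [hn]; exact formN_sub_left (memLp_dn hk) hq hv
    have hqN : M.formN γ (modeFlux uRD qRN U (N + 1 + 1)) v = -M.formN γ (U (N + 1)) v :=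
      formN_neg_left M γ _ v
    rw [hc, hqN, hnN, hBN, robinPerturb]
    linear_combination ((ε⁻¹) ^ (N + 1) *
      (M.formN γ (U (N + 1)) v - γ * M.formN γ (M.dn (U (N + 1))) v)) * hτ

end TriMesh

/-! ### Cascade, coercivity, solvability and error bound -/

namespace TriMesh

variable {M : TriMesh} {P : ℕ} {α γ : ℝ} {f uRD qRN u v w : Plane → ℝ}

theorem forall_modeEq_iff {U : ℕ → Plane → ℝ} {N : ℕ} (hγ : 0 < γ) (hD : MemLp uRD 2 M.surf)
    (hN : MemLp qRN 2 M.surf) (hU : ∀ m ≤ N, U m ∈ M.V P) (hv : v ∈ M.V P) :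
    (∀ m ≤ N, M.ModeEq α γ f uRD qRN U m (U m) v) ↔ ∀ m ≤ N, cascadeCoeff γ
      (fun m => M.neumannForm α γ (U m) v - M.modeLoad γ f uRD qRN U m v)
      (fun m => M.formN γ (M.dn (U m) - modeFlux uRD qRN U m) v) m = 0 := by
  rw [cascadeCoeff_eq_zero_iff]
  refine forall₂_congr fun m hm => ?_
  rw [modeEq_iff hγ hD hN (fun l hl => hU l (by omega)) (hU m hm) hv, errorTerm]

/-- The factor `1 + γ * ε⁻¹` tends to `1`, so it is bounded with bounded inverse near infinity and
does not affect the order. The remainder of `robinResidual_sum` is itself `o(ε⁻ᴺ)`. -/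
theorem isLittleO_robinResidual_iff {U : ℕ → Plane → ℝ} {N : ℕ} (hγ : 0 < γ)
    (hD : MemLp uRD 2 M.surf) (hN : MemLp qRN 2 M.surf) (hU : ∀ m ≤ N, U m ∈ M.V P)
    (hv : v ∈ M.V P) :
    (fun ε : ℝ => M.robinResidual α γ f uRD qRN ε
      (∑ m ∈ Finset.range (N + 1), (ε⁻¹) ^ m • U m) v) =o[atTop] (fun ε : ℝ => (ε⁻¹) ^ N) ↔
      ∀ m ≤ N, M.ModeEq α γ f uRD qRN U m (U m) v := by
  rw [forall_modeEq_iff hγ hD hN hU hv, ← isLittleO_sum_inv_pow_iff]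
  set R : ℝ → ℝ := fun ε => M.robinResidual α γ f uRD qRN ε
    (∑ m ∈ Finset.range (N + 1), (ε⁻¹) ^ m • U m) v with hR
  set S : ℝ → ℝ := fun ε => ∑ m ∈ Finset.range (N + 1), (ε⁻¹) ^ m * cascadeCoeff γ
      (fun m => M.neumannForm α γ (U m) v - M.modeLoad γ f uRD qRN U m v)
      (fun m => M.formN γ (M.dn (U m) - modeFlux uRD qRN U m) v) m with hS
  obtain ⟨c, hc⟩ : ∃ c : ℝ, ∀ ε : ℝ, 0 < ε →
      (1 + γ * ε⁻¹) * R ε = S ε + (ε⁻¹) ^ (N + 1) * c :=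
    ⟨_, fun ε hε => robinResidual_sum hγ hε hD hN hU hv rfl rfl⟩
  have hlim : Tendsto (fun ε : ℝ => 1 + γ * ε⁻¹) atTop (𝓝 1) := by
    simpa using (tendsto_inv_atTop_zero.const_mul γ).const_add (1 : ℝ)
  have hO : (fun ε : ℝ => 1 + γ * ε⁻¹) =O[atTop] fun _ : ℝ => (1 : ℝ) := hlim.isBigO_one ℝ
  have hO' : (fun ε : ℝ => (1 + γ * ε⁻¹)⁻¹) =O[atTop] fun _ : ℝ => (1 : ℝ) :=
    (hlim.inv₀ one_ne_zero).isBigO_one ℝ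
  have htail : (fun ε : ℝ => (ε⁻¹) ^ (N + 1) * c) =o[atTop] fun ε : ℝ => (ε⁻¹) ^ N :=
    ((isLittleO_inv_pow_succ N).const_mul_left c).congr_left fun ε => mul_comm _ _
  constructor
  · intro h
    have h1 := (hO.mul_isLittleO h)
    simp only [one_mul] at h1
    refine (h1.sub htail).congr' ?_ EventuallyEq.rfl
    filter_upwards [eventually_gt_atTop 0] with ε hε
    rw [hc ε hε]; ring
  · intro h
    have h1 := hO'.mul_isLittleO (h.add htail)
    simp only [one_mul] at h1
    refine h1.congr' ?_ EventuallyEq.rfl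
    filter_upwards [eventually_gt_atTop 0] with ε hε
    have : 1 + γ * ε⁻¹ ≠ 0 := by positivity
    rw [← hc ε hε]; field_simp

theorem gradIp_self (M : TriMesh) (u : Plane → ℝ) :
    M.gradIp u u = ∫ x, ‖∇ u x‖ ^ 2 ∂M.vol := by
  simp only [gradIp, real_inner_self_eq_norm_sq]

theorem gradIp_self_nonneg (M : TriMesh) (u : Plane → ℝ) : 0 ≤ M.gradIp u u := by
  rw [gradIp_self]; exact integral_nonneg fun _ => by positivity

theorem ipΩ_self_nonneg (M : TriMesh) (u : Plane → ℝ) : 0 ≤ M.ipΩ u u :=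
  integral_nonneg fun _ => mul_self_nonneg _

theorem ipΓ_dn_self_le (hu : u ∈ M.V P) :
    M.ipΓ (M.dn u) (M.dn u) ≤ ∫ x, ‖M.gradTrace u x‖ ^ 2 ∂M.surf := by
  refine integral_mono ((memLp_dn hu).integrable_mul (memLp_dn hu)) ?_ fun x => ?_
  · simpa using (memLp_gradTrace hu).integrable_norm_pow (by norm_num)
  · have := M.abs_dn_le u x
    simp only
    rw [← sq, ← sq_abs]
    exact pow_le_pow_left₀ (abs_nonneg _) this 2

theorem neumannForm_self_ge {CI : ℝ} (hγ : 0 < γ) (hCI : M.IsTraceConstant P CI)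
    (hu : u ∈ M.V P) :
    (1 - M.h⁻¹ * CI * γ) * M.gradIp u u + α * M.ipΩ u u ≤ M.neumannForm α γ u u := by
  have h1 := hCI u hu
  have hh := M.h_pos
  rw [← gradIp_self] at h1
  have h2 : M.ipΓ (M.dn u) (M.dn u) ≤ M.h⁻¹ * (CI * M.gradIp u u) := by
    refine (ipΓ_dn_self_le hu).trans ?_
    rwa [← div_eq_inv_mul, le_div_iff₀ hh, mul_comm]
  have h3 := mul_le_mul_of_nonneg_left h2 hγ.le
  rw [neumannForm, formI]
  nlinarith

/-- Continuity turns almost everywhere into everywhere on `Ω`, density gives the closed region, and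
elements of `V` are zero elsewhere by convention. -/
theorem eq_zero_of_ipΩ_self (hu : u ∈ M.V P) (h : M.ipΩ u u = 0) : u = 0 := by
  have hi : Integrable (fun x => u x * u x) M.vol := (V_memLp_vol hu).integrable_mul (V_memLp_vol hu)
  have h1 := (integral_eq_zero_iff_of_nonneg (fun x => mul_self_nonneg (u x)) hi).1 h
  have h2 : u =ᵐ[(volume : Measure Plane).restrict M.Ω] fun _ => 0 := by
    filter_upwards [h1] with x hx
    exact mul_self_eq_zero.1 hx
  have h3 : EqOn u (fun _ => 0) M.Ω := Measure.eqOn_open_of_ae_eq h2 M.isOpen_Ω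
    (hu.1.mono M.Ω_subset) continuousOn_const
  have h4 : EqOn u (fun _ => 0) M.closedRegion :=
    h3.of_subset_closure hu.1 continuousOn_const M.Ω_subset M.closedRegion_subset_closure
  funext x
  by_cases hx : x ∈ M.closedRegion
  · exact h4 hx
  · exact hu.2.2 x hx

/-- The bilinear form of the mode problems on the finite element space. -/
def neumannBilin (M : TriMesh) (P : ℕ) (α γ : ℝ) : M.V P →ₗ[ℝ] M.V P →ₗ[ℝ] ℝ :=
  bilinOf (fun u v => M.neumannForm α γ u v)
    (fun c u w v => neumannForm_smul_add_left u.2 w.2 v.2 c)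
    (fun c u w v => neumannForm_smul_add_right u.2 w.2 v.2 c)

/-- The perturbation of the bilinear form in the Robin problem on the finite element space. -/
def perturbBilin (M : TriMesh) (P : ℕ) (γ : ℝ) : M.V P →ₗ[ℝ] M.V P →ₗ[ℝ] ℝ :=
  bilinOf (fun u v => M.robinPerturb γ u v)
    (fun c u w v => robinPerturb_smul_add_left u.2 w.2 v.2 c)
    (fun c u w v => robinPerturb_smul_add_right u.2 w.2 v.2 c)

theorem neumannBilin_apply (u v : M.V P) : neumannBilin M P α γ u v = M.neumannForm α γ u v := rfl

theorem perturbBilin_apply (u v : M.V P) : perturbBilin M P γ u v = M.robinPerturb γ u v := rfl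

theorem existsUnique_mem_V {q : (Plane → ℝ) → (Plane → ℝ) → Prop}
    (h : ∃! z : M.V P, ∀ v : M.V P, q z v) : ∃! z, z ∈ M.V P ∧ ∀ v ∈ M.V P, q z v := by
  obtain ⟨z, hz, hu⟩ := h
  refine ⟨z, ⟨z.2, fun v hv => hz ⟨v, hv⟩⟩, fun y hy => ?_⟩
  exact congrArg Subtype.val (hu ⟨y, hy.1⟩ fun v => hy.2 v v.2)

theorem ipΩ_smul_add_right (hf : MemLp f 2 M.vol) (hu : u ∈ M.V P) (hw : w ∈ M.V P) (c : ℝ) :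
    M.ipΩ f (c • u + w) = c * M.ipΩ f u + M.ipΩ f w := by
  rw [ipΩ_comm, ipΩ_smul_add_left (V_memLp_vol hu) (V_memLp_vol hw) hf, ipΩ_comm, ipΩ_comm M w]

theorem memLp_modeSource (hf : MemLp f 2 M.vol) : ∀ m, MemLp (modeSource f m) 2 M.vol
  | 0 => hf
  | _ + 1 => MemLp.zero

/-- Unique solvability of a mode problem. -/
theorem existsUnique_mode (hγ : 0 < γ) (ha : Function.Injective (neumannBilin M P α γ))
    (hf : MemLp f 2 M.vol) (hD : MemLp uRD 2 M.surf) (hN : MemLp qRN 2 M.surf)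
    {U : ℕ → Plane → ℝ} {m : ℕ} (hU : ∀ l < m, U l ∈ M.V P) :
    ∃! z, z ∈ M.V P ∧ ∀ v ∈ M.V P, M.ModeEq α γ f uRD qRN U m z v := by
  refine existsUnique_mem_V ?_
  have hq : ∀ l ≤ m, MemLp (modeFlux uRD qRN U l) 2 M.surf := fun l hl =>
    memLp_modeFlux hD hN fun k hk => hU k (by omega)
  obtain ⟨z, hz, hz'⟩ := existsUnique_of_injective _ ha (functionalOf
    (fun v : M.V P => M.modeLoad γ f uRD qRN U m v + M.errorTerm γ uRD qRN U m v) (by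
      intro c u w
      simp only [modeLoad, errorTerm, Submodule.coe_add, Submodule.coe_smul]
      rw [ipΩ_smul_add_right (memLp_modeSource hf m) u.2 w.2,
        formN_smul_add_right (hq m le_rfl) u.2 w.2]
      have : ∀ l ∈ Finset.range m, (-γ) ^ (m + 1 - l) *
          M.formN γ (M.dn (U l) - modeFlux uRD qRN U l) (c • (u : Plane → ℝ) + w) =
          c * ((-γ) ^ (m + 1 - l) * M.formN γ (M.dn (U l) - modeFlux uRD qRN U l) u) +
          (-γ) ^ (m + 1 - l) * M.formN γ (M.dn (U l) - modeFlux uRD qRN U l) w := by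
        intro l hl
        have hl' := Finset.mem_range.1 hl
        rw [formN_smul_add_right ((memLp_dn (hU l hl')).sub (hq l hl'.le)) u.2 w.2]
        ring
      rw [Finset.sum_congr rfl this, Finset.sum_add_distrib, ← Finset.mul_sum]
      ring))
  have key : ∀ z v : M.V P, M.ModeEq α γ f uRD qRN U m z v ↔ neumannBilin M P α γ z v =
      M.modeLoad γ f uRD qRN U m v + M.errorTerm γ uRD qRN U m v := fun z v => by
    rw [modeEq_iff hγ hD hN hU z.2 v.2, neumannBilin_apply, sub_eq_iff_eq_add']
  exact ⟨z, fun v => (key z v).2 (hz v), fun y hy => hz' y fun v => (key y v).1 (hy v)⟩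

theorem tendsto_div_add_atTop (γ : ℝ) : Tendsto (fun ε : ℝ => γ / (γ + ε)) atTop (𝓝 0) :=
  (tendsto_atTop_add_const_left atTop γ tendsto_id).const_div_atTop γ

theorem eventually_abs_div_le (γ : ℝ) {τ₀ : ℝ} (h : 0 < τ₀) :
    ∀ᶠ ε in atTop, |γ / (γ + ε)| ≤ τ₀ := by
  have := (tendsto_div_add_atTop γ).abs
  rw [abs_zero] at this
  exact this.eventually_le_const h

/-- Unique solvability of the Robin problem for large `ε`. -/
theorem eventually_existsUnique_robin (hγ : 0 < γ)
    (ha : Function.Injective (neumannBilin M P α γ))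
    (hf : MemLp f 2 M.vol) (hD : MemLp uRD 2 M.surf) (hN : MemLp qRN 2 M.surf) :
    ∀ᶠ ε in atTop, ∃! w, w ∈ M.V P ∧ ∀ v ∈ M.V P, M.robinResidual α γ f uRD qRN ε w v = 0 := by
  set e := Module.finBasis ℝ (M.V P)
  obtain ⟨τ₀, hτ₀, K, -, hK⟩ := exists_stable e _ (perturbBilin M P γ) ha
  filter_upwards [eventually_gt_atTop 0, eventually_abs_div_le γ hτ₀] with ε hε hτ
  have hinj : Function.Injective (neumannBilin M P α γ + (γ / (γ + ε)) • perturbBilin M P γ) := by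
    refine (injective_iff_map_eq_zero _).2 fun u hu => ?_
    -- Stability with `δ = 0` is injectivity of the perturbed form.
    have h0 := hK _ hτ u 0 le_rfl fun k => by
      have := LinearMap.congr_fun hu (e k)
      simp only [LinearMap.add_apply, LinearMap.smul_apply, smul_eq_mul,
        LinearMap.zero_apply] at this
      rw [this, abs_zero]
    refine e.repr.map_eq_zero_iff.1 (Finsupp.ext fun j => ?_)
    simpa using h0 j
  refine existsUnique_mem_V ?_
  obtain ⟨z, hz, hz'⟩ := existsUnique_of_injective _ hinj (functionalOf
    (fun v : M.V P => M.robinLoad γ f uRD qRN ε v) (by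
      intro c u w
      simp only [robinLoad, Submodule.coe_add, Submodule.coe_smul]
      rw [ipΩ_smul_add_right hf u.2 w.2, formN_smul_add_right hD u.2 w.2,
        formN_smul_add_right hN u.2 w.2]
      ring))
  have key : ∀ z v : M.V P, M.robinResidual α γ f uRD qRN ε z v = 0 ↔
      (neumannBilin M P α γ + (γ / (γ + ε)) • perturbBilin M P γ) z v =
      M.robinLoad γ f uRD qRN ε v := fun z v => by
    rw [robinResidual_eq hγ hε hD hN z.2 v.2, sub_eq_zero]
    rfl
  exact ⟨z, fun v => (key z v).2 (hz v), fun y hy => hz' y fun v => (key y v).1 (hy v)⟩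

theorem sum_mem_V {U : ℕ → Plane → ℝ} {N : ℕ} (hU : ∀ m ≤ N, U m ∈ M.V P) (c : ℕ → ℝ) :
    ∑ m ∈ Finset.range (N + 1), c m • U m ∈ M.V P :=
  (M.V P).sum_mem fun m hm => (M.V P).smul_mem _
    (hU m (by have := Finset.mem_range.1 hm; omega))

/-- The bilinear part of the Robin form at the difference of a Robin solution and a function. -/
theorem robin_sub_eq {ε : ℝ} (hγ : 0 < γ) (hε : 0 < ε) (hD : MemLp uRD 2 M.surf)
    (hN : MemLp qRN 2 M.surf) (hw : w ∈ M.V P) (hu : u ∈ M.V P) (hv : v ∈ M.V P)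
    (h : M.robinResidual α γ f uRD qRN ε w v = 0) :
    M.neumannForm α γ (w - u) v + γ / (γ + ε) * M.robinPerturb γ (w - u) v =
      -M.robinResidual α γ f uRD qRN ε u v := by
  have := robinResidual_smul_add (α := α) (f := f) hγ hε hD hN ((M.V P).sub_mem hw hu) hu hv 1
  rw [one_smul, sub_add_cancel, h] at this
  linarith

/-- The expansion approximates the Robin solutions, uniformly on the closed region. -/
theorem exists_error_bound (hγ : 0 < γ) (ha : Function.Injective (neumannBilin M P α γ))
    (hD : MemLp uRD 2 M.surf) (hN : MemLp qRN 2 M.surf) {U : ℕ → Plane → ℝ} {N : ℕ}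
    (hU : ∀ m ≤ N, U m ∈ M.V P)
    (hmode : ∀ m ≤ N, ∀ v ∈ M.V P, M.ModeEq α γ f uRD qRN U m (U m) v) :
    ∃ K : ℝ, ∀ᶠ ε in atTop, ∀ w ∈ M.V P,
      (∀ v ∈ M.V P, M.robinResidual α γ f uRD qRN ε w v = 0) →
      ∀ x ∈ M.closedRegion,
        |w x - ∑ m ∈ Finset.range (N + 1), (ε⁻¹) ^ m * U m x| ≤ K * (ε⁻¹) ^ (N + 1) := by
  set e := Module.finBasis ℝ (M.V P)
  obtain ⟨τ₀, hτ₀, K, hK0, hK⟩ := exists_stable e _ (perturbBilin M P γ) ha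
  -- The cascade kills all coefficients up to order `N`, so only the remainder survives. The factor
  -- `1 + γ * ε⁻¹ ≥ 1` can be dropped.
  have hres : ∀ v ∈ M.V P, ∃ c : ℝ, ∀ ε : ℝ, 0 < ε → |M.robinResidual α γ f uRD qRN ε
      (∑ m ∈ Finset.range (N + 1), (ε⁻¹) ^ m • U m) v| ≤ (ε⁻¹) ^ (N + 1) * |c| := by
    intro v hv
    have h0 := (forall_modeEq_iff hγ hD hN hU hv).1 fun m hm => hmode m hm v hv
    obtain ⟨c, hc⟩ : ∃ c : ℝ, ∀ ε : ℝ, 0 < ε → (1 + γ * ε⁻¹) *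
        M.robinResidual α γ f uRD qRN ε (∑ m ∈ Finset.range (N + 1), (ε⁻¹) ^ m • U m) v =
        ∑ m ∈ Finset.range (N + 1), (ε⁻¹) ^ m * cascadeCoeff γ
          (fun m => M.neumannForm α γ (U m) v - M.modeLoad γ f uRD qRN U m v)
          (fun m => M.formN γ (M.dn (U m) - modeFlux uRD qRN U m) v) m + (ε⁻¹) ^ (N + 1) * c :=
      ⟨_, fun ε hε => robinResidual_sum hγ hε hD hN hU hv rfl rfl⟩
    refine ⟨c, fun ε hε => ?_⟩
    have h1 := (hc ε hε).trans (congrArg (· + (ε⁻¹) ^ (N + 1) * c)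
      (Finset.sum_eq_zero fun m hm => mul_eq_zero_of_right _
        (h0 m (Nat.lt_succ_iff.1 (Finset.mem_range.1 hm)))))
    rw [zero_add] at h1
    have h2 : (1 : ℝ) ≤ |1 + γ * ε⁻¹| := by
      rw [abs_of_pos (by positivity)]
      have : 0 < γ * ε⁻¹ := by positivity
      linarith
    have h3 := congrArg abs h1
    rw [abs_mul, abs_mul, abs_of_pos (show 0 < (ε⁻¹) ^ (N + 1) by positivity)] at h3
    rw [← h3]
    exact le_mul_of_one_le_left (abs_nonneg _) h2
  choose c hc using fun k => hres (e k) (e k).2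
  have hbd : ∀ k, ∃ S : ℝ, ∀ x ∈ M.closedRegion, ‖(e k : Plane → ℝ) x‖ ≤ S := fun k =>
    M.isCompact_closedRegion.exists_bound_of_continuousOn (e k).2.1
  choose S hS using hbd
  -- The stability constant, times the residual bounds on the basis, times the sup bounds of the
  -- basis functions.
  refine ⟨K * (∑ k, |c k|) * ∑ j, |S j|, ?_⟩
  filter_upwards [eventually_gt_atTop 0, eventually_abs_div_le γ hτ₀] with ε hε hτ w hw hrob x hx
  have hs := sum_mem_V hU fun m => (ε⁻¹) ^ m
  set s := ∑ m ∈ Finset.range (N + 1), (ε⁻¹) ^ m • U m with hsdef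
  have hsx : s x = ∑ m ∈ Finset.range (N + 1), (ε⁻¹) ^ m * U m x := by
    simp [hsdef, Finset.sum_apply]
  set d : M.V P := ⟨w - s, (M.V P).sub_mem hw hs⟩ with hd
  have hδ : 0 ≤ (ε⁻¹) ^ (N + 1) * ∑ k, |c k| :=
    mul_nonneg (by positivity) (Finset.sum_nonneg fun _ _ => abs_nonneg _)
  have hcoef := hK _ hτ d _ hδ fun k => by
    rw [neumannBilin_apply, perturbBilin_apply,
      robin_sub_eq hγ hε hD hN hw hs (e k).2 (hrob _ (e k).2), abs_neg]
    refine (hc k ε hε).trans (mul_le_mul_of_nonneg_left ?_ (by positivity))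
    exact Finset.single_le_sum (f := fun k => |c k|) (fun _ _ => abs_nonneg _) (Finset.mem_univ k)
  have hdx : w x - s x = ∑ j, e.repr d j * (e j : Plane → ℝ) x := by
    have h1 := congrArg (fun z : M.V P => (z : Plane → ℝ) x) (e.sum_repr d)
    simp only [Submodule.coe_sum, Finset.sum_apply, Submodule.coe_smul, Pi.smul_apply,
      smul_eq_mul] at h1
    rw [h1]; rfl
  rw [← hsx, hdx]
  calc |∑ j, e.repr d j * (e j : Plane → ℝ) x| ≤ ∑ j, |e.repr d j * (e j : Plane → ℝ) x| :=
        Finset.abs_sum_le_sum_abs _ _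
    _ ≤ ∑ j, K * ((ε⁻¹) ^ (N + 1) * ∑ k, |c k|) * |S j| := by
        refine Finset.sum_le_sum fun j _ => ?_
        rw [abs_mul]
        exact mul_le_mul (hcoef j) ((hS j x hx).trans (le_abs_self _)) (abs_nonneg _)
          (mul_nonneg hK0 hδ)
    _ = _ := by rw [← Finset.mul_sum]; ring

/-- On the finite element space, pointwise smallness implies smallness of linear functionals. -/
theorem isLittleO_functional (L : M.V P →ₗ[ℝ] ℝ) {d : ℝ → M.V P} {N : ℕ}
    (hd : ∀ x, (fun ε => (d ε : Plane → ℝ) x) =o[atTop] fun ε : ℝ => (ε⁻¹) ^ N) :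
    (fun ε => L (d ε)) =o[atTop] fun ε : ℝ => (ε⁻¹) ^ N := by
  obtain ⟨c, hc⟩ := exists_eval_repr (M.V P) L
  simp only [hc, Finsupp.sum]
  exact IsLittleO.fun_sum fun x _ => (hd x).const_mul_left (c x)

/-- The modes of an asymptotic expansion of Robin solutions solve the cascade. -/
theorem modeEq_of_expansion (hγ : 0 < γ) (hD : MemLp uRD 2 M.surf) (hN : MemLp qRN 2 M.surf)
    {U : ℕ → Plane → ℝ} {N : ℕ} {W : ℝ → Plane → ℝ} (hU : ∀ m ≤ N, U m ∈ M.V P)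
    (hW : ∀ᶠ ε in atTop, W ε ∈ M.V P ∧
      ∀ v ∈ M.V P, M.robinResidual α γ f uRD qRN ε (W ε) v = 0)
    (hexp : ∀ x ∈ M.closedRegion,
      (fun ε : ℝ => W ε x - ∑ m ∈ Finset.range (N + 1), (ε⁻¹) ^ m * U m x)
        =o[atTop] fun ε : ℝ => (ε⁻¹) ^ N) (hv : v ∈ M.V P) :
    ∀ m ≤ N, M.ModeEq α γ f uRD qRN U m (U m) v := by
  classical
  rw [← isLittleO_robinResidual_iff hγ hD hN hU hv]
  have hs := fun ε : ℝ => sum_mem_V hU fun m => (ε⁻¹) ^ m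
  -- The value `0` is used only where `W ε` is not in the space, which does not happen for large
  -- `ε`.
  let d : ℝ → M.V P := fun ε => if h : W ε ∈ M.V P then
    ⟨W ε - ∑ m ∈ Finset.range (N + 1), (ε⁻¹) ^ m • U m, (M.V P).sub_mem h (hs ε)⟩ else 0
  have hdW : ∀ᶠ ε in atTop, (d ε : Plane → ℝ) =
      W ε - ∑ m ∈ Finset.range (N + 1), (ε⁻¹) ^ m • U m := by
    filter_upwards [hW] with ε hε
    simp only [d, hε.1, dite_true]
  have hd : ∀ x, (fun ε => (d ε : Plane → ℝ) x) =o[atTop] fun ε : ℝ => (ε⁻¹) ^ N := by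
    intro x
    by_cases hx : x ∈ M.closedRegion
    · refine (hexp x hx).congr' ?_ EventuallyEq.rfl
      filter_upwards [hdW] with ε hε
      rw [hε]
      simp [Finset.sum_apply]
    · refine (isLittleO_zero _ _).congr_left fun ε => ?_
      exact ((d ε).2.2.2 x hx).symm
  have ha := isLittleO_functional ((neumannBilin M P α γ).flip ⟨v, hv⟩) hd
  have hb := isLittleO_functional ((perturbBilin M P γ).flip ⟨v, hv⟩) hd
  have hτ : (fun ε : ℝ => γ / (γ + ε)) =O[atTop] fun _ : ℝ => (1 : ℝ) :=
    (tendsto_div_add_atTop γ).isBigO_one ℝ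
  have hτb := hτ.mul_isLittleO hb
  simp only [one_mul] at hτb
  refine (ha.add hτb).neg_left.congr' ?_ EventuallyEq.rfl
  -- The residual of the partial sum is minus the perturbed bilinear form at the difference `d ε`,
  -- whose two parts are already known to be `o(ε⁻ᴺ)`.
  filter_upwards [hdW, hW, eventually_gt_atTop 0] with ε hdε hWε hε
  simp only [LinearMap.flip_apply, neumannBilin_apply, perturbBilin_apply, hdε]
  rw [robin_sub_eq hγ hε hD hN hWε.1 (hs ε) hv (hWε.2 v hv), neg_neg]

/-- Classical solutions of the mode problems solve the cascade, with vanishing error terms. -/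
theorem IsClassicalNeumann.modeEq {U : ℕ → Plane → ℝ} {m : ℕ} (hf : MemLp f 2 M.vol)
    (hU : ∀ l ≤ m, M.IsClassicalNeumann α (modeSource f l) (modeFlux uRD qRN U l) (U l))
    (hv : v ∈ M.V P) :
    M.ModeEq α γ f uRD qRN U m (U m) v ∧ M.errorTerm γ uRD qRN U m v = 0 := by
  -- The flux agrees almost everywhere with its Neumann datum. This removes both the error term and
  -- the `γ` term, leaving Green's formula.
  have hz : ∀ l ≤ m, ∀ g, M.ipΓ (M.dn (U l) - modeFlux uRD qRN U l) g = 0 := by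
    intro l hl g
    refine integral_eq_zero_of_ae ?_
    filter_upwards [(hU l hl).flux] with x hx
    simp [hx]
  have hE : M.errorTerm γ uRD qRN U m v = 0 := by
    refine Finset.sum_eq_zero fun l hl => ?_
    rw [formN, hz l (Finset.mem_range.1 hl).le, mul_zero]
  refine ⟨?_, hE⟩
  rw [ModeEq, hE, hz m le_rfl, mul_zero, sub_zero]
  exact (hU m le_rfl).green (memLp_modeSource hf m) hv

end TriMesh

end NitscheRobin

end

/-! ### Assembly of the proposition -/

theorem proposition4p2 (P : ℕ) :
    -- the trace inequality, with a constant depending only on `P` and the mesh regularity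
    (∀ κ : ℝ, 0 < κ → ∃ CI : ℝ, 0 < CI ∧ ∀ M : TriMesh, M.IsRegular κ → M.IsTraceConstant P CI) ∧
    ∀ (M : TriMesh) (α γ : ℝ), 0 < γ → ∀ f uRD qRN : Plane → ℝ,
      MemLp f 2 M.vol → MemLp uRD 2 M.surf → MemLp qRN 2 M.surf →
      -- inserting the ansatz into the Robin form and equating powers of `ε⁻¹` gives the cascade
      (∀ (u : ℕ → Plane → ℝ) (N : ℕ), (∀ m ≤ N, u m ∈ M.V P) →
        ((∀ v ∈ M.V P,
            (fun ε : ℝ => M.robinResidual α γ f uRD qRN ε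
              (∑ m ∈ Finset.range (N + 1), (ε⁻¹) ^ m • u m) v) =o[atTop] fun ε : ℝ => (ε⁻¹) ^ N) ↔
          ∀ m ≤ N, ∀ v ∈ M.V P, M.ModeEq α γ f uRD qRN u m (u m) v)) ∧
      -- the modes of an asymptotic expansion of Robin solutions solve the cascade
      (∀ (u : ℕ → Plane → ℝ) (N : ℕ) (w : ℝ → Plane → ℝ), (∀ m ≤ N, u m ∈ M.V P) →
        (∀ᶠ ε in atTop, w ε ∈ M.V P ∧ ∀ v ∈ M.V P, M.robinResidual α γ f uRD qRN ε (w ε) v = 0) →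
        (∀ x ∈ M.closedRegion,
          (fun ε : ℝ => w ε x - ∑ m ∈ Finset.range (N + 1), (ε⁻¹) ^ m * u m x)
            =o[atTop] fun ε : ℝ => (ε⁻¹) ^ N) →
        ∀ m ≤ N, ∀ v ∈ M.V P, M.ModeEq α γ f uRD qRN u m (u m) v) ∧
      -- consistency with the Neumann problems of the exact modes
      (∀ (u : ℕ → Plane → ℝ) (N : ℕ),
        (∀ m ≤ N, M.IsClassicalNeumann α (modeSource f m) (modeFlux uRD qRN u m) (u m)) →
        ∀ m ≤ N, ∀ v ∈ M.V P,
          M.ModeEq α γ f uRD qRN u m (u m) v ∧ M.errorTerm γ uRD qRN u m v = 0) ∧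
      -- coercivity, and solvability of the cascade
      (∀ CI C : ℝ, M.IsTraceConstant P CI → 0 < C → C ≤ 1 - M.h⁻¹ * CI * γ →
        (∀ u ∈ M.V P, (1 - M.h⁻¹ * CI * γ) * M.gradIp u u + α * M.ipΩ u u ≤ M.neumannForm α γ u u ∧
          C * M.gradIp u u + α * M.ipΩ u u ≤ M.neumannForm α γ u u) ∧
        (0 < α →
          (∀ u ∈ M.V P, min C α * (M.gradIp u u + M.ipΩ u u) ≤ M.neumannForm α γ u u) ∧
          (∀ (u : ℕ → Plane → ℝ) (m : ℕ), (∀ l < m, u l ∈ M.V P) →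
            ∃! z, z ∈ M.V P ∧ ∀ v ∈ M.V P, M.ModeEq α γ f uRD qRN u m z v) ∧
          (∀ᶠ ε in atTop, ∃! w, w ∈ M.V P ∧
            ∀ v ∈ M.V P, M.robinResidual α γ f uRD qRN ε w v = 0) ∧
          (∀ (u : ℕ → Plane → ℝ) (N : ℕ), (∀ m ≤ N, u m ∈ M.V P) →
            (∀ m ≤ N, ∀ v ∈ M.V P, M.ModeEq α γ f uRD qRN u m (u m) v) →
            ∃ K : ℝ, ∀ᶠ ε in atTop, ∀ w ∈ M.V P,
              (∀ v ∈ M.V P, M.robinResidual α γ f uRD qRN ε w v = 0) →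
              ∀ x ∈ M.closedRegion,
                |w x - ∑ m ∈ Finset.range (N + 1), (ε⁻¹) ^ m * u m x| ≤ K * (ε⁻¹) ^ (N + 1)))) := by
  refine ⟨fun κ hκ => TriMesh.exists_isTraceConstant P hκ, ?_⟩
  intro M α γ hγ f uRD qRN hf hD hN
  refine ⟨fun u N hu => ⟨fun h m hm v hv => ?_, fun h v hv => ?_⟩,
    fun u N w hu hw hexp m hm v hv => TriMesh.modeEq_of_expansion hγ hD hN hu hw hexp hv m hm,
    fun u N hu m hm v hv =>
      TriMesh.IsClassicalNeumann.modeEq hf (fun l hl => hu l (hl.trans hm)) hv,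
    fun CI C hCI hC hle => ?_⟩
  · exact (TriMesh.isLittleO_robinResidual_iff hγ hD hN hu hv).1 (h v hv) m hm
  · exact (TriMesh.isLittleO_robinResidual_iff hγ hD hN hu hv).2 fun m hm => h m hm v hv
  have hcoer : ∀ u ∈ M.V P, C * M.gradIp u u + α * M.ipΩ u u ≤ M.neumannForm α γ u u := by
    intro u hu
    refine le_trans ?_ (TriMesh.neumannForm_self_ge hγ hCI hu)
    gcongr
    exact M.gradIp_self_nonneg u
  refine ⟨fun u hu => ⟨TriMesh.neumannForm_self_ge hγ hCI hu, hcoer u hu⟩, fun hα => ?_⟩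
  have ha : Function.Injective (TriMesh.neumannBilin M P α γ) := by
    refine injective_of_pos _ fun u hu => ?_
    rw [TriMesh.neumannBilin_apply]
    refine lt_of_lt_of_le ?_ (hcoer u u.2)
    -- Definiteness rests on the `α` term alone; the gradient term need only be nonnegative.
    have hpos : 0 < M.ipΩ u u := (M.ipΩ_self_nonneg u).lt_of_ne' fun h0 =>
      hu (Subtype.ext (TriMesh.eq_zero_of_ipΩ_self u.2 h0))
    exact add_pos_of_nonneg_of_pos (mul_nonneg hC.le (M.gradIp_self_nonneg u)) (mul_pos hα hpos)
  refine ⟨fun u hu => le_trans ?_ (hcoer u hu),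
    fun u m hu => TriMesh.existsUnique_mode hγ ha hf hD hN hu,
    TriMesh.eventually_existsUnique_robin hγ ha hf hD hN,
    fun u N hu hmode => TriMesh.exists_error_bound hγ ha hD hN hu hmode⟩
  rw [mul_add]
  exact add_le_add (mul_le_mul_of_nonneg_right (min_le_left _ _) (M.gradIp_self_nonneg u))
    (mul_le_mul_of_nonneg_right (min_le_right _ _) (M.ipΩ_self_nonneg u))
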